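/- Work over a set of simple types built from a nonempty set of base types, with typed constants; terms are simply typed $\lambda$-terms modulo $\alpha\beta\eta$, and a complete set of unifiers $csu(s\doteq t)$ is fixed for every unification problem, with $csu(t\doteq t)=\{\mathrm{id}\}$. Predicate operators $B=\lambda p\lambda\vec x.\,B\,p\,\vec x$ are monotonic (no negated occurrence of a predicate variable) and have no free term variables. $\mu$MALL is first-order multiplicative-additive linear logic with $=$, $\neq$ (whose rule has one premise for each $\theta\in csu(s\doteq t)$) and least and greatest fixed points, with the rules $$\frac{\Sigma;\vdash\Gamma,B(\mu B)\vec t}{\Sigma;\vdash\Gamma,\mu B\vec t}\qquad \frac{\Sigma;\vdash\Gamma,T\vec t\qquad \vec x;\vdash B\,T\,\vec x,(T\vec x)^\perp}{\Sigma;\vdash\Gamma,\nu B\vec t}\quad(T\text{ a closed predicate}).$$ Negation $(\cdot)^\perp$ is De Morgan duality, with $(\nu B\vec t)^\perp=\mu\overline B\vec t$ and $\overline B=\lambda p\lambda\vec x.(B\,p^\perp\,\vec x)^\perp$. The fragments $\mathcal H$ and $\mathcal G$ of intuitionistic formulas are $$\mathcal H::=\mathcal H\wedge\mathcal H\mid\mathcal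 H\vee\mathcal H\mid s=t\mid\exists x.\mathcal H\mid\mu(\lambda p\lambda\vec x.\mathcal H)\vec t\mid p\vec t,$$ $$\mathcal G::=\mathcal G\wedge\mathcal G\mid\mathcal G\vee\mathcal G\mid s=t\mid\exists x.\mathcal G\mid\mu(\lambda p\lambda\vec x.\mathcal G)\vec t\mid p\vec t\mid\forall x.\mathcal G\mid\mathcal H\supset\mathcal G\mid\nu(\lambda p\lambda\vec x.\mathcal G)\vec t .$$ $\mu$LJL is the intuitionistic sequent calculus on sequents $\Sigma;\Gamma\vdash P$ with hypotheses in $\mathcal H$ and goal in $\mathcal G$, with contraction and weakening, the initial rule $\Gamma,\mu B\vec t\vdash\mu B\vec t$, the usual left rules for $\wedge,\vee,\exists$ and right rules for $\wedge,\vee,\supset,=,\exists,\forall$, the left rule for $s=t$ with one premise $(\Gamma\vdash P)\theta$ for each $\theta\in csu(s\doteq t)$, the unfolding of $\mu$ on the right, and, for closed predicates $S$ in $\mathcal H$, $$\frac{\Gamma,S\vec t\vdash P\qquad B\,S\,\vec x\vdash S\vec x}{\Gamma,\mu B\vec t\vdash P}\qquad\frac{\Gamma\vdash S\vec t\qquad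 S\vec x\vdash B\,S\,\vec x}{\Gamma\vdash\nu B\vec t}.$$ The encoding $[\cdot]$ into $\mu$MALL sends $\wedge,\vee,\supset$ to $\otimes,\oplus,\multimap$ (where $A\multimap C$ is the multiplicative disjunction of $A^\perp$ and $C$) and commutes with $=,\exists,\forall,\mu,\nu$ and predicate variables. A derivation is quasi-finite if it is cut-free, has finite height and uses only finitely many different (co)invariants. **Proposition.** Let $\Sigma$ be a signature, $\Gamma$ a finite multiset of $\mathcal H$-formulas and $P$ a $\mathcal G$-formula under $\Sigma$, without free predicate variables. Then $\Sigma;\Gamma\vdash P$ has a quasi-finite $\mu$LJL derivation if and only if $\Sigma;\vdash[\Gamma]^\perp,[P]$ has a quasi-finite $\mu$MALL derivation in which all (co)invariants are encodings of closed predicates $S$ in $\mathcal H$, in the following sense: at every instance of the $\nu$ rule, on $\nu C\vec t$ with coinvariant $T$, there is such an $S$ for which either $C=\overline{[B]}$ for an operator $B$ in $\mathcal H$ and $T=[S]^\perp$ (induction on the negation of $\mu[B]\vec t$, with invariant $[S]$), or $C=[B]$ for an operator $B$ in $\mathcal G$ and $T=[S]$ (coinduction with coinvariant $[S]$). -/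

import Mathlib

/-!
  The first-order linear logic with least and greatest fixed points (muMALL), the fragment muLJL of
  intuitionistic logic with fixed points, and the encoding of the second into the first.

  Conventions.  Terms are simply typed lambda-terms modulo beta-eta; binding is represented by
  well-scoped, well-typed de Bruijn variables, so a signature is a list of types and a term
  or a formula is indexed by the signature under which it is well-formed.
-/

namespace MuMALL

universe u v w

/-! ### Types, variables, raw terms -/

/-- The simple types over a set of base types (none of them is the type of formulas). -/
inductive Ty (B : Type u) : Type u
  | base (b : B) : Ty B
  | arr (a c : Ty B) : Ty B

/-- `Var l a`: the positions of the list `l` that hold `a` (typed de Bruijn variables). -/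
inductive Var {K : Type u} : List K → K → Type u
  | zero {a : K} {l : List K} : Var (a :: l) a
  | succ {a b : K} {l : List K} (x : Var l a) : Var (b :: l) a

/-- Base types, typed term constants, and atoms (predicate constants) with the types of their
arguments: the external, toplevel signature. -/
structure Vocabulary where
  Base : Type u
  Const : Ty Base → Type v
  Atom : Type w
  arity : Atom → List (Ty Base)

variable {L : Vocabulary.{u, v, w}}

/-- A signature of universal variables; also the list of argument types of a predicate. -/
abbrev Ctx (L : Vocabulary.{u, v, w}) : Type u := List (Ty L.Base)

/-- A context of predicate variables, each given by the list of its argument types. -/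
abbrev PCtx (L : Vocabulary.{u, v, w}) : Type u := List (Ctx L)

/-- Simply typed lambda-terms, before conversion. -/
inductive RawTm (L : Vocabulary.{u, v, w}) : Ctx L → Ty L.Base → Type (max u v)
  | var {V : Ctx L} {a : Ty L.Base} (x : Var V a) : RawTm L V a
  | const {V : Ctx L} {a : Ty L.Base} (c : L.Const a) : RawTm L V a
  | lam {V : Ctx L} {a c : Ty L.Base} (t : RawTm L (a :: V) c) : RawTm L V (Ty.arr a c)
  | app {V : Ctx L} {a c : Ty L.Base} (t : RawTm L V (Ty.arr a c)) (s : RawTm L V a) :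
      RawTm L V c

/-- Renamings of variables. -/
abbrev Ren {K : Type u} (l m : List K) : Type u := ∀ ⦃a : K⦄, Var l a → Var m a

/-- Extension of a renaming under a binder. -/
def Ren.lift {K : Type u} {l m : List K} (ρ : Ren l m) (b : K) : Ren (b :: l) (b :: m)
  | _, .zero => .zero
  | _, .succ x => .succ (ρ x)

namespace RawTm

/-- Raw substitutions. -/
abbrev RSub (L : Vocabulary.{u, v, w}) (V W : Ctx L) : Type (max u v) :=
  ∀ ⦃a : Ty L.Base⦄, Var V a → RawTm L W a

def rename {V W : Ctx L} {a : Ty L.Base} : RawTm L V a → Ren V W → RawTm L W a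
  | var x, ρ => var (ρ x)
  | const c, _ => const c
  | lam t, ρ => lam (t.rename (ρ.lift _))
  | app t s, ρ => app (t.rename ρ) (s.rename ρ)

def RSub.lift {V W : Ctx L} (σ : RSub L V W) (b : Ty L.Base) : RSub L (b :: V) (b :: W)
  | _, .zero => var .zero
  | _, .succ x => (σ x).rename (fun _ y => .succ y)

/-- Capture-avoiding simultaneous substitution. -/
def subst {V W : Ctx L} {a : Ty L.Base} : RawTm L V a → RSub L V W → RawTm L W a
  | var x, σ => σ x
  | const c, _ => const c
  | lam t, σ => lam (t.subst (σ.lift _))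
  | app t s, σ => app (t.subst σ) (s.subst σ)

/-- The substitution of a term for the last variable. -/
def RSub.single {V : Ctx L} {b : Ty L.Base} (s : RawTm L V b) : RSub L (b :: V) V
  | _, .zero => s
  | _, .succ x => var x

/-- Beta-eta-conversion (alpha-conversion is the identity in this representation). -/
inductive Conv : ∀ {V : Ctx L} {a : Ty L.Base}, RawTm L V a → RawTm L V a → Prop
  | refl {V : Ctx L} {a : Ty L.Base} (t : RawTm L V a) : Conv t t
  | symm {V : Ctx L} {a : Ty L.Base} {t s : RawTm L V a} : Conv t s → Conv s t
  | trans {V : Ctx L} {a : Ty L.Base} {t s r : RawTm L V a} : Conv t s → Conv s r → Conv t r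
  | lam {V : Ctx L} {a c : Ty L.Base} {t s : RawTm L (a :: V) c} :
      Conv t s → Conv (RawTm.lam t) (RawTm.lam s)
  | app {V : Ctx L} {a c : Ty L.Base} {t t' : RawTm L V (Ty.arr a c)} {s s' : RawTm L V a} :
      Conv t t' → Conv s s' → Conv (RawTm.app t s) (RawTm.app t' s')
  | beta {V : Ctx L} {a c : Ty L.Base} (t : RawTm L (a :: V) c) (s : RawTm L V a) :
      Conv (RawTm.app (RawTm.lam t) s) (t.subst (RSub.single s))
  | eta {V : Ctx L} {a c : Ty L.Base} (t : RawTm L V (Ty.arr a c)) :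
      Conv (RawTm.lam (RawTm.app (t.rename (fun _ y => .succ y)) (RawTm.var .zero))) t

/-! Substitution is compatible with conversion. -/

theorem rename_rename {V W X : Ctx L} {a : Ty L.Base} (t : RawTm L V a) (ρ : Ren V W)
    (ρ' : Ren W X) : (t.rename ρ).rename ρ' = t.rename (fun _ x => ρ' (ρ x)) := by
  induction t generalizing W X with
  | var x => rfl
  | const c => rfl
  | lam t ih =>
    simp only [rename, ih]
    congr 2
    funext b x
    cases x <;> rfl
  | app t s iht ihs => simp only [rename, iht, ihs]

theorem rename_subst {V W X : Ctx L} {a : Ty L.Base} (t : RawTm L V a) (ρ : Ren V W)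
    (σ : RSub L W X) : (t.rename ρ).subst σ = t.subst (fun _ x => σ (ρ x)) := by
  induction t generalizing W X with
  | var x => rfl
  | const c => rfl
  | lam t ih =>
    simp only [rename, subst, ih]
    congr 2
    funext b x
    cases x <;> rfl
  | app t s iht ihs => simp only [rename, subst, iht, ihs]

theorem subst_rename {V W X : Ctx L} {a : Ty L.Base} (t : RawTm L V a) (σ : RSub L V W)
    (ρ : Ren W X) : (t.subst σ).rename ρ = t.subst (fun _ x => (σ x).rename ρ) := by
  induction t generalizing W X with
  | var x => rfl
  | const c => rfl
  | lam t ih =>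
    simp only [rename, subst, ih]
    congr 2
    funext b x
    cases x with
    | zero => rfl
    | succ x => simp only [RSub.lift, rename_rename]; rfl
  | app t s iht ihs => simp only [rename, subst, iht, ihs]

theorem subst_subst {V W X : Ctx L} {a : Ty L.Base} (t : RawTm L V a) (σ : RSub L V W)
    (τ : RSub L W X) : (t.subst σ).subst τ = t.subst (fun _ x => (σ x).subst τ) := by
  induction t generalizing W X with
  | var x => rfl
  | const c => rfl
  | lam t ih =>
    simp only [subst, ih]
    congr 2
    funext b x
    cases x with
    | zero => rfl
    | succ x => simp only [RSub.lift, rename_subst, subst_rename]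
  | app t s iht ihs => simp only [subst, iht, ihs]

theorem subst_var {V : Ctx L} {a : Ty L.Base} (t : RawTm L V a) :
    t.subst (fun _ x => var x) = t := by
  induction t with
  | var x => rfl
  | const c => rfl
  | lam t ih =>
    simp only [subst]
    congr 1
    rw [show (RSub.lift (fun _ x => var x) _ : RSub L _ _) = fun _ x => var x from ?_]
    · exact ih
    · funext b x
      cases x <;> rfl
  | app t s iht ihs => simp only [subst, iht, ihs]

theorem rename_eq_subst {V W : Ctx L} {a : Ty L.Base} (t : RawTm L V a) (ρ : Ren V W) :
    t.rename ρ = t.subst (fun _ x => var (ρ x)) := by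
  have h := rename_subst t ρ (fun _ x => var x)
  rwa [subst_var] at h

theorem Conv.subst {V W : Ctx L} {a : Ty L.Base} {t s : RawTm L V a} (h : Conv t s)
    (σ : RSub L V W) : Conv (t.subst σ) (s.subst σ) := by
  induction h generalizing W with
  | refl t => exact .refl _
  | symm _ ih => exact .symm (ih σ)
  | trans _ _ ih₁ ih₂ => exact .trans (ih₁ σ) (ih₂ σ)
  | lam _ ih => exact .lam (ih _)
  | app _ _ ih₁ ih₂ => exact .app (ih₁ σ) (ih₂ σ)
  | beta t s =>
    have h := Conv.beta (t.subst (σ.lift _)) (s.subst σ)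
    rw [subst_subst] at h
    simp only [RawTm.subst, subst_subst]
    convert h using 2
    funext b x
    cases x with
    | zero => rfl
    | succ x =>
      simp only [RSub.lift, RSub.single, rename_subst, RawTm.subst]
      exact (subst_var _).symm
  | eta t =>
    have h := Conv.eta (t.subst σ)
    simp only [RawTm.subst, rename_subst, subst_rename] at h ⊢
    exact h

theorem Conv.subst_congr {V W : Ctx L} {a : Ty L.Base} (t : RawTm L V a) {σ τ : RSub L V W}
    (h : ∀ ⦃b : Ty L.Base⦄ (x : Var V b), Conv (σ x) (τ x)) :
    Conv (t.subst σ) (t.subst τ) := by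
  induction t generalizing W with
  | var x => exact h x
  | const c => exact .refl _
  | lam t ih =>
    refine .lam (ih ?_)
    intro b x
    cases x with
    | zero => exact .refl _
    | succ x =>
      simp only [RSub.lift, rename_eq_subst]
      exact (h x).subst _
  | app t s iht ihs => exact .app (iht h) (ihs h)

end RawTm

/-! ### Terms and substitutions -/

/-- Convertibility as an equivalence relation. -/
def convSetoid (L : Vocabulary.{u, v, w}) (V : Ctx L) (a : Ty L.Base) : Setoid (RawTm L V a) where
  r := RawTm.Conv
  iseqv := ⟨.refl, .symm, .trans⟩

/-- Terms of type `a` under the signature `V`: simply typed lambda-terms modulo conversion. -/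
def Tm (L : Vocabulary.{u, v, w}) (V : Ctx L) (a : Ty L.Base) : Type (max u v) :=
  Quotient (convSetoid L V a)

/-- Substitutions of domain `V` and image signature `W`.  A substitution of domain `γ` is also a
tuple of arguments for a predicate with argument types `γ`. -/
abbrev Sub (L : Vocabulary.{u, v, w}) (V W : Ctx L) : Type (max u v) :=
  ∀ ⦃a : Ty L.Base⦄, Var V a → Tm L W a

namespace Tm

def var {V : Ctx L} {a : Ty L.Base} (x : Var V a) : Tm L V a :=
  Quotient.mk (convSetoid L V a) (RawTm.var x)

/-- The application of a substitution to a term; it is computed on representatives. -/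
noncomputable def subst {V W : Ctx L} {a : Ty L.Base} (t : Tm L V a) (σ : Sub L V W) : Tm L W a :=
  Quotient.map' (s₁ := convSetoid L V a) (s₂ := convSetoid L W a)
    (fun r => r.subst (fun _ x => Quotient.out (σ x))) (fun _ _ h => RawTm.Conv.subst h _) t

theorem subst_mk {V W : Ctx L} {a : Ty L.Base} (t : RawTm L V a) (σ : RawTm.RSub L V W) :
    subst (Quotient.mk (convSetoid L V a) t)
        (fun _ x => Quotient.mk (convSetoid L W _) (σ x)) =
      Quotient.mk (convSetoid L W a) (t.subst σ) := by
  refine Quotient.sound (s := convSetoid L W a) (RawTm.Conv.subst_congr t ?_)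
  intro b x
  exact Quotient.mk_out (s := convSetoid L W b) (σ x)

theorem var_subst {V W : Ctx L} {a : Ty L.Base} (x : Var V a) (σ : Sub L V W) :
    (var x).subst σ = σ x :=
  Quotient.out_eq (σ x)

theorem subst_var {V : Ctx L} {a : Ty L.Base} (t : Tm L V a) : t.subst (fun _ x => var x) = t := by
  induction t using Quotient.ind with
  | _ t => exact (subst_mk t _).trans (by rw [RawTm.subst_var])

theorem subst_subst {V W X : Ctx L} {a : Ty L.Base} (t : Tm L V a) (σ : Sub L V W)
    (τ : Sub L W X) : (t.subst σ).subst τ = t.subst (fun _ x => (σ x).subst τ) := by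
  induction t using Quotient.ind with
  | _ t =>
    have hσ : σ = fun _ x => Quotient.mk (convSetoid L W _) (Quotient.out (σ x)) := by
      funext b x
      exact (Quotient.out_eq (σ x)).symm
    have hτ : τ = fun _ x => Quotient.mk (convSetoid L X _) (Quotient.out (τ x)) := by
      funext b x
      exact (Quotient.out_eq (τ x)).symm
    rw [hσ, hτ]
    simp only [subst_mk, RawTm.subst_subst]
    rfl

end Tm

namespace Sub

/-- The identity substitution. -/
def id (V : Ctx L) : Sub L V V := fun _ x => Tm.var x

/-- `σ.comp τ` is `σ` followed by `τ`. -/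
noncomputable def comp {V W X : Ctx L} (σ : Sub L V W) (τ : Sub L W X) : Sub L V X :=
  fun _ x => (σ x).subst τ

/-- The inclusion of a signature into its extension by one variable. -/
def weaken (V : Ctx L) (b : Ty L.Base) : Sub L V (b :: V) := fun _ x => Tm.var (.succ x)

/-- Extension of a substitution under a binder. -/
noncomputable def lift {V W : Ctx L} (σ : Sub L V W) (b : Ty L.Base) : Sub L (b :: V) (b :: W)
  | _, .zero => Tm.var .zero
  | _, .succ x => (σ x).subst (weaken W b)

/-- The substitution of a term for the last variable. -/
def single {V : Ctx L} {b : Ty L.Base} (t : Tm L V b) : Sub L (b :: V) V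
  | _, .zero => t
  | _, .succ x => Tm.var x

end Sub

/-- A fixed choice of complete sets of unifiers, with `{id}` for trivial problems. -/
structure CSU (L : Vocabulary.{u, v, w}) where
  csu : ∀ {V : Ctx L} {a : Ty L.Base}, Tm L V a → Tm L V a → Set (Σ W : Ctx L, Sub L V W)
  unifies : ∀ {V : Ctx L} {a : Ty L.Base} (s t : Tm L V a), ∀ θ ∈ csu s t,
    s.subst θ.2 = t.subst θ.2
  complete : ∀ {V : Ctx L} {a : Ty L.Base} (s t : Tm L V a) {X : Ctx L} (σ : Sub L V X),
    s.subst σ = t.subst σ → ∃ θ ∈ csu s t, ∃ σ' : Sub L θ.1 X, σ = θ.2.comp σ'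
  csu_self : ∀ {V : Ctx L} {a : Ty L.Base} (t : Tm L V a), csu t t = {⟨V, Sub.id V⟩}

/-! ### Formulas of muMALL -/

/-- `Fm L Δ V`: formulas of muMALL under the signature `V`, with predicate variables in `Δ`.
The body of a fixed point sees its own predicate variable, its own arguments, and the outer
predicate variables, but no outer term variable.  There are no negated predicate variables:
all operators are monotonic. -/
inductive Fm (L : Vocabulary.{u, v, w}) : PCtx L → Ctx L → Type (max u v w)
  | tensor {Δ : PCtx L} {V : Ctx L} (P Q : Fm L Δ V) : Fm L Δ V
  | plus {Δ : PCtx L} {V : Ctx L} (P Q : Fm L Δ V) : Fm L Δ V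
  | par {Δ : PCtx L} {V : Ctx L} (P Q : Fm L Δ V) : Fm L Δ V
  | amp {Δ : PCtx L} {V : Ctx L} (P Q : Fm L Δ V) : Fm L Δ V
  | one {Δ : PCtx L} {V : Ctx L} : Fm L Δ V
  | zero {Δ : PCtx L} {V : Ctx L} : Fm L Δ V
  | bot {Δ : PCtx L} {V : Ctx L} : Fm L Δ V
  | top {Δ : PCtx L} {V : Ctx L} : Fm L Δ V
  | atom {Δ : PCtx L} {V : Ctx L} (a : L.Atom) (ts : Sub L (L.arity a) V) : Fm L Δ V
  | natom {Δ : PCtx L} {V : Ctx L} (a : L.Atom) (ts : Sub L (L.arity a) V) : Fm L Δ V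
  | ex {Δ : PCtx L} {V : Ctx L} (a : Ty L.Base) (P : Fm L Δ (a :: V)) : Fm L Δ V
  | all {Δ : PCtx L} {V : Ctx L} (a : Ty L.Base) (P : Fm L Δ (a :: V)) : Fm L Δ V
  | eq {Δ : PCtx L} {V : Ctx L} {a : Ty L.Base} (s t : Tm L V a) : Fm L Δ V
  | neq {Δ : PCtx L} {V : Ctx L} {a : Ty L.Base} (s t : Tm L V a) : Fm L Δ V
  | mu {Δ : PCtx L} {V γ : Ctx L} (B : Fm L (γ :: Δ) γ) (ts : Sub L γ V) : Fm L Δ V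
  | nu {Δ : PCtx L} {V γ : Ctx L} (B : Fm L (γ :: Δ) γ) (ts : Sub L γ V) : Fm L Δ V
  | pvar {Δ : PCtx L} {V γ : Ctx L} (p : Var Δ γ) (ts : Sub L γ V) : Fm L Δ V

namespace Fm

/-- Application of a term substitution. -/
noncomputable def subst {Δ : PCtx L} {V W : Ctx L} : Fm L Δ V → Sub L V W → Fm L Δ W
  | tensor P Q, σ => tensor (P.subst σ) (Q.subst σ)
  | plus P Q, σ => plus (P.subst σ) (Q.subst σ)
  | par P Q, σ => par (P.subst σ) (Q.subst σ)
  | amp P Q, σ => amp (P.subst σ) (Q.subst σ)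
  | one, _ => one
  | zero, _ => zero
  | bot, _ => bot
  | top, _ => top
  | atom a ts, σ => atom a (ts.comp σ)
  | natom a ts, σ => natom a (ts.comp σ)
  | ex a P, σ => ex a (P.subst (σ.lift a))
  | all a P, σ => all a (P.subst (σ.lift a))
  | eq s t, σ => eq (s.subst σ) (t.subst σ)
  | neq s t, σ => neq (s.subst σ) (t.subst σ)
  | mu B ts, σ => mu B (ts.comp σ)
  | nu B ts, σ => nu B (ts.comp σ)
  | pvar p ts, σ => pvar p (ts.comp σ)

/-- Renaming of predicate variables. -/
def prename {Δ Δ' : PCtx L} {V : Ctx L} : Fm L Δ V → Ren Δ Δ' → Fm L Δ' V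
  | tensor P Q, ρ => tensor (P.prename ρ) (Q.prename ρ)
  | plus P Q, ρ => plus (P.prename ρ) (Q.prename ρ)
  | par P Q, ρ => par (P.prename ρ) (Q.prename ρ)
  | amp P Q, ρ => amp (P.prename ρ) (Q.prename ρ)
  | one, _ => one
  | zero, _ => zero
  | bot, _ => bot
  | top, _ => top
  | atom a ts, _ => atom a ts
  | natom a ts, _ => natom a ts
  | ex a P, ρ => ex a (P.prename ρ)
  | all a P, ρ => all a (P.prename ρ)
  | eq s t, _ => eq s t
  | neq s t, _ => neq s t
  | mu B ts, ρ => mu (B.prename (ρ.lift _)) ts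
  | nu B ts, ρ => nu (B.prename (ρ.lift _)) ts
  | pvar p ts, ρ => pvar (ρ p) ts

/-- Substitutions of predicates for predicate variables. -/
abbrev PSub (L : Vocabulary.{u, v, w}) (Δ Δ' : PCtx L) : Type (max u v w) :=
  ∀ ⦃γ : Ctx L⦄, Var Δ γ → Fm L Δ' γ

def PSub.lift {Δ Δ' : PCtx L} (τ : PSub L Δ Δ') (γ : Ctx L) : PSub L (γ :: Δ) (γ :: Δ')
  | _, .zero => pvar .zero (Sub.id γ)
  | _, .succ p => (τ p).prename (fun _ q => .succ q)

/-- Application of a predicate substitution. -/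
noncomputable def psubst {Δ Δ' : PCtx L} {V : Ctx L} : Fm L Δ V → PSub L Δ Δ' → Fm L Δ' V
  | tensor P Q, τ => tensor (P.psubst τ) (Q.psubst τ)
  | plus P Q, τ => plus (P.psubst τ) (Q.psubst τ)
  | par P Q, τ => par (P.psubst τ) (Q.psubst τ)
  | amp P Q, τ => amp (P.psubst τ) (Q.psubst τ)
  | one, _ => one
  | zero, _ => zero
  | bot, _ => bot
  | top, _ => top
  | atom a ts, _ => atom a ts
  | natom a ts, _ => natom a ts
  | ex a P, τ => ex a (P.psubst τ)
  | all a P, τ => all a (P.psubst τ)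
  | eq s t, _ => eq s t
  | neq s t, _ => neq s t
  | mu B ts, τ => mu (B.psubst (τ.lift _)) ts
  | nu B ts, τ => nu (B.psubst (τ.lift _)) ts
  | pvar p ts, τ => (τ p).subst ts

/-- `B.inst S` is the predicate `B S`, for an operator `B` and a predicate `S`. -/
noncomputable def inst {γ : Ctx L} (B : Fm L [γ] γ) (S : Fm L [] γ) : Fm L [] γ :=
  B.psubst (fun _ p => match p with | .zero => S)

/-- Negation.  On a formula without free predicate variables this is linear negation.  On the body
of an operator `B` it is the body of the dual operator, which negates its predicate variable
before it negates `B`; hence positive occurrences of predicate variables are left unchanged. -/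
def dual {Δ : PCtx L} {V : Ctx L} : Fm L Δ V → Fm L Δ V
  | tensor P Q => par P.dual Q.dual
  | plus P Q => amp P.dual Q.dual
  | par P Q => tensor P.dual Q.dual
  | amp P Q => plus P.dual Q.dual
  | one => bot
  | zero => top
  | bot => one
  | top => zero
  | atom a ts => natom a ts
  | natom a ts => atom a ts
  | ex a P => all a P.dual
  | all a P => ex a P.dual
  | eq s t => neq s t
  | neq s t => eq s t
  | mu B ts => nu B.dual ts
  | nu B ts => mu B.dual ts
  | pvar p ts => pvar p ts

end Fm

/-! ### Derivations of muMALL -/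

/-- `MALL c V Γ`: derivations of the sequent `V; ⊢ Γ`. -/
inductive MALL (c : CSU L) : (V : Ctx L) → Multiset (Fm L [] V) → Type (max u v w)
  | cut {V : Ctx L} {Γ Δ : Multiset (Fm L [] V)} (P : Fm L [] V)
      (d : MALL c V (P.dual ::ₘ Γ)) (e : MALL c V (P ::ₘ Δ)) : MALL c V (Γ + Δ)
  | init {V : Ctx L} (P : Fm L [] V) : MALL c V {P, P.dual}
  | bot {V : Ctx L} {Γ : Multiset (Fm L [] V)} (d : MALL c V Γ) : MALL c V (Fm.bot ::ₘ Γ)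
  | par {V : Ctx L} {Γ : Multiset (Fm L [] V)} (P Q : Fm L [] V)
      (d : MALL c V (P ::ₘ Q ::ₘ Γ)) : MALL c V (Fm.par P Q ::ₘ Γ)
  | tensor {V : Ctx L} {Γ Δ : Multiset (Fm L [] V)} (P Q : Fm L [] V)
      (d : MALL c V (P ::ₘ Γ)) (e : MALL c V (Q ::ₘ Δ)) : MALL c V (Fm.tensor P Q ::ₘ (Γ + Δ))
  | one {V : Ctx L} : MALL c V {Fm.one}
  | top {V : Ctx L} (Γ : Multiset (Fm L [] V)) : MALL c V (Fm.top ::ₘ Γ)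
  | amp {V : Ctx L} {Γ : Multiset (Fm L [] V)} (P Q : Fm L [] V)
      (d : MALL c V (P ::ₘ Γ)) (e : MALL c V (Q ::ₘ Γ)) : MALL c V (Fm.amp P Q ::ₘ Γ)
  | plusLeft {V : Ctx L} {Γ : Multiset (Fm L [] V)} (P Q : Fm L [] V)
      (d : MALL c V (P ::ₘ Γ)) : MALL c V (Fm.plus P Q ::ₘ Γ)
  | plusRight {V : Ctx L} {Γ : Multiset (Fm L [] V)} (P Q : Fm L [] V)
      (d : MALL c V (Q ::ₘ Γ)) : MALL c V (Fm.plus P Q ::ₘ Γ)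
  | all {V : Ctx L} {Γ : Multiset (Fm L [] V)} (a : Ty L.Base) (P : Fm L [] (a :: V))
      (d : MALL c (a :: V) (P ::ₘ Γ.map (fun Q => Q.subst (Sub.weaken V a)))) :
      MALL c V (Fm.all a P ::ₘ Γ)
  | ex {V : Ctx L} {Γ : Multiset (Fm L [] V)} (a : Ty L.Base) (P : Fm L [] (a :: V))
      (t : Tm L V a) (d : MALL c V (P.subst (Sub.single t) ::ₘ Γ)) : MALL c V (Fm.ex a P ::ₘ Γ)
  | neq {V : Ctx L} {Γ : Multiset (Fm L [] V)} {a : Ty L.Base} (s t : Tm L V a)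
      (d : ∀ θ : c.csu s t, MALL c θ.1.1 (Γ.map (fun Q => Q.subst θ.1.2))) :
      MALL c V (Fm.neq s t ::ₘ Γ)
  | eq {V : Ctx L} {a : Ty L.Base} (t : Tm L V a) : MALL c V {Fm.eq t t}
  | nu {V γ : Ctx L} {Γ : Multiset (Fm L [] V)} (B : Fm L [γ] γ) (ts : Sub L γ V)
      (S : Fm L [] γ) (d : MALL c V (S.subst ts ::ₘ Γ)) (e : MALL c γ {B.inst S, S.dual}) :
      MALL c V (Fm.nu B ts ::ₘ Γ)
  | mu {V γ : Ctx L} {Γ : Multiset (Fm L [] V)} (B : Fm L [γ] γ) (ts : Sub L γ V)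
      (d : MALL c V ((B.inst (Fm.mu B (Sub.id γ))).subst ts ::ₘ Γ)) :
      MALL c V (Fm.mu B ts ::ₘ Γ)

namespace MALL

def CutFree {c : CSU L} {V : Ctx L} {Γ : Multiset (Fm L [] V)} : MALL c V Γ → Prop
  | cut _ _ _ => False
  | init _ => True
  | bot d => d.CutFree
  | par _ _ d => d.CutFree
  | tensor _ _ d e => d.CutFree ∧ e.CutFree
  | one => True
  | top _ => True
  | amp _ _ d e => d.CutFree ∧ e.CutFree
  | plusLeft _ _ d => d.CutFree
  | plusRight _ _ d => d.CutFree
  | all _ _ d => d.CutFree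
  | ex _ _ _ d => d.CutFree
  | neq _ _ d => ∀ θ, (d θ).CutFree
  | eq _ => True
  | nu _ _ _ d e => d.CutFree ∧ e.CutFree
  | mu _ _ d => d.CutFree

/-- The height of a derivation, infinite when the heights of its branches are unbounded. -/
noncomputable def height {c : CSU L} {V : Ctx L} {Γ : Multiset (Fm L [] V)} :
    MALL c V Γ → ℕ∞
  | cut _ d e => max d.height e.height + 1
  | init _ => 1
  | bot d => d.height + 1
  | par _ _ d => d.height + 1
  | tensor _ _ d e => max d.height e.height + 1
  | one => 1
  | top _ => 1
  | amp _ _ d e => max d.height e.height + 1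
  | plusLeft _ _ d => d.height + 1
  | plusRight _ _ d => d.height + 1
  | all _ _ d => d.height + 1
  | ex _ _ _ d => d.height + 1
  | neq _ _ d => (⨆ θ, (d θ).height) + 1
  | eq _ => 1
  | nu _ _ _ d e => max d.height e.height + 1
  | mu _ _ d => d.height + 1

/-- The pairs of an operator `B` and a (co)invariant `S` such that the rule for the greatest fixed
point of `B` is used with `S` somewhere in the derivation. -/
def nuUses {c : CSU L} {V : Ctx L} {Γ : Multiset (Fm L [] V)} :
    MALL c V Γ → Set (Σ γ : Ctx L, Fm L [γ] γ × Fm L [] γ)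
  | cut _ d e => d.nuUses ∪ e.nuUses
  | init _ => ∅
  | bot d => d.nuUses
  | par _ _ d => d.nuUses
  | tensor _ _ d e => d.nuUses ∪ e.nuUses
  | one => ∅
  | top _ => ∅
  | amp _ _ d e => d.nuUses ∪ e.nuUses
  | plusLeft _ _ d => d.nuUses
  | plusRight _ _ d => d.nuUses
  | all _ _ d => d.nuUses
  | ex _ _ _ d => d.nuUses
  | neq _ _ d => ⋃ θ, (d θ).nuUses
  | eq _ => ∅
  | nu B _ S d e => insert ⟨_, B, S⟩ (d.nuUses ∪ e.nuUses)
  | mu _ _ d => d.nuUses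

/-- The (co)invariants used in a derivation. -/
def coinvariants {c : CSU L} {V : Ctx L} {Γ : Multiset (Fm L [] V)} (d : MALL c V Γ) :
    Set (Σ γ : Ctx L, Fm L [] γ) :=
  (fun i => ⟨i.1, i.2.2⟩) '' d.nuUses

/-- Quasi-finite derivations: cut-free, of finite height, with finitely many coinvariants. -/
def QuasiFinite {c : CSU L} {V : Ctx L} {Γ : Multiset (Fm L [] V)} (d : MALL c V Γ) : Prop :=
  d.CutFree ∧ d.height < ⊤ ∧ d.coinvariants.Finite

end MALL

/-! ### Intuitionistic formulas -/

/-- Atom-free intuitionistic formulas with fixed points.  The antecedent of an implication has no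
free predicate variable, because operators are monotonic. -/
inductive IFm (L : Vocabulary.{u, v, w}) : PCtx L → Ctx L → Type (max u v)
  | and {Δ : PCtx L} {V : Ctx L} (P Q : IFm L Δ V) : IFm L Δ V
  | or {Δ : PCtx L} {V : Ctx L} (P Q : IFm L Δ V) : IFm L Δ V
  | eq {Δ : PCtx L} {V : Ctx L} {a : Ty L.Base} (s t : Tm L V a) : IFm L Δ V
  | ex {Δ : PCtx L} {V : Ctx L} (a : Ty L.Base) (P : IFm L Δ (a :: V)) : IFm L Δ V
  | mu {Δ : PCtx L} {V γ : Ctx L} (B : IFm L (γ :: Δ) γ) (ts : Sub L γ V) : IFm L Δ V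
  | pvar {Δ : PCtx L} {V γ : Ctx L} (p : Var Δ γ) (ts : Sub L γ V) : IFm L Δ V
  | all {Δ : PCtx L} {V : Ctx L} (a : Ty L.Base) (P : IFm L Δ (a :: V)) : IFm L Δ V
  | imp {Δ : PCtx L} {V : Ctx L} (P : IFm L [] V) (Q : IFm L Δ V) : IFm L Δ V
  | nu {Δ : PCtx L} {V γ : Ctx L} (B : IFm L (γ :: Δ) γ) (ts : Sub L γ V) : IFm L Δ V

namespace IFm

/-- The fragment of formulas that may be hypotheses. -/
def IsH {Δ : PCtx L} {V : Ctx L} : IFm L Δ V → Prop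
  | and P Q => P.IsH ∧ Q.IsH
  | or P Q => P.IsH ∧ Q.IsH
  | eq _ _ => True
  | ex _ P => P.IsH
  | mu B _ => B.IsH
  | pvar _ _ => True
  | all _ _ => False
  | imp _ _ => False
  | nu _ _ => False

/-- The fragment of formulas that may be goals. -/
def IsG {Δ : PCtx L} {V : Ctx L} : IFm L Δ V → Prop
  | and P Q => P.IsG ∧ Q.IsG
  | or P Q => P.IsG ∧ Q.IsG
  | eq _ _ => True
  | ex _ P => P.IsG
  | mu B _ => B.IsG
  | pvar _ _ => True
  | all _ P => P.IsG
  | imp P Q => P.IsH ∧ Q.IsG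
  | nu B _ => B.IsG

/-- Application of a term substitution. -/
noncomputable def subst {Δ : PCtx L} {V W : Ctx L} : IFm L Δ V → Sub L V W → IFm L Δ W
  | and P Q, σ => and (P.subst σ) (Q.subst σ)
  | or P Q, σ => or (P.subst σ) (Q.subst σ)
  | eq s t, σ => eq (s.subst σ) (t.subst σ)
  | ex a P, σ => ex a (P.subst (σ.lift a))
  | mu B ts, σ => mu B (ts.comp σ)
  | pvar p ts, σ => pvar p (ts.comp σ)
  | all a P, σ => all a (P.subst (σ.lift a))
  | imp P Q, σ => imp (P.subst σ) (Q.subst σ)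
  | nu B ts, σ => nu B (ts.comp σ)

/-- Renaming of predicate variables. -/
def prename {Δ Δ' : PCtx L} {V : Ctx L} : IFm L Δ V → Ren Δ Δ' → IFm L Δ' V
  | and P Q, ρ => and (P.prename ρ) (Q.prename ρ)
  | or P Q, ρ => or (P.prename ρ) (Q.prename ρ)
  | eq s t, _ => eq s t
  | ex a P, ρ => ex a (P.prename ρ)
  | mu B ts, ρ => mu (B.prename (ρ.lift _)) ts
  | pvar p ts, ρ => pvar (ρ p) ts
  | all a P, ρ => all a (P.prename ρ)
  | imp P Q, ρ => imp P (Q.prename ρ)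
  | nu B ts, ρ => nu (B.prename (ρ.lift _)) ts

/-- Substitutions of predicates for predicate variables. -/
abbrev PSub (L : Vocabulary.{u, v, w}) (Δ Δ' : PCtx L) : Type (max u v) :=
  ∀ ⦃γ : Ctx L⦄, Var Δ γ → IFm L Δ' γ

def PSub.lift {Δ Δ' : PCtx L} (τ : PSub L Δ Δ') (γ : Ctx L) : PSub L (γ :: Δ) (γ :: Δ')
  | _, .zero => pvar .zero (Sub.id γ)
  | _, .succ p => (τ p).prename (fun _ q => .succ q)

/-- Application of a predicate substitution. -/
noncomputable def psubst {Δ Δ' : PCtx L} {V : Ctx L} : IFm L Δ V → PSub L Δ Δ' → IFm L Δ' V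
  | and P Q, τ => and (P.psubst τ) (Q.psubst τ)
  | or P Q, τ => or (P.psubst τ) (Q.psubst τ)
  | eq s t, _ => eq s t
  | ex a P, τ => ex a (P.psubst τ)
  | mu B ts, τ => mu (B.psubst (τ.lift _)) ts
  | pvar p ts, τ => (τ p).subst ts
  | all a P, τ => all a (P.psubst τ)
  | imp P Q, τ => imp P (Q.psubst τ)
  | nu B ts, τ => nu (B.psubst (τ.lift _)) ts

/-- `B.inst S` is the predicate `B S`, for an operator `B` and a predicate `S`. -/
noncomputable def inst {γ : Ctx L} (B : IFm L [γ] γ) (S : IFm L [] γ) : IFm L [] γ :=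
  B.psubst (fun _ p => match p with | .zero => S)

/-- The encoding of intuitionistic formulas and operators in muMALL; an implication is
encoded as a linear implication, that is, as `[P]^⊥ ⅋ [Q]`. -/
def enc {Δ : PCtx L} {V : Ctx L} : IFm L Δ V → Fm L Δ V
  | and P Q => Fm.tensor P.enc Q.enc
  | or P Q => Fm.plus P.enc Q.enc
  | eq s t => Fm.eq s t
  | ex a P => Fm.ex a P.enc
  | mu B ts => Fm.mu B.enc ts
  | pvar p ts => Fm.pvar p ts
  | all a P => Fm.all a P.enc
  | imp P Q => Fm.par (P.enc.dual.prename (fun _ p => nomatch p)) Q.enc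
  | nu B ts => Fm.nu B.enc ts

end IFm

/-! ### Derivations of muLJL -/

/-- `LJL c V Γ P`: derivations of the sequent `V; Γ ⊢ P`.  Cut formulas and (co)invariants are in
the fragment `H`, so that from a conclusion with hypotheses in `H` and goal in `G` only such
sequents arise. -/
inductive LJL (c : CSU L) : (V : Ctx L) → Multiset (IFm L [] V) → IFm L [] V → Type (max u v)
  | cut {V : Ctx L} {Γ Γ' : Multiset (IFm L [] V)} {R : IFm L [] V} (P : IFm L [] V)
      (hP : P.IsH) (d : LJL c V Γ P) (e : LJL c V (P ::ₘ Γ') R) : LJL c V (Γ + Γ') R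
  | init {V γ : Ctx L} (Γ : Multiset (IFm L [] V)) (B : IFm L [γ] γ) (ts : Sub L γ V) :
      LJL c V (IFm.mu B ts ::ₘ Γ) (IFm.mu B ts)
  | weak {V : Ctx L} {Γ : Multiset (IFm L [] V)} {R : IFm L [] V} (P : IFm L [] V)
      (d : LJL c V Γ R) : LJL c V (P ::ₘ Γ) R
  | contr {V : Ctx L} {Γ : Multiset (IFm L [] V)} {R : IFm L [] V} (P : IFm L [] V)
      (d : LJL c V (P ::ₘ P ::ₘ Γ) R) : LJL c V (P ::ₘ Γ) R
  | andL {V : Ctx L} {Γ : Multiset (IFm L [] V)} {R : IFm L [] V} (P Q : IFm L [] V)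
      (d : LJL c V (P ::ₘ Q ::ₘ Γ) R) : LJL c V (IFm.and P Q ::ₘ Γ) R
  | orL {V : Ctx L} {Γ : Multiset (IFm L [] V)} {R : IFm L [] V} (P Q : IFm L [] V)
      (d : LJL c V (P ::ₘ Γ) R) (e : LJL c V (Q ::ₘ Γ) R) : LJL c V (IFm.or P Q ::ₘ Γ) R
  | exL {V : Ctx L} {Γ : Multiset (IFm L [] V)} {R : IFm L [] V} (a : Ty L.Base)
      (P : IFm L [] (a :: V))
      (d : LJL c (a :: V) (P ::ₘ Γ.map (fun Q => Q.subst (Sub.weaken V a)))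
        (R.subst (Sub.weaken V a))) : LJL c V (IFm.ex a P ::ₘ Γ) R
  | eqL {V : Ctx L} {Γ : Multiset (IFm L [] V)} {R : IFm L [] V} {a : Ty L.Base} (s t : Tm L V a)
      (d : ∀ θ : c.csu s t, LJL c θ.1.1 (Γ.map (fun Q => Q.subst θ.1.2)) (R.subst θ.1.2)) :
      LJL c V (IFm.eq s t ::ₘ Γ) R
  | muL {V γ : Ctx L} {Γ : Multiset (IFm L [] V)} {R : IFm L [] V} (B : IFm L [γ] γ)
      (ts : Sub L γ V) (S : IFm L [] γ) (hS : S.IsH) (d : LJL c V (S.subst ts ::ₘ Γ) R)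
      (e : LJL c γ {B.inst S} S) : LJL c V (IFm.mu B ts ::ₘ Γ) R
  | andR {V : Ctx L} {Γ : Multiset (IFm L [] V)} {P Q : IFm L [] V}
      (d : LJL c V Γ P) (e : LJL c V Γ Q) : LJL c V Γ (IFm.and P Q)
  | orRLeft {V : Ctx L} {Γ : Multiset (IFm L [] V)} (P Q : IFm L [] V)
      (d : LJL c V Γ P) : LJL c V Γ (IFm.or P Q)
  | orRRight {V : Ctx L} {Γ : Multiset (IFm L [] V)} (P Q : IFm L [] V)
      (d : LJL c V Γ Q) : LJL c V Γ (IFm.or P Q)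
  | impR {V : Ctx L} {Γ : Multiset (IFm L [] V)} {P Q : IFm L [] V}
      (d : LJL c V (P ::ₘ Γ) Q) : LJL c V Γ (IFm.imp P Q)
  | eqR {V : Ctx L} (Γ : Multiset (IFm L [] V)) {a : Ty L.Base} (t : Tm L V a) :
      LJL c V Γ (IFm.eq t t)
  | exR {V : Ctx L} {Γ : Multiset (IFm L [] V)} (a : Ty L.Base) (P : IFm L [] (a :: V))
      (t : Tm L V a) (d : LJL c V Γ (P.subst (Sub.single t))) : LJL c V Γ (IFm.ex a P)
  | allR {V : Ctx L} {Γ : Multiset (IFm L [] V)} (a : Ty L.Base) (P : IFm L [] (a :: V))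
      (d : LJL c (a :: V) (Γ.map (fun Q => Q.subst (Sub.weaken V a))) P) :
      LJL c V Γ (IFm.all a P)
  | muR {V γ : Ctx L} {Γ : Multiset (IFm L [] V)} (B : IFm L [γ] γ) (ts : Sub L γ V)
      (d : LJL c V Γ ((B.inst (IFm.mu B (Sub.id γ))).subst ts)) : LJL c V Γ (IFm.mu B ts)
  | nuR {V γ : Ctx L} {Γ : Multiset (IFm L [] V)} (B : IFm L [γ] γ) (ts : Sub L γ V)
      (S : IFm L [] γ) (hS : S.IsH) (d : LJL c V Γ (S.subst ts))
      (e : LJL c γ {S} (B.inst S)) : LJL c V Γ (IFm.nu B ts)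

namespace LJL

def CutFree {c : CSU L} {V : Ctx L} {Γ : Multiset (IFm L [] V)} {R : IFm L [] V} :
    LJL c V Γ R → Prop
  | cut _ _ _ _ => False
  | init _ _ _ => True
  | weak _ d => d.CutFree
  | contr _ d => d.CutFree
  | andL _ _ d => d.CutFree
  | orL _ _ d e => d.CutFree ∧ e.CutFree
  | exL _ _ d => d.CutFree
  | eqL _ _ d => ∀ θ, (d θ).CutFree
  | muL _ _ _ _ d e => d.CutFree ∧ e.CutFree
  | andR d e => d.CutFree ∧ e.CutFree
  | orRLeft _ _ d => d.CutFree
  | orRRight _ _ d => d.CutFree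
  | impR d => d.CutFree
  | eqR _ _ => True
  | exR _ _ _ d => d.CutFree
  | allR _ _ d => d.CutFree
  | muR _ _ d => d.CutFree
  | nuR _ _ _ _ d e => d.CutFree ∧ e.CutFree

/-- The height of a derivation, infinite when the heights of its branches are unbounded. -/
noncomputable def height {c : CSU L} {V : Ctx L} {Γ : Multiset (IFm L [] V)} {R : IFm L [] V} :
    LJL c V Γ R → ℕ∞
  | cut _ _ d e => max d.height e.height + 1
  | init _ _ _ => 1
  | weak _ d => d.height + 1
  | contr _ d => d.height + 1
  | andL _ _ d => d.height + 1
  | orL _ _ d e => max d.height e.height + 1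
  | exL _ _ d => d.height + 1
  | eqL _ _ d => (⨆ θ, (d θ).height) + 1
  | muL _ _ _ _ d e => max d.height e.height + 1
  | andR d e => max d.height e.height + 1
  | orRLeft _ _ d => d.height + 1
  | orRRight _ _ d => d.height + 1
  | impR d => d.height + 1
  | eqR _ _ => 1
  | exR _ _ _ d => d.height + 1
  | allR _ _ d => d.height + 1
  | muR _ _ d => d.height + 1
  | nuR _ _ _ _ d e => max d.height e.height + 1

/-- The invariants and coinvariants used in a derivation. -/
def coinvariants {c : CSU L} {V : Ctx L} {Γ : Multiset (IFm L [] V)} {R : IFm L [] V} :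
    LJL c V Γ R → Set (Σ γ : Ctx L, IFm L [] γ)
  | cut _ _ d e => d.coinvariants ∪ e.coinvariants
  | init _ _ _ => ∅
  | weak _ d => d.coinvariants
  | contr _ d => d.coinvariants
  | andL _ _ d => d.coinvariants
  | orL _ _ d e => d.coinvariants ∪ e.coinvariants
  | exL _ _ d => d.coinvariants
  | eqL _ _ d => ⋃ θ, (d θ).coinvariants
  | muL _ _ S _ d e => insert ⟨_, S⟩ (d.coinvariants ∪ e.coinvariants)
  | andR d e => d.coinvariants ∪ e.coinvariants
  | orRLeft _ _ d => d.coinvariants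
  | orRRight _ _ d => d.coinvariants
  | impR d => d.coinvariants
  | eqR _ _ => ∅
  | exR _ _ _ d => d.coinvariants
  | allR _ _ d => d.coinvariants
  | muR _ _ d => d.coinvariants
  | nuR _ _ S _ d e => insert ⟨_, S⟩ (d.coinvariants ∪ e.coinvariants)

/-- Quasi-finite derivations: cut-free, of finite height, with finitely many (co)invariants. -/
def QuasiFinite {c : CSU L} {V : Ctx L} {Γ : Multiset (IFm L [] V)} {R : IFm L [] V}
    (d : LJL c V Γ R) : Prop :=
  d.CutFree ∧ d.height < ⊤ ∧ d.coinvariants.Finite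

end LJL

/-! ### The restriction on (co)invariants -/

/-- The use of a (co)invariant for the greatest fixed point of an operator is the encoding of an
induction or of a coinduction, with a (co)invariant `S` in `H`: either the operator is the dual
of an encoded operator `B` in `H`, so that the greatest fixed point is the negation of the encoded
least fixed point of `B`, and the invariant is, across that negation, `[S]` (as a coinvariant, the
negation of `[S]`); or the operator is an encoded operator in `G` and the coinvariant is `[S]`. -/
def EncodesH (i : Σ γ : Ctx L, Fm L [γ] γ × Fm L [] γ) : Prop :=
  ∃ S : IFm L [] i.1, S.IsH ∧
    ((∃ B : IFm L [i.1] i.1, B.IsH ∧ i.2.1 = B.enc.dual ∧ i.2.2 = S.enc.dual) ∨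
     (∃ B : IFm L [i.1] i.1, B.IsG ∧ i.2.1 = B.enc ∧ i.2.2 = S.enc))

end MuMALL

/-! The calculi differ in their structural rules, in their identity axioms, and in the conjunction
rule on the right, which is additive in muLJL and multiplicative in muMALL. The proof compares them
inside one auxiliary calculus, `Calc`. There, rules with eigenvariables or unifiers are replaced by
rules with one premise for every substitution, so that derivations are closed under substitution
without growing in height. Completeness of the sets of unifiers is used only to enter `Calc`
(`LJL.int`, `MALL.calc`); leaving it (`Int.bounded`, `Lin.mallBounded`) consists in selecting
premises.

From muLJL to muMALL, weakening and contraction of hypotheses in `H` have to be simulated without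
cut. Apart from least fixed points, the connectives of `H` have invertible left rules (`Lin.step`),
which reduces both to the components. On a least fixed point they are inductions. Weakening takes a
true equation as invariant. Contraction of `μB` takes `μB ∧ μB`: by monotonicity, `B (μB ∧ μB)` does
the work of two copies of `B (μB)`, and each folds to `μB`. To pass under the binder, both
statements are proved for open formulas with predicates substituted for their variables
(`Lin.exists_weakens_psubst`, `Lin.exists_merges_psubst`).

Finiteness needs care because a set of unifiers may be infinite: a derivation of finite height can
contain infinitely many sequents, yet the simulation may add only finitely many invariants and must
keep the height bounded. With finitely many invariants, all formulas met within a given number of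
inferences are term instances of a finite set, obtained by iterating `IFm.next`. The cost of
weakening or contracting an instance depends only on the formula of which it is an instance, and the
number of hypotheses is bounded as well. Hence `Int.exists_lin` finds its bounds before the sequent
is given.

From muMALL to muLJL, a cut-free derivation of an encoded sequent is read rule by rule as an
intuitionistic one; multiplicative contexts are made equal by weakening, and identity on `H` is
reduced to the initial rule on least fixed points. The one obstacle is that some formulas are both
the encoding of a goal and the negation of an encoded hypothesis. A greatest fixed point on the goal
side may then carry a coinvariant `[S]^⊥`, or one on the hypothesis side a coinvariant `[S]`, and
the premises have no intuitionistic reading. Such coincidences force the goal, and the hypothesis,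
to end in a predicate variable (`IFm.IsH.vacuous_absurd`). The goal is then provable with a true
equation as coinvariant, or the hypothesis refutable with a false one as invariant, and the given
premises are discarded. These sequents are the extra axioms of `ambAx`, eliminated in
`Calc.exists_int`. -/

namespace MuMALL

universe u v w

variable {L : Vocabulary.{u, v, w}}

/-! ### Substitutions -/

namespace Sub

/-- Extension of a substitution by a term for the last variable. -/
def snoc {V W : Ctx L} {a : Ty L.Base} (σ : Sub L V W) (t : Tm L W a) : Sub L (a :: V) W
  | _, .zero => t
  | _, .succ x => σ x

theorem comp_id {V W : Ctx L} (σ : Sub L V W) : σ.comp (Sub.id W) = σ := by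
  funext a x
  exact Tm.subst_var _

theorem id_comp {V W : Ctx L} (σ : Sub L V W) : (Sub.id V).comp σ = σ := by
  funext a x
  exact Tm.var_subst x σ

theorem comp_assoc {V W X Y : Ctx L} (σ : Sub L V W) (τ : Sub L W X) (ρ : Sub L X Y) :
    (σ.comp τ).comp ρ = σ.comp (τ.comp ρ) := by
  funext a x
  exact Tm.subst_subst _ _ _

theorem weaken_comp_snoc {V W : Ctx L} {a : Ty L.Base} (σ : Sub L V W) (t : Tm L W a) :
    (weaken V a).comp (snoc σ t) = σ := by
  funext b x
  exact Tm.var_subst _ _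

theorem snoc_comp {V W X : Ctx L} {a : Ty L.Base} (σ : Sub L V W) (t : Tm L W a)
    (τ : Sub L W X) : (snoc σ t).comp τ = snoc (σ.comp τ) (t.subst τ) := by
  funext b x
  cases x <;> rfl

theorem lift_comp_snoc {V W X : Ctx L} {a : Ty L.Base} (σ : Sub L V W) (τ : Sub L W X)
    (t : Tm L X a) : (σ.lift a).comp (snoc τ t) = snoc (σ.comp τ) t := by
  funext b x
  cases x with
  | zero => exact Tm.var_subst _ _
  | succ x =>
    refine (Tm.subst_subst (σ x) _ _).trans ?_
    exact congrArg (Tm.subst (σ x)) (weaken_comp_snoc τ t)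

theorem snoc_weaken_var {V : Ctx L} {a : Ty L.Base} :
    snoc (weaken V a) (Tm.var .zero) = Sub.id (a :: V) := by
  funext b x
  cases x <;> rfl

theorem lift_eq_snoc {V W : Ctx L} {a : Ty L.Base} (σ : Sub L V W) :
    σ.lift a = snoc (σ.comp (weaken W a)) (Tm.var .zero) := by
  funext b x
  cases x <;> rfl

theorem single_eq_snoc {V : Ctx L} {a : Ty L.Base} (t : Tm L V a) :
    single t = snoc (Sub.id V) t := by
  funext b x
  cases x <;> rfl

theorem lift_id {V : Ctx L} {a : Ty L.Base} : (Sub.id V).lift a = Sub.id (a :: V) := by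
  rw [lift_eq_snoc, id_comp, snoc_weaken_var]

theorem lift_comp_lift {V W X : Ctx L} {a : Ty L.Base} (σ : Sub L V W) (τ : Sub L W X) :
    (σ.lift a).comp (τ.lift a) = (σ.comp τ).lift a := by
  rw [lift_eq_snoc τ, lift_comp_snoc, lift_eq_snoc (σ.comp τ), comp_assoc]

theorem lift_comp_single {V W : Ctx L} {a : Ty L.Base} (σ : Sub L V W) (t : Tm L W a) :
    (σ.lift a).comp (single t) = snoc σ t := by
  rw [single_eq_snoc, lift_comp_snoc, comp_id]

theorem single_comp {V W : Ctx L} {a : Ty L.Base} (t : Tm L V a) (σ : Sub L V W) :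
    (single t).comp σ = snoc σ (t.subst σ) := by
  rw [single_eq_snoc, snoc_comp, id_comp]

end Sub

theorem Ren.lift_lift {K : Type u} {l m n : List K} (ρ : Ren l m) (ρ' : Ren m n) (b : K) :
    (fun _ x => ρ'.lift b (ρ.lift b x) : Ren (b :: l) (b :: n)) =
      Ren.lift (fun _ x => ρ' (ρ x)) b := by
  funext a x
  cases x <;> rfl

theorem Var.nil_elim {K : Type u} {a : K} (x : Var ([] : List K) a) : False := nomatch x

/-! ### Intuitionistic formulas under substitutions -/

namespace IFm

theorem subst_id {Δ : PCtx L} {V : Ctx L} (P : IFm L Δ V) : P.subst (Sub.id V) = P := by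
  induction P <;> simp only [subst, Sub.lift_id, Sub.comp_id, *]
  exact congrArg₂ IFm.eq (Tm.subst_var _) (Tm.subst_var _)

theorem subst_subst {Δ : PCtx L} {V W X : Ctx L} (P : IFm L Δ V) (σ : Sub L V W)
    (τ : Sub L W X) : (P.subst σ).subst τ = P.subst (σ.comp τ) := by
  induction P generalizing W X <;>
    simp only [subst, Sub.lift_comp_lift, Sub.comp_assoc, *]
  exact congrArg₂ IFm.eq (Tm.subst_subst _ _ _) (Tm.subst_subst _ _ _)

theorem subst_prename {Δ Δ' : PCtx L} {V W : Ctx L} (P : IFm L Δ V) (ρ : Ren Δ Δ')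
    (σ : Sub L V W) : (P.prename ρ).subst σ = (P.subst σ).prename ρ := by
  induction P generalizing W Δ' <;> simp only [subst, prename, *]

theorem prename_prename {Δ Δ' Δ'' : PCtx L} {V : Ctx L} (P : IFm L Δ V) (ρ : Ren Δ Δ')
    (ρ' : Ren Δ' Δ'') : (P.prename ρ).prename ρ' = P.prename (fun _ x => ρ' (ρ x)) := by
  induction P generalizing Δ' Δ'' <;> simp only [prename, Ren.lift_lift, *]

theorem subst_psubst {Δ Δ' : PCtx L} {V W : Ctx L} (P : IFm L Δ V) (τ : PSub L Δ Δ')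
    (σ : Sub L V W) : (P.psubst τ).subst σ = (P.subst σ).psubst τ := by
  induction P generalizing W Δ' <;> simp only [subst, psubst, subst_subst, *]

theorem prename_psubst {Δ Δ' Δ'' : PCtx L} {V : Ctx L} (P : IFm L Δ V) (ρ : Ren Δ Δ')
    (τ : PSub L Δ' Δ'') : (P.prename ρ).psubst τ = P.psubst (fun _ x => τ (ρ x)) := by
  have h : ∀ {Δ Δ' Δ'' : PCtx L} (ρ : Ren Δ Δ') (τ : PSub L Δ' Δ'') (γ : Ctx L),
      (fun _ x => τ.lift γ (ρ.lift γ x) : PSub L (γ :: Δ) (γ :: Δ'')) =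
        PSub.lift (fun _ x => τ (ρ x)) γ := by
    intro Δ Δ' Δ'' ρ τ γ
    funext a x
    cases x <;> rfl
  induction P generalizing Δ' Δ'' <;> simp only [prename, psubst, *]

theorem psubst_prename {Δ Δ' Δ'' : PCtx L} {V : Ctx L} (P : IFm L Δ V) (τ : PSub L Δ Δ')
    (ρ : Ren Δ' Δ'') : (P.psubst τ).prename ρ = P.psubst (fun _ x => (τ x).prename ρ) := by
  have h : ∀ {Δ Δ' Δ'' : PCtx L} (τ : PSub L Δ Δ') (ρ : Ren Δ' Δ'') (γ : Ctx L),
      (fun _ x => (τ.lift γ x).prename (ρ.lift γ) : PSub L (γ :: Δ) (γ :: Δ'')) =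
        PSub.lift (fun _ x => (τ x).prename ρ) γ := by
    intro Δ Δ' Δ'' τ ρ γ
    funext a x
    cases x with
    | zero => rfl
    | succ x => simp only [PSub.lift, prename_prename, Ren.lift]
  induction P generalizing Δ' Δ'' <;> simp only [prename, psubst, subst_prename, *]

theorem psubst_psubst {Δ Δ' Δ'' : PCtx L} {V : Ctx L} (P : IFm L Δ V) (τ : PSub L Δ Δ')
    (τ' : PSub L Δ' Δ'') : (P.psubst τ).psubst τ' = P.psubst (fun _ x => (τ x).psubst τ') := by
  have h : ∀ {Δ Δ' Δ'' : PCtx L} (τ : PSub L Δ Δ') (τ' : PSub L Δ' Δ'') (γ : Ctx L),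
      (fun _ x => (τ.lift γ x).psubst (τ'.lift γ) : PSub L (γ :: Δ) (γ :: Δ'')) =
        PSub.lift (fun _ x => (τ x).psubst τ') γ := by
    intro Δ Δ' Δ'' τ τ' γ
    funext a x
    cases x with
    | zero => exact subst_id _
    | succ x => simp only [PSub.lift, prename_psubst, psubst_prename]
  induction P generalizing Δ' Δ'' <;> simp only [psubst, subst_psubst, *]

theorem psubst_pvar {Δ : PCtx L} {V : Ctx L} (P : IFm L Δ V) :
    P.psubst (fun γ p => pvar p (Sub.id γ)) = P := by
  have h : ∀ (Δ : PCtx L) (γ : Ctx L),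
      PSub.lift (fun γ p => pvar p (Sub.id γ) : PSub L Δ Δ) γ =
        fun γ p => pvar p (Sub.id γ) := by
    intro Δ γ
    funext a x
    cases x <;> rfl
  induction P <;> simp_all [psubst, subst, Sub.id_comp]

theorem psubst_nil {V : Ctx L} (P : IFm L [] V) (τ : PSub L [] []) : P.psubst τ = P := by
  rw [show τ = fun γ p => pvar p (Sub.id γ) from by funext γ p; cases p]
  exact psubst_pvar P

/-- Extension of a predicate substitution by a predicate for the last variable. -/
def PSub.snoc {Δ Δ' : PCtx L} (τ : PSub L Δ Δ') {γ : Ctx L} (S : IFm L Δ' γ) :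
    PSub L (γ :: Δ) Δ'
  | _, .zero => S
  | _, .succ p => τ p

/-- This is what lets an induction on open formulas pass a fixed point: instantiating an operator
whose outer variables are already replaced amounts to one substitution, to which the induction
hypothesis for the body applies. -/
theorem psubst_lift_inst {Δ : PCtx L} {γ : Ctx L} (B : IFm L (γ :: Δ) γ) (τ : PSub L Δ [])
    (S : IFm L [] γ) : (B.psubst (τ.lift γ)).inst S = B.psubst (τ.snoc S) := by
  rw [inst, psubst_psubst]
  congr 1
  funext a x
  cases x with
  | zero => exact subst_id _
  | succ x =>
    simp only [PSub.lift, PSub.snoc, prename_psubst]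
    exact psubst_nil _ _

theorem isH_subst {Δ : PCtx L} {V W : Ctx L} (P : IFm L Δ V) (σ : Sub L V W) :
    (P.subst σ).IsH ↔ P.IsH := by
  induction P generalizing W <;> simp_all [subst, IsH]

theorem isG_subst {Δ : PCtx L} {V W : Ctx L} (P : IFm L Δ V) (σ : Sub L V W) :
    (P.subst σ).IsG ↔ P.IsG := by
  induction P generalizing W <;> simp_all [subst, IsG, isH_subst]

theorem isH_prename {Δ Δ' : PCtx L} {V : Ctx L} (P : IFm L Δ V) (ρ : Ren Δ Δ') :
    (P.prename ρ).IsH ↔ P.IsH := by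
  induction P generalizing Δ' <;> simp_all [prename, IsH]

theorem isG_prename {Δ Δ' : PCtx L} {V : Ctx L} (P : IFm L Δ V) (ρ : Ren Δ Δ') :
    (P.prename ρ).IsG ↔ P.IsG := by
  induction P generalizing Δ' <;> simp_all [prename, IsG]

theorem IsH.isG {Δ : PCtx L} {V : Ctx L} {P : IFm L Δ V} (h : P.IsH) : P.IsG := by
  induction P <;> simp_all [IsH, IsG]

theorem IsH.psubst {Δ Δ' : PCtx L} {V : Ctx L} {P : IFm L Δ V} (h : P.IsH) {τ : PSub L Δ Δ'}
    (hτ : ∀ ⦃γ : Ctx L⦄ (p : Var Δ γ), (τ p).IsH) : (P.psubst τ).IsH := by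
  induction P generalizing Δ' with
  | and P Q ihP ihQ => exact ⟨ihP h.1 hτ, ihQ h.2 hτ⟩
  | or P Q ihP ihQ => exact ⟨ihP h.1 hτ, ihQ h.2 hτ⟩
  | eq s t => trivial
  | ex a P ih => exact ih (Δ' := Δ') h hτ
  | mu B ts ih =>
    refine ih (Δ' := _ :: Δ') h ?_
    intro γ p
    cases p with
    | zero => trivial
    | succ p => exact (isH_prename _ _).2 (hτ p)
  | pvar p ts => exact (isH_subst _ _).2 (hτ p)
  | all a P ih => exact h.elim
  | imp P Q ihP ihQ => exact h.elim
  | nu B ts ih => exact h.elim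

theorem IsG.psubst {Δ Δ' : PCtx L} {V : Ctx L} {P : IFm L Δ V} (h : P.IsG) {τ : PSub L Δ Δ'}
    (hτ : ∀ ⦃γ : Ctx L⦄ (p : Var Δ γ), (τ p).IsG) : (P.psubst τ).IsG := by
  have lift : ∀ {Δ Δ' : PCtx L} {τ : PSub L Δ Δ'} (γ : Ctx L),
      (∀ ⦃δ : Ctx L⦄ (p : Var Δ δ), (τ p).IsG) →
      ∀ ⦃δ : Ctx L⦄ (p : Var (γ :: Δ) δ), (τ.lift γ p).IsG := by
    intro Δ Δ' τ γ hτ δ p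
    cases p with
    | zero => trivial
    | succ p => exact (isG_prename _ _).2 (hτ p)
  induction P generalizing Δ' with
  | and P Q ihP ihQ => exact ⟨ihP h.1 hτ, ihQ h.2 hτ⟩
  | or P Q ihP ihQ => exact ⟨ihP h.1 hτ, ihQ h.2 hτ⟩
  | eq s t => trivial
  | ex a P ih => exact ih (Δ' := Δ') h hτ
  | mu B ts ih => exact ih (Δ' := _ :: Δ') h (lift _ hτ)
  | pvar p ts => exact (isG_subst _ _).2 (hτ p)
  | all a P ih => exact ih (Δ' := Δ') h hτ
  | imp P Q ihP ihQ => exact ⟨h.1, ihQ h.2 hτ⟩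
  | nu B ts ih => exact ih (Δ' := _ :: Δ') h (lift _ hτ)

theorem IsH.inst {γ : Ctx L} {B : IFm L [γ] γ} {S : IFm L [] γ} (hB : B.IsH) (hS : S.IsH) :
    (B.inst S).IsH := by
  refine hB.psubst ?_
  rintro δ (_ | p)
  · exact hS
  · cases p

theorem IsG.inst {γ : Ctx L} {B : IFm L [γ] γ} {S : IFm L [] γ} (hB : B.IsG) (hS : S.IsG) :
    (B.inst S).IsG := by
  refine hB.psubst ?_
  rintro δ (_ | p)
  · exact hS
  · cases p

end IFm

/-! ### Formulas of muMALL under substitutions, negation and encoding -/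

namespace Fm

theorem dual_dual {Δ : PCtx L} {V : Ctx L} (P : Fm L Δ V) : P.dual.dual = P := by
  induction P <;> simp only [dual, *]

theorem dual_injective {Δ : PCtx L} {V : Ctx L} {P Q : Fm L Δ V} (h : P.dual = Q.dual) :
    P = Q := by
  rw [← dual_dual P, h, dual_dual]

theorem dual_subst {Δ : PCtx L} {V W : Ctx L} (P : Fm L Δ V) (σ : Sub L V W) :
    (P.subst σ).dual = P.dual.subst σ := by
  induction P generalizing W <;> simp only [dual, subst, *]

theorem dual_prename {Δ Δ' : PCtx L} {V : Ctx L} (P : Fm L Δ V) (ρ : Ren Δ Δ') :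
    (P.prename ρ).dual = P.dual.prename ρ := by
  induction P generalizing Δ' <;> simp only [dual, prename, *]

theorem dual_psubst {Δ Δ' : PCtx L} {V : Ctx L} (P : Fm L Δ V) (τ : PSub L Δ Δ') :
    (P.psubst τ).dual = P.dual.psubst (fun _ p => (τ p).dual) := by
  have h : ∀ {Δ Δ' : PCtx L} (τ : PSub L Δ Δ') (γ : Ctx L),
      (fun _ p => (τ.lift γ p).dual : PSub L (γ :: Δ) (γ :: Δ')) =
        PSub.lift (fun _ p => (τ p).dual) γ := by
    intro Δ Δ' τ γ
    funext a x
    cases x with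
    | zero => rfl
    | succ x => simp only [PSub.lift, dual_prename]
  induction P generalizing Δ' <;> simp only [dual, psubst, dual_subst, *]

theorem dual_inst {γ : Ctx L} (B : Fm L [γ] γ) (S : Fm L [] γ) :
    (B.inst S).dual = B.dual.inst S.dual := by
  rw [inst, dual_psubst, inst]
  congr 1
  funext a x
  cases x with
  | zero => rfl
  | succ x => cases x

theorem prename_prename {Δ Δ' Δ'' : PCtx L} {V : Ctx L} (P : Fm L Δ V) (ρ : Ren Δ Δ')
    (ρ' : Ren Δ' Δ'') : (P.prename ρ).prename ρ' = P.prename (fun _ x => ρ' (ρ x)) := by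
  induction P generalizing Δ' Δ'' <;> simp only [prename, Ren.lift_lift, *]

theorem prename_psubst {Δ Δ' Δ'' : PCtx L} {V : Ctx L} (P : Fm L Δ V) (ρ : Ren Δ Δ')
    (τ : PSub L Δ' Δ'') : (P.prename ρ).psubst τ = P.psubst (fun _ x => τ (ρ x)) := by
  have h : ∀ {Δ Δ' Δ'' : PCtx L} (ρ : Ren Δ Δ') (τ : PSub L Δ' Δ'') (γ : Ctx L),
      (fun _ x => τ.lift γ (ρ.lift γ x) : PSub L (γ :: Δ) (γ :: Δ'')) =
        PSub.lift (fun _ x => τ (ρ x)) γ := by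
    intro Δ Δ' Δ'' ρ τ γ
    funext a x
    cases x <;> rfl
  induction P generalizing Δ' Δ'' <;> simp only [prename, psubst, *]

theorem psubst_pvar {Δ Δ' : PCtx L} {V : Ctx L} (P : Fm L Δ V) (ρ : Ren Δ Δ') :
    P.psubst (fun γ p => pvar (ρ p) (Sub.id γ)) = P.prename ρ := by
  have h : ∀ {Δ Δ' : PCtx L} (ρ : Ren Δ Δ') (γ : Ctx L),
      PSub.lift (fun γ p => pvar (ρ p) (Sub.id γ) : PSub L Δ Δ') γ =
        fun δ p => pvar (ρ.lift γ p) (Sub.id δ) := by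
    intro Δ Δ' ρ γ
    funext a x
    cases x <;> rfl
  induction P generalizing Δ' <;> simp only [prename, psubst, subst, Sub.id_comp, *]

theorem prename_id {Δ : PCtx L} {V : Ctx L} (P : Fm L Δ V) : P.prename (fun _ p => p) = P := by
  have h : ∀ (Δ : PCtx L) (γ : Ctx L),
      Ren.lift (fun _ p => p : Ren Δ Δ) γ = fun _ p => p := by
    intro Δ γ
    funext a x
    cases x <;> rfl
  induction P <;> simp only [prename, *]

theorem subst_prename {Δ Δ' : PCtx L} {V W : Ctx L} (P : Fm L Δ V) (ρ : Ren Δ Δ')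
    (σ : Sub L V W) : (P.prename ρ).subst σ = (P.subst σ).prename ρ := by
  induction P generalizing W Δ' <;> simp only [subst, prename, *]

theorem prename_nil_psubst {Δ Δ' : PCtx L} {V : Ctx L} (P : Fm L [] V) (ρ : Ren [] Δ)
    (ρ' : Ren [] Δ') (τ : PSub L Δ Δ') : (P.prename ρ).psubst τ = P.prename ρ' := by
  rw [prename_psubst, ← psubst_pvar]
  congr 1
  funext γ p
  cases p

theorem prename_nil_prename {Δ Δ' : PCtx L} {V : Ctx L} (P : Fm L [] V) (ρ : Ren [] Δ)
    (ρ' : Ren [] Δ') (ρ'' : Ren Δ Δ') : (P.prename ρ).prename ρ'' = P.prename ρ' := by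
  rw [prename_prename]
  congr 1
  funext γ p
  cases p

theorem prename_nil {V : Ctx L} (P : Fm L [] V) (ρ : Ren [] []) : P.prename ρ = P := by
  rw [show ρ = fun _ p => p from by funext γ p; cases p]
  exact prename_id P

end Fm

namespace IFm

theorem enc_subst {Δ : PCtx L} {V W : Ctx L} (P : IFm L Δ V) (σ : Sub L V W) :
    (P.subst σ).enc = P.enc.subst σ := by
  induction P generalizing W <;>
    simp only [enc, subst, Fm.subst, Fm.subst_prename, Fm.dual_subst, *]

theorem enc_prename {Δ Δ' : PCtx L} {V : Ctx L} (P : IFm L Δ V) (ρ : Ren Δ Δ') :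
    (P.prename ρ).enc = P.enc.prename ρ := by
  induction P generalizing Δ' <;> simp only [enc, prename, Fm.prename, *]
  exact congrArg (Fm.par · _) (Fm.prename_nil_prename _ _ _ _).symm

theorem enc_psubst {Δ Δ' : PCtx L} {V : Ctx L} (P : IFm L Δ V) (τ : PSub L Δ Δ') :
    (P.psubst τ).enc = P.enc.psubst (fun _ p => (τ p).enc) := by
  have h : ∀ {Δ Δ' : PCtx L} (τ : PSub L Δ Δ') (γ : Ctx L),
      (fun _ p => (τ.lift γ p).enc : Fm.PSub L (γ :: Δ) (γ :: Δ')) =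
        Fm.PSub.lift (fun _ p => (τ p).enc) γ := by
    intro Δ Δ' τ γ
    funext a x
    cases x with
    | zero => rfl
    | succ x => simp only [PSub.lift, Fm.PSub.lift, enc_prename]
  induction P generalizing Δ' <;> simp only [enc, psubst, Fm.psubst, enc_subst, *]
  exact congrArg (Fm.par · _) (Fm.prename_nil_psubst _ _ _ _).symm

theorem enc_inst {γ : Ctx L} (B : IFm L [γ] γ) (S : IFm L [] γ) :
    (B.inst S).enc = B.enc.inst S.enc := by
  rw [inst, enc_psubst, Fm.inst]
  congr 1
  funext a x
  cases x with
  | zero => rfl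
  | succ x => cases x

/-- On `H` each connective is encoded by a constructor of its own, and these differ from the
encodings of the remaining connectives; it is therefore enough that one of the two formulas is in
`H`. -/
theorem IsH.enc_injective {Δ : PCtx L} {V : Ctx L} {P Q : IFm L Δ V} (hP : P.IsH)
    (h : P.enc = Q.enc) : P = Q := by
  induction P with
  | and P P' ih ih' =>
    cases Q <;> simp [enc] at h
    rw [ih hP.1 h.1, ih' hP.2 h.2]
  | or P P' ih ih' =>
    cases Q <;> simp [enc] at h
    rw [ih hP.1 h.1, ih' hP.2 h.2]
  | eq s t =>
    cases Q <;> simp [enc] at h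
    obtain ⟨rfl, h₁, h₂⟩ := h
    cases h₁; cases h₂; rfl
  | ex a P ih =>
    cases Q <;> simp [enc] at h
    obtain ⟨rfl, h⟩ := h
    rw [ih hP (eq_of_heq h)]
  | mu B ts ih =>
    cases Q <;> simp [enc] at h
    obtain ⟨rfl, h, h'⟩ := h
    rw [ih hP (eq_of_heq h), eq_of_heq h']
  | pvar p ts =>
    cases Q <;> simp [enc] at h
    obtain ⟨rfl, h, h'⟩ := h
    rw [eq_of_heq h, eq_of_heq h']
  | all a P ih => exact hP.elim
  | imp P P' ih ih' => exact hP.elim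
  | nu B ts ih => exact hP.elim

end IFm

/-! ### Decomposition of hypotheses -/

namespace IFm

theorem map_subst_id {V : Ctx L} (Γ : Multiset (IFm L [] V)) :
    Γ.map (fun Q => Q.subst (Sub.id V)) = Γ := by
  simp only [subst_id, Multiset.map_id']

theorem map_subst_subst {V W X : Ctx L} (Γ : Multiset (IFm L [] V)) (σ : Sub L V W)
    (τ : Sub L W X) : (Γ.map (fun Q => Q.subst σ)).map (fun Q => Q.subst τ) =
      Γ.map (fun Q => Q.subst (σ.comp τ)) := by
  simp only [Multiset.map_map, Function.comp_def, subst_subst]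

/-- Formulas whose rule on the left of the turnstile is invertible and needs no invariant. -/
inductive Async {V : Ctx L} : IFm L [] V → Prop
  | and (P Q : IFm L [] V) : Async (and P Q)
  | or (P Q : IFm L [] V) : Async (or P Q)
  | ex (a : Ty L.Base) (P : IFm L [] (a :: V)) : Async (ex a P)
  | eq {a : Ty L.Base} (s t : Tm L V a) : Async (eq s t)

/-- `A.Step ρ Θ`: under the substitution `ρ`, the hypothesis `A` may be replaced by `Θ`.  All
steps together are the premises of the left rule for `A`, closed under substitution. -/
inductive Step {V W : Ctx L} : IFm L [] V → Sub L V W → Multiset (IFm L [] W) → Prop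
  | and (P Q : IFm L [] V) (ρ : Sub L V W) : Step (and P Q) ρ {P.subst ρ, Q.subst ρ}
  | orLeft (P Q : IFm L [] V) (ρ : Sub L V W) : Step (or P Q) ρ {P.subst ρ}
  | orRight (P Q : IFm L [] V) (ρ : Sub L V W) : Step (or P Q) ρ {Q.subst ρ}
  | ex (a : Ty L.Base) (P : IFm L [] (a :: V)) (ρ : Sub L V W) (t : Tm L W a) :
      Step (ex a P) ρ {P.subst (ρ.snoc t)}
  | eq {a : Ty L.Base} (s t : Tm L V a) (ρ : Sub L V W) (h : s.subst ρ = t.subst ρ) :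
      Step (eq s t) ρ 0

theorem Async.subst {V W : Ctx L} {A : IFm L [] V} (h : A.Async) (σ : Sub L V W) :
    (A.subst σ).Async := by
  cases h <;> constructor

/-- Steps are indexed by arbitrary substitutions, so a step of an instance is already a step of the
formula along the composite. This makes the family of premises of `Calc.left` stable under
substitution. -/
theorem Step.of_subst {V W X : Ctx L} {A : IFm L [] V} {σ : Sub L V W} {ρ : Sub L W X}
    {Θ : Multiset (IFm L [] X)} (h : (A.subst σ).Step ρ Θ) : A.Step (σ.comp ρ) Θ := by
  cases A <;> simp only [IFm.subst] at h <;> cases h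
  · rw [subst_subst, subst_subst]; constructor
  · rw [subst_subst]; exact .orLeft _ _ _
  · rw [subst_subst]; exact .orRight _ _ _
  · constructor
    rw [Tm.subst_subst, Tm.subst_subst] at *
    assumption
  · rw [subst_subst, Sub.lift_comp_snoc]; constructor

theorem Step.subst {V W X : Ctx L} {A : IFm L [] V} {σ : Sub L V W}
    {Θ : Multiset (IFm L [] W)} (h : A.Step σ Θ) (ρ : Sub L W X) :
    (A.subst σ).Step ρ (Θ.map (fun Q => Q.subst ρ)) := by
  cases h
  · exact .and _ _ _
  · exact .orLeft _ _ _
  · exact .orRight _ _ _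
  · simp only [Multiset.map_singleton, subst_subst, Sub.snoc_comp, IFm.subst]
    rw [← Sub.lift_comp_snoc, ← subst_subst]
    exact .ex _ _ _ _
  · rename_i h
    exact .eq _ _ _ (by rw [h])

theorem Step.subst_id {V W : Ctx L} {A : IFm L [] V} {ρ : Sub L V W}
    {Θ : Multiset (IFm L [] W)} (h : A.Step ρ Θ) : (A.subst ρ).Step (Sub.id W) Θ := by
  simpa only [map_subst_id] using h.subst (Sub.id W)

end IFm

/-! ### A calculus without unifiers -/

/-- A predicate with its arguments. -/
abbrev Pred (L : Vocabulary.{u, v, w}) : Type (max u v) := Σ γ : Ctx L, IFm L [] γ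

/-- Axioms of a calculus. -/
abbrev Axioms (L : Vocabulary.{u, v, w}) : Type (max u v) :=
  ∀ V : Ctx L, Multiset (IFm L [] V) → IFm L [] V → Prop

/-- `Calc s E F n V Γ R`: the sequent `V; Γ ⊢ R` has a cut-free derivation of height at most `n`,
with axioms in `E` and (co)invariants in `F`.  Structural rules and the additive rule for
conjunction are available when `s` holds, the multiplicative rule when it does not.  The rules for
eigenvariables and for equality on the left have one premise for each substitution. -/
inductive Calc (s : Prop) (E : Axioms L) (F : Set (Pred L)) :
    ℕ → (V : Ctx L) → Multiset (IFm L [] V) → IFm L [] V → Prop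
  | ax {n : ℕ} {V : Ctx L} {Γ : Multiset (IFm L [] V)} {R : IFm L [] V} (h : E V Γ R) :
      Calc s E F (n + 1) V Γ R
  | weak {n : ℕ} {V : Ctx L} {Γ : Multiset (IFm L [] V)} {R : IFm L [] V} (hs : s)
      (P : IFm L [] V) (d : Calc s E F n V Γ R) : Calc s E F (n + 1) V (P ::ₘ Γ) R
  | contr {n : ℕ} {V : Ctx L} {Γ : Multiset (IFm L [] V)} {R : IFm L [] V} (hs : s)
      (P : IFm L [] V) (d : Calc s E F n V (P ::ₘ P ::ₘ Γ) R) : Calc s E F (n + 1) V (P ::ₘ Γ) R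
  | left {n : ℕ} {V : Ctx L} {Γ : Multiset (IFm L [] V)} {A R : IFm L [] V} (hA : A.Async)
      (d : ∀ (W : Ctx L) (ρ : Sub L V W) (Θ : Multiset (IFm L [] W)), A.Step ρ Θ →
        Calc s E F n W (Θ + Γ.map (fun Q => Q.subst ρ)) (R.subst ρ)) :
      Calc s E F (n + 1) V (A ::ₘ Γ) R
  | muL {n : ℕ} {V γ : Ctx L} {Γ : Multiset (IFm L [] V)} {R : IFm L [] V} (B : IFm L [γ] γ)
      (ts : Sub L γ V) (S : IFm L [] γ) (hS : S.IsH) (hF : ⟨γ, S⟩ ∈ F)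
      (d : Calc s E F n V (S.subst ts ::ₘ Γ) R) (e : Calc s E F n γ {B.inst S} S) :
      Calc s E F (n + 1) V (IFm.mu B ts ::ₘ Γ) R
  | andR {n : ℕ} {V : Ctx L} {Γ : Multiset (IFm L [] V)} {P Q : IFm L [] V} (hs : s)
      (d : Calc s E F n V Γ P) (e : Calc s E F n V Γ Q) : Calc s E F (n + 1) V Γ (IFm.and P Q)
  | tensorR {n : ℕ} {V : Ctx L} {Γ Γ' : Multiset (IFm L [] V)} {P Q : IFm L [] V} (hs : ¬ s)
      (d : Calc s E F n V Γ P) (e : Calc s E F n V Γ' Q) :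
      Calc s E F (n + 1) V (Γ + Γ') (IFm.and P Q)
  | orRLeft {n : ℕ} {V : Ctx L} {Γ : Multiset (IFm L [] V)} (P Q : IFm L [] V)
      (d : Calc s E F n V Γ P) : Calc s E F (n + 1) V Γ (IFm.or P Q)
  | orRRight {n : ℕ} {V : Ctx L} {Γ : Multiset (IFm L [] V)} (P Q : IFm L [] V)
      (d : Calc s E F n V Γ Q) : Calc s E F (n + 1) V Γ (IFm.or P Q)
  | impR {n : ℕ} {V : Ctx L} {Γ : Multiset (IFm L [] V)} {P Q : IFm L [] V}
      (d : Calc s E F n V (P ::ₘ Γ) Q) : Calc s E F (n + 1) V Γ (IFm.imp P Q)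
  | exR {n : ℕ} {V : Ctx L} {Γ : Multiset (IFm L [] V)} (a : Ty L.Base) (P : IFm L [] (a :: V))
      (t : Tm L V a) (d : Calc s E F n V Γ (P.subst (Sub.single t))) :
      Calc s E F (n + 1) V Γ (IFm.ex a P)
  | allR {n : ℕ} {V : Ctx L} {Γ : Multiset (IFm L [] V)} (a : Ty L.Base) (P : IFm L [] (a :: V))
      (d : ∀ (W : Ctx L) (ρ : Sub L V W) (t : Tm L W a),
        Calc s E F n W (Γ.map (fun Q => Q.subst ρ)) (P.subst (ρ.snoc t))) :
      Calc s E F (n + 1) V Γ (IFm.all a P)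
  | muR {n : ℕ} {V γ : Ctx L} {Γ : Multiset (IFm L [] V)} (B : IFm L [γ] γ) (ts : Sub L γ V)
      (d : Calc s E F n V Γ ((B.inst (IFm.mu B (Sub.id γ))).subst ts)) :
      Calc s E F (n + 1) V Γ (IFm.mu B ts)
  | nuR {n : ℕ} {V γ : Ctx L} {Γ : Multiset (IFm L [] V)} (B : IFm L [γ] γ) (ts : Sub L γ V)
      (S : IFm L [] γ) (hS : S.IsH) (hF : ⟨γ, S⟩ ∈ F) (d : Calc s E F n V Γ (S.subst ts))
      (e : Calc s E F n γ {S} (B.inst S)) : Calc s E F (n + 1) V Γ (IFm.nu B ts)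

namespace Calc

variable {s : Prop} {E : Axioms L} {F F' : Set (Pred L)} {n m : ℕ} {V : Ctx L}
  {Γ : Multiset (IFm L [] V)} {R : IFm L [] V}

theorem mono (d : Calc s E F n V Γ R) (hF : F ⊆ F') (h : n ≤ m) : Calc s E F' m V Γ R := by
  induction d generalizing m <;> (
    obtain ⟨m, rfl⟩ : ∃ k, m = k + 1 := ⟨m - 1, by omega⟩
    have hn := Nat.le_of_succ_le_succ h
    clear h)
  case ax h => exact .ax h
  case weak hs P d ih => exact .weak hs P (ih hn)
  case contr hs P d ih => exact .contr hs P (ih hn)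
  case left hA d ih => exact .left hA fun W ρ Θ hΘ => ih W ρ Θ hΘ hn
  case muL B ts S hS hSF d e ihd ihe => exact .muL B ts S hS (hF hSF) (ihd hn) (ihe hn)
  case andR hs d e ihd ihe => exact .andR hs (ihd hn) (ihe hn)
  case tensorR hs d e ihd ihe => exact .tensorR hs (ihd hn) (ihe hn)
  case orRLeft P Q d ih => exact .orRLeft P Q (ih hn)
  case orRRight P Q d ih => exact .orRRight P Q (ih hn)
  case impR d ih => exact .impR (ih hn)
  case exR a P t d ih => exact .exR a P t (ih hn)
  case allR a P d ih => exact .allR a P fun W ρ t => ih W ρ t hn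
  case muR B ts d ih => exact .muR B ts (ih hn)
  case nuR B ts S hS hSF d e ihd ihe => exact .nuR B ts S hS (hF hSF) (ihd hn) (ihe hn)

theorem congr {Γ' : Multiset (IFm L [] V)} (d : Calc s E F n V Γ R) (h : Γ = Γ') :
    Calc s E F n V Γ' R := h ▸ d

theorem exR_subst {W : Ctx L} {Γ : Multiset (IFm L [] W)} (a : Ty L.Base)
    (P : IFm L [] (a :: V)) (σ : Sub L V W) (t : Tm L W a)
    (d : Calc s E F n W Γ (P.subst (σ.snoc t))) :
    Calc s E F (n + 1) W Γ ((IFm.ex a P).subst σ) := by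
  refine .exR a _ t ?_
  rwa [IFm.subst_subst, Sub.lift_comp_single]

/-- Derivations are closed under substitution when the axioms are. -/
theorem subst (hE : ∀ ⦃V : Ctx L⦄ ⦃Γ : Multiset (IFm L [] V)⦄ ⦃R : IFm L [] V⦄, E V Γ R →
      ∀ ⦃W : Ctx L⦄ (σ : Sub L V W), E W (Γ.map (fun Q => Q.subst σ)) (R.subst σ))
    (d : Calc s E F n V Γ R) {W : Ctx L} (σ : Sub L V W) :
    Calc s E F n W (Γ.map (fun Q => Q.subst σ)) (R.subst σ) := by
  induction d generalizing W <;>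
    try simp only [Multiset.map_cons, Multiset.map_add, IFm.subst]
  case ax h => exact .ax (hE h σ)
  case weak hs P d ih => exact .weak hs _ (ih σ)
  case contr hs P d ih =>
    exact .contr hs _ (by simpa only [Multiset.map_cons] using ih σ)
  case left hA d ih =>
    refine .left (hA.subst σ) fun X ρ Θ hΘ => ?_
    rw [IFm.map_subst_subst, IFm.subst_subst]
    exact d X _ Θ hΘ.of_subst
  case muL B ts S hS hSF d e ihd ihe =>
    exact .muL B _ S hS hSF
      (by simpa only [Multiset.map_cons, IFm.subst_subst] using ihd σ) e
  case andR hs d e ihd ihe => exact .andR hs (ihd σ) (ihe σ)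
  case tensorR hs d e ihd ihe => exact .tensorR hs (ihd σ) (ihe σ)
  case orRLeft P Q d ih => exact .orRLeft _ _ (ih σ)
  case orRRight P Q d ih => exact .orRRight _ _ (ih σ)
  case impR d ih => exact .impR (by simpa only [Multiset.map_cons] using ih σ)
  case exR a P t d ih =>
    refine exR_subst a P σ (t.subst σ) ?_
    rw [← Sub.single_comp, ← IFm.subst_subst]
    exact ih σ
  case allR a P d ih =>
    refine .allR a _ fun X ρ t => ?_
    rw [IFm.map_subst_subst, IFm.subst_subst, Sub.lift_comp_snoc]
    exact d X _ t
  case muR B ts d ih => exact .muR B _ (by simpa only [IFm.subst_subst] using ih σ)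
  case nuR B ts S hS hSF d e ihd ihe =>
    exact .nuR B _ S hS hSF (by simpa only [IFm.subst_subst] using ihd σ) e

end Calc

/-! ### The linear calculus: inversion -/

/-- The axioms of the linear calculus: identity and reflexivity. -/
def linAx : Axioms L := fun V Γ R =>
  Γ = {R} ∨ Γ = 0 ∧ ∃ (a : Ty L.Base) (t : Tm L V a), R = IFm.eq t t

/-- The linear calculus. -/
abbrev Lin (F : Set (Pred L)) : ℕ → (V : Ctx L) → Multiset (IFm L [] V) → IFm L [] V → Prop :=
  Calc False linAx F

namespace Lin

variable {F F' : Set (Pred L)} {n m : ℕ} {V : Ctx L} {Γ : Multiset (IFm L [] V)}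
  {R : IFm L [] V}

theorem ident (A : IFm L [] V) : Lin F (n + 1) V {A} A := .ax (.inl rfl)

theorem eqR {a : Ty L.Base} (t : Tm L V a) : Lin F (n + 1) V 0 (IFm.eq t t) :=
  .ax (.inr ⟨rfl, a, t, rfl⟩)

theorem subst (d : Lin F n V Γ R) {W : Ctx L} (σ : Sub L V W) :
    Lin F n W (Γ.map (fun Q => Q.subst σ)) (R.subst σ) := by
  refine Calc.subst ?_ d σ
  rintro V Γ R (rfl | ⟨rfl, a, t, rfl⟩) W σ
  · exact .inl (Multiset.map_singleton _ _)
  · exact .inr ⟨rfl, a, t.subst σ, rfl⟩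

/-- The step of a hypothesis leads from the hypothesis itself to its instance. -/
theorem of_step {W : Ctx L} {A : IFm L [] V} {ρ : Sub L V W} {Θ : Multiset (IFm L [] W)}
    (h : A.Step ρ Θ) : Lin F (n + 2) W Θ (A.subst ρ) := by
  cases h with
  | and P Q => exact .tensorR (Γ := {P.subst ρ}) not_false (ident _) (ident _)
  | orLeft P Q => exact .orRLeft _ _ (ident _)
  | orRight P Q => exact .orRRight _ _ (ident _)
  | ex a P _ t => exact Calc.exR_subst a P ρ t (ident _)
  | eq s t _ h =>
    simp only [IFm.subst, h]
    exact eqR _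

/-- The invertible left rules are invertible. -/
theorem step {A : IFm L [] V} (d : Lin F n V (A ::ₘ Γ) R) {W : Ctx L} {ρ : Sub L V W}
    {Θ : Multiset (IFm L [] W)} (h : A.Step ρ Θ) :
    Lin F (n + 1) W (Θ + Γ.map (fun Q => Q.subst ρ)) (R.subst ρ) := by
  generalize hΔ : A ::ₘ Γ = Δ at d
  induction d generalizing W
  case ax h' =>
    subst hΔ
    rcases h' with h' | ⟨h', -⟩
    -- An identity axiom on `A` is replaced by a derivation of `A` from its components, which
    -- accounts for the extra unit of height.
    · obtain ⟨rfl, rfl⟩ := (Multiset.cons_eq_cons.1 h').resolve_right (by simp)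
      simpa using of_step h
    · exact (Multiset.cons_ne_zero h').elim
  case weak hs P d ih => exact hs.elim
  case contr hs P d ih => exact hs.elim
  case left hA d ih =>
    rcases Multiset.cons_eq_cons.1 hΔ with ⟨rfl, rfl⟩ | ⟨-, cs, rfl, rfl⟩
    · exact (d W ρ Θ h).mono le_rfl (by omega)
    · rw [Multiset.map_cons, Multiset.add_cons]
      refine .left (hA.subst ρ) fun X σ Θ' hΘ' => ?_
      -- The premise already lives under the composite of `ρ` and `σ`; what remains of the step of
      -- `A` is a step of its instance along the identity.
      have h' := ih X _ Θ' hΘ'.of_subst (h.subst σ).of_subst.subst_id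
        (by rw [Multiset.map_cons, Multiset.add_cons])
      rw [IFm.map_subst_id, IFm.subst_id] at h'
      rw [Multiset.map_add, IFm.map_subst_subst, IFm.subst_subst, add_left_comm]
      exact h'
  case muL B ts S hS hSF d e ihd ihe =>
    rcases Multiset.cons_eq_cons.1 hΔ with ⟨rfl, rfl⟩ | ⟨-, cs, rfl, rfl⟩
    · cases h
    · rw [Multiset.map_cons, Multiset.add_cons]
      refine .muL B _ S hS hSF ?_ (e.mono le_rfl (by omega))
      have := ihd h (Multiset.cons_swap _ _ _)
      simpa only [Multiset.map_cons, Multiset.add_cons, IFm.subst_subst] using this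
  case andR hs d e ihd ihe => exact hs.elim
  case tensorR Γ₁ Γ₂ P Q hs d e ihd ihe =>
    -- The hypothesis belongs to one premise, which is inverted; the other premise is only
    -- instantiated.
    have hmem : A ∈ Γ₁ + Γ₂ := hΔ ▸ Multiset.mem_cons_self A Γ
    rcases Multiset.mem_add.1 hmem with hA | hA
    · obtain ⟨cs, rfl⟩ := Multiset.exists_cons_of_mem hA
      rw [Multiset.cons_add, Multiset.cons_inj_right] at hΔ
      rw [hΔ, Multiset.map_add, ← add_assoc]
      exact .tensorR hs (ihd h rfl) ((subst e ρ).mono le_rfl (by omega))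
    · obtain ⟨cs, rfl⟩ := Multiset.exists_cons_of_mem hA
      rw [Multiset.add_cons, Multiset.cons_inj_right] at hΔ
      rw [hΔ, Multiset.map_add, add_left_comm]
      exact .tensorR hs ((subst d ρ).mono le_rfl (by omega)) (ihe h rfl)
  case orRLeft P Q d ih => exact .orRLeft _ _ (ih h hΔ)
  case orRRight P Q d ih => exact .orRRight _ _ (ih h hΔ)
  case impR P Q d ih =>
    refine .impR ?_
    have := ih h (Γ := P ::ₘ Γ) (by rw [← hΔ, Multiset.cons_swap])
    rwa [Multiset.map_cons, Multiset.add_cons] at this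
  case exR a P t d ih =>
    refine Calc.exR_subst a P ρ (t.subst ρ) ?_
    have := ih h hΔ
    rwa [IFm.subst_subst, Sub.single_comp] at this
  case allR a P d ih =>
    refine .allR a _ fun X σ t => ?_
    have h' := ih X (ρ.comp σ) t (h.subst σ).of_subst.subst_id
      (by rw [← hΔ, Multiset.map_cons])
    rw [IFm.map_subst_id, IFm.subst_id] at h'
    rwa [Multiset.map_add, IFm.map_subst_subst, IFm.subst_subst, Sub.lift_comp_snoc]
  case muR B ts d ih =>
    refine .muR B _ ?_
    have := ih h hΔ
    rwa [IFm.subst_subst] at this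
  case nuR B ts S hS hSF d e ihd ihe =>
    refine .nuR B _ S hS hSF ?_ (e.mono le_rfl (by omega))
    have := ihd h hΔ
    rwa [IFm.subst_subst] at this

end Lin

/-! ### Weakening and contraction in the linear calculus -/

namespace IFm

/-- A true formula of the fragment of hypotheses. -/
noncomputable def verum [Nonempty L.Base] (Δ : PCtx L) (V : Ctx L) : IFm L Δ V :=
  let t : Tm L V (.arr (.base (Classical.arbitrary L.Base)) (.base (Classical.arbitrary L.Base))) :=
    Quotient.mk _ (RawTm.lam (RawTm.var .zero))
  eq t t

theorem isH_verum [Nonempty L.Base] (Δ : PCtx L) (V : Ctx L) : (verum Δ V).IsH := trivial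

theorem verum_psubst_snoc [Nonempty L.Base] {Δ : PCtx L} {V γ : Ctx L}
    (B : IFm L (γ :: Δ) V) :
    B.psubst (PSub.snoc (fun δ _ => verum [] δ) (verum [] γ)) =
      B.psubst (fun δ _ => verum [] δ) := by
  congr 1
  funext δ p
  cases p <;> rfl

/-- The pointwise conjunction of predicate substitutions. -/
def PSub.and {Δ Δ' : PCtx L} (τ τ' : PSub L Δ Δ') : PSub L Δ Δ' :=
  fun _ p => IFm.and (τ p) (τ' p)

theorem PSub.and_snoc {Δ Δ' : PCtx L} {γ : Ctx L} (τ τ' : PSub L Δ Δ') (S S' : IFm L Δ' γ) :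
    (PSub.and τ τ').snoc (IFm.and S S') = PSub.and (τ.snoc S) (τ'.snoc S') := by
  funext δ p
  cases p <;> rfl

theorem IsH.psubst_lift {Δ : PCtx L} {γ : Ctx L} {B : IFm L (γ :: Δ) γ} (hB : B.IsH)
    {τ : PSub L Δ []} (hτ : ∀ ⦃δ : Ctx L⦄ (p : Var Δ δ), (τ p).IsH) :
    (B.psubst (τ.lift γ)).IsH := by
  refine hB.psubst ?_
  intro δ p
  cases p with
  | zero => trivial
  | succ p => exact (isH_prename _ _).2 (hτ p)

end IFm

namespace Lin

variable {F : Set (Pred L)} {n : ℕ} {V : Ctx L} {Γ : Multiset (IFm L [] V)} {R : IFm L [] V}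

/-- Every premise of the left rule for an equation is an instance of the given derivation, so an
equation can be weakened in whether or not it is solvable. -/
theorem weak_eq {a : Ty L.Base} (s t : Tm L V a) (d : Lin F n V Γ R) :
    Lin F (n + 1) V (IFm.eq s t ::ₘ Γ) R := by
  refine .left (.eq s t) fun W ρ Θ hΘ => ?_
  cases hΘ
  rw [zero_add]
  exact subst d ρ

/-- With invariants in `K`, at the cost of `m` more inferences, instances of `A` may be added
to the hypotheses. -/
def Weakens (K : Set (Pred L)) (m : ℕ) (A : IFm L [] V) : Prop :=
  ∀ ⦃F : Set (Pred L)⦄, K ⊆ F → ∀ ⦃W : Ctx L⦄ (σ : Sub L V W) ⦃n : ℕ⦄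
    ⦃Γ : Multiset (IFm L [] W)⦄ ⦃R : IFm L [] W⦄, Lin F n W Γ R →
      Lin F (n + m) W (A.subst σ ::ₘ Γ) R

/-- With invariants in `K`, at the cost of `m` more inferences, instances of `A₁` and `A₂` may be
replaced by one of `A`. -/
def Merges (K : Set (Pred L)) (m : ℕ) (A₁ A₂ A : IFm L [] V) : Prop :=
  ∀ ⦃F : Set (Pred L)⦄, K ⊆ F → ∀ ⦃W : Ctx L⦄ (σ : Sub L V W) ⦃n : ℕ⦄
    ⦃Γ : Multiset (IFm L [] W)⦄ ⦃R : IFm L [] W⦄,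
      Lin F n W (A₁.subst σ ::ₘ A₂.subst σ ::ₘ Γ) R → Lin F (n + m) W (A.subst σ ::ₘ Γ) R

/-- Each connective of `H` passes weakening on to its components. A least fixed point is weakened by
induction with the true equation as invariant: the equation itself can be weakened in, and the
invariance premise follows by weakening the axiom for the equation with the body, whose own variable
has also become that equation. -/
theorem exists_weakens_psubst [Nonempty L.Base] {Δ : PCtx L} (C : IFm L Δ V) (hC : C.IsH) :
    ∃ K : Set (Pred L), K.Finite ∧ ∃ m, Weakens K m (C.psubst (fun γ _ => IFm.verum [] γ)) := by
  induction C with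
  | and P Q ihP ihQ =>
    obtain ⟨K, hK, m, h⟩ := ihP hC.1
    obtain ⟨K', hK', m', h'⟩ := ihQ hC.2
    refine ⟨K ∪ K', hK.union hK', m + m' + 1, fun F hF W σ n Γ R d => ?_⟩
    refine Calc.mono (.left (.and _ _) fun X ρ Θ hΘ => ?_) subset_rfl
      (show n + m' + m + 1 ≤ _ by omega)
    cases hΘ
    rw [IFm.subst_subst, IFm.subst_subst, Multiset.insert_eq_cons, Multiset.cons_add,
      Multiset.singleton_add]
    exact h (Set.subset_union_left.trans hF) _ (h' (Set.subset_union_right.trans hF) _ (subst d ρ))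
  | or P Q ihP ihQ =>
    obtain ⟨K, hK, m, h⟩ := ihP hC.1
    obtain ⟨K', hK', m', h'⟩ := ihQ hC.2
    refine ⟨K ∪ K', hK.union hK', m + m' + 1, fun F hF W σ n Γ R d => ?_⟩
    refine .left (.or _ _) fun X ρ Θ hΘ => ?_
    cases hΘ <;> rw [IFm.subst_subst, Multiset.singleton_add]
    · exact (h (Set.subset_union_left.trans hF) _ (subst d ρ)).mono subset_rfl (by change _ ≤ n + (m + m'); omega)
    · exact (h' (Set.subset_union_right.trans hF) _ (subst d ρ)).mono subset_rfl (by change _ ≤ n + (m + m'); omega)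
  | eq s t => exact ⟨∅, Set.finite_empty, 1, fun F hF W σ n Γ R d => weak_eq _ _ d⟩
  | ex a P ih =>
    obtain ⟨K, hK, m, h⟩ := ih hC
    refine ⟨K, hK, m + 1, fun F hF W σ n Γ R d => ?_⟩
    refine .left (.ex _ _) fun X ρ Θ hΘ => ?_
    cases hΘ
    rw [IFm.subst_subst, Multiset.singleton_add]
    exact h hF _ (subst d ρ)
  | @mu Δ V γ B ts ih =>
    obtain ⟨K, hK, m, h⟩ := ih hC
    refine ⟨insert ⟨γ, IFm.verum [] γ⟩ K, hK.insert _, m + 2, fun F hF W σ n Γ R d => ?_⟩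
    rw [Set.insert_subset_iff] at hF
    refine .muL (n := n + m + 1) _ _ _ (IFm.isH_verum _ _) hF.1
      (Calc.mono (weak_eq _ _ d) subset_rfl (by omega)) ?_
    rw [IFm.psubst_lift_inst, IFm.verum_psubst_snoc]
    have := h hF.2 (Sub.id γ) (Γ := 0) (R := IFm.verum [] γ) (eqR (n := 0) _)
    rw [IFm.subst_id] at this
    exact this.mono subset_rfl (by omega)
  | pvar p ts => exact ⟨∅, Set.finite_empty, 1, fun F hF W σ n Γ R d => weak_eq _ _ d⟩
  | all a P ih => exact hC.elim
  | imp P Q ihP ihQ => exact hC.elim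
  | nu B ts ih => exact hC.elim

theorem exists_weakens [Nonempty L.Base] (A : IFm L [] V) (hA : A.IsH) :
    ∃ K : Set (Pred L), K.Finite ∧ ∃ m, Weakens K m A := by
  have := exists_weakens_psubst A hA
  rwa [IFm.psubst_nil] at this

/-- Contraction at a connective decomposes both copies along the same substitution before the
components are merged; each inversion costs one inference. -/
theorem step_step {W : Ctx L} {A B : IFm L [] V} {ρ : Sub L V W} {Θ Θ' : Multiset (IFm L [] W)}
    (d : Lin F n V (A ::ₘ B ::ₘ Γ) R) (h : A.Step ρ Θ) (h' : B.Step ρ Θ') :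
    Lin F (n + 2) W (Θ + (Θ' + Γ.map (fun Q => Q.subst ρ))) (R.subst ρ) := by
  have := step d h
  rw [Multiset.map_cons, Multiset.add_cons] at this
  have := step this h'.subst_id
  rwa [IFm.map_subst_id, IFm.subst_id, add_left_comm] at this

/-- Contraction is generalized to two different instances of one operator because, under a fixed
point, the copies to be merged hold different predicates. At a predicate variable the claim is the
left rule for conjunction; elsewhere monotonicity carries it through. -/
theorem exists_merges_psubst {Δ : PCtx L} (C : IFm L Δ V) (hC : C.IsH) (τ τ' : IFm.PSub L Δ [])
    (hτ : ∀ ⦃γ : Ctx L⦄ (p : Var Δ γ), (τ p).IsH)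
    (hτ' : ∀ ⦃γ : Ctx L⦄ (p : Var Δ γ), (τ' p).IsH) :
    ∃ K : Set (Pred L), K.Finite ∧ ∃ m,
      Merges K m (C.psubst τ) (C.psubst τ') (C.psubst (IFm.PSub.and τ τ')) := by
  induction C with
  | and P Q ihP ihQ =>
    obtain ⟨K, hK, m, h⟩ := ihP hC.1 τ τ' hτ hτ'
    obtain ⟨K', hK', m', h'⟩ := ihQ hC.2 τ τ' hτ hτ'
    refine ⟨K ∪ K', hK.union hK', m + m' + 3, fun F hF W σ n Γ R d => ?_⟩
    refine Calc.mono (.left (.and _ _) fun X ρ Θ hΘ => ?_) subset_rfl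
      (show n + 2 + m + m' + 1 ≤ _ by omega)
    cases hΘ
    have := step_step d (.and _ _ ρ) (.and _ _ ρ)
    simp only [IFm.subst_subst, Multiset.insert_eq_cons, Multiset.cons_add,
      Multiset.singleton_add] at this ⊢
    rw [Multiset.cons_swap]
    refine h' (Set.subset_union_right.trans hF) _ ?_
    have := h (Set.subset_union_left.trans hF) _
      (this.congr (by rw [Multiset.cons_swap ((Q.psubst τ).subst _)]))
    refine this.congr ?_
    rw [Multiset.cons_swap ((P.psubst _).subst _), Multiset.cons_swap ((P.psubst _).subst _)]
  | or P Q ihP ihQ =>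
    obtain ⟨K, hK, m, h⟩ := ihP hC.1 τ τ' hτ hτ'
    obtain ⟨K', hK', m', h'⟩ := ihQ hC.2 τ τ' hτ hτ'
    refine ⟨K ∪ K', hK.union hK', m + m' + 3, fun F hF W σ n Γ R d => ?_⟩
    refine .left (.or _ _) fun X ρ Θ hΘ => ?_
    cases hΘ
    · have := step_step d (.orLeft _ _ ρ) (.orLeft _ _ ρ)
      simp only [IFm.subst_subst, Multiset.singleton_add] at this ⊢
      exact (h (Set.subset_union_left.trans hF) _ this).mono subset_rfl (by change _ ≤ n + (m + m' + 2); omega)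
    · have := step_step d (.orRight _ _ ρ) (.orRight _ _ ρ)
      simp only [IFm.subst_subst, Multiset.singleton_add] at this ⊢
      exact (h' (Set.subset_union_right.trans hF) _ this).mono subset_rfl (by change _ ≤ n + (m + m' + 2); omega)
  | eq s t =>
    refine ⟨∅, Set.finite_empty, 3, fun F hF W σ n Γ R d => ?_⟩
    refine .left (.eq _ _) fun X ρ Θ hΘ => ?_
    cases hΘ with
    | eq _ _ _ h =>
      have := step_step d (.eq _ _ ρ h) (.eq _ _ ρ h)
      rwa [zero_add] at this
  | ex a P ih =>
    obtain ⟨K, hK, m, h⟩ := ih hC τ τ' hτ hτ'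
    refine ⟨K, hK, m + 3, fun F hF W σ n Γ R d => ?_⟩
    refine .left (.ex _ _) fun X ρ Θ hΘ => ?_
    cases hΘ with
    | ex _ _ _ t =>
      have := step_step d (.ex _ _ ρ t) (.ex _ _ ρ t)
      simp only [IFm.subst_subst, Multiset.singleton_add] at this ⊢
      exact (h hF _ this).mono subset_rfl (by change _ ≤ n + (m + 2); omega)
  | @mu Δ V γ B ts ih =>
    set M := IFm.mu (B.psubst (τ.lift γ)) (Sub.id γ) with hM
    set M' := IFm.mu (B.psubst (τ'.lift γ)) (Sub.id γ) with hM'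
    have hMH : M.IsH := IFm.IsH.psubst_lift (B := B) hC hτ
    have hMH' : M'.IsH := IFm.IsH.psubst_lift (B := B) hC hτ'
    obtain ⟨K, hK, m, h⟩ := ih hC (τ.snoc M) (τ'.snoc M')
      (by rintro δ (_ | p); exacts [hMH, hτ p]) (by rintro δ (_ | p); exacts [hMH', hτ' p])
    -- The invariant is the conjunction of the two fixed points. For the main premise it only has to
    -- be split; for invariance the body is merged by the induction hypothesis and each half is
    -- folded.
    refine ⟨insert ⟨γ, IFm.and M M'⟩ K, hK.insert _, m + 4, fun F hF W σ n Γ R d => ?_⟩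
    rw [Set.insert_subset_iff] at hF
    refine .muL (n := n + m + 3) _ _ (IFm.and M M') ⟨hMH, hMH'⟩ hF.1 ?_ ?_
    · refine Calc.mono (.left (.and _ _) fun X ρ Θ hΘ => ?_) subset_rfl
        (show n + 1 ≤ _ by omega)
      cases hΘ
      have := subst d ρ
      simpa only [Multiset.insert_eq_cons, Multiset.cons_add, Multiset.singleton_add,
        Multiset.map_cons, IFm.subst, hM, hM', Sub.id_comp, IFm.psubst] using this
    · rw [IFm.psubst_lift_inst, IFm.PSub.and_snoc]
      have unfold : ∀ (τ : IFm.PSub L Δ []), Lin F 2 γ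
          {B.psubst (τ.snoc (IFm.mu (B.psubst (τ.lift γ)) (Sub.id γ)))}
          (IFm.mu (B.psubst (τ.lift γ)) (Sub.id γ)) := by
        intro τ
        refine .muR _ _ ?_
        rw [IFm.psubst_lift_inst, IFm.subst_id]
        exact ident _
      have := h hF.2 (Sub.id γ) (Γ := 0) (R := IFm.and M M') (n := 3) (by
        rw [IFm.subst_id, IFm.subst_id]
        exact .tensorR (Γ := {_}) not_false (unfold τ) (unfold τ'))
      rw [IFm.subst_id] at this
      exact this.mono subset_rfl (by omega)
  | pvar p ts =>
    refine ⟨∅, Set.finite_empty, 1, fun F hF W σ n Γ R d => ?_⟩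
    refine .left (.and _ _) fun X ρ Θ hΘ => ?_
    cases hΘ
    simpa only [Multiset.insert_eq_cons, Multiset.cons_add, Multiset.singleton_add,
        Multiset.map_cons, IFm.subst, IFm.psubst] using subst d ρ
  | all a P ih => exact hC.elim
  | imp P Q ihP ihQ => exact hC.elim
  | nu B ts ih => exact hC.elim

theorem exists_merges (A : IFm L [] V) (hA : A.IsH) :
    ∃ K : Set (Pred L), K.Finite ∧ ∃ m, Merges K m A A A := by
  have := exists_merges_psubst A hA (fun _ p => p.nil_elim.elim) (fun _ p => p.nil_elim.elim)
    (fun _ p => p.nil_elim.elim) (fun _ p => p.nil_elim.elim)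
  simpa only [IFm.psubst_nil] using this

end Lin

/-! ### Instances of a finite set of formulas -/

/-- Instances of the formulas in `Φ` under term substitutions. -/
def IsInst (Φ : Set (Pred L)) {V : Ctx L} (A : IFm L [] V) : Prop :=
  ∃ x ∈ Φ, ∃ σ : Sub L x.1 V, A = x.2.subst σ

namespace IFm

/-- The formulas which the rules for `A`, with (co)invariants in `F`, put into their premises, up
to term substitution. -/
def parts (F : Set (Pred L)) {V : Ctx L} : IFm L [] V → Set (Pred L)
  | and P Q => {⟨V, P⟩, ⟨V, Q⟩}
  | or P Q => {⟨V, P⟩, ⟨V, Q⟩}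
  | eq _ _ => ∅
  | ex a P => {⟨a :: V, P⟩}
  | mu (γ := γ) B _ =>
      insert ⟨γ, B.inst (mu B (Sub.id γ))⟩ ((fun S => ⟨γ, B.inst S⟩) '' (Sigma.mk γ ⁻¹' F))
  | pvar _ _ => ∅
  | all a P => {⟨a :: V, P⟩}
  | imp P Q => {⟨V, P⟩, ⟨V, Q⟩}
  | nu (γ := γ) B _ => (fun S => ⟨γ, B.inst S⟩) '' (Sigma.mk γ ⁻¹' F)

/-- A fixed point is unfolded only with itself or with an element of `F` of the matching arity, so
each formula has finitely many parts. -/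
theorem finite_parts {F : Set (Pred L)} (hF : F.Finite) {V : Ctx L} (A : IFm L [] V) :
    (A.parts F).Finite := by
  have h : ∀ {γ : Ctx L} (B : IFm L [γ] γ),
      ((fun S => (⟨γ, B.inst S⟩ : Pred L)) '' (Sigma.mk γ ⁻¹' F)).Finite := fun B =>
    (hF.preimage sigma_mk_injective.injOn).image _
  cases A <;> simp only [parts, Set.finite_empty, Set.finite_singleton, Set.finite_insert, h]

/-- `Φ`, the (co)invariants in `F`, and the parts of the formulas in `Φ`. -/
def next (F Φ : Set (Pred L)) : Set (Pred L) := Φ ∪ F ∪ ⋃ x ∈ Φ, x.2.parts F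

theorem finite_next {F Φ : Set (Pred L)} (hF : F.Finite) (hΦ : Φ.Finite) :
    (next F Φ).Finite :=
  (hΦ.union hF).union (hΦ.biUnion fun x _ => finite_parts hF x.2)

end IFm

namespace IsInst

open IFm

variable {F Φ Ψ : Set (Pred L)} {V W : Ctx L}

theorem of_mem {A : IFm L [] V} (h : ⟨V, A⟩ ∈ Φ) : IsInst Φ A :=
  ⟨_, h, Sub.id V, (subst_id A).symm⟩

theorem mono {A : IFm L [] V} (h : IsInst Φ A) (hΦ : Φ ⊆ Ψ) : IsInst Ψ A :=
  let ⟨x, hx, h⟩ := h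
  ⟨x, hΦ hx, h⟩

theorem next {A : IFm L [] V} (h : IsInst Φ A) : IsInst (next F Φ) A :=
  h.mono (Set.subset_union_left.trans Set.subset_union_left)

theorem of_invariant {S : IFm L [] V} (h : ⟨V, S⟩ ∈ F) : IsInst (IFm.next F Φ) S :=
  of_mem (Or.inl (Or.inr h))

theorem subst {A : IFm L [] V} (h : IsInst Φ A) (σ : Sub L V W) : IsInst Φ (A.subst σ) := by
  obtain ⟨x, hx, τ, rfl⟩ := h
  exact ⟨x, hx, _, subst_subst _ _ _⟩

theorem of_parts {x y : Pred L} (hx : x ∈ Φ) (hy : y ∈ x.2.parts F) (σ : Sub L y.1 W) :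
    IsInst (IFm.next F Φ) (y.2.subst σ) :=
  ⟨y, Or.inr (Set.mem_biUnion hx hy), σ, rfl⟩

/-- Term substitution preserves the head connective, so the formula in `Φ` is itself a conjunction,
and its components are among its parts. The other connectives are treated alike. -/
theorem and {P Q : IFm L [] V} (h : IsInst Φ (IFm.and P Q)) :
    IsInst (IFm.next F Φ) P ∧ IsInst (IFm.next F Φ) Q := by
  obtain ⟨⟨U, A⟩, hx, τ, h⟩ := h
  cases A <;> cases h
  exact ⟨of_parts hx (.inl rfl) τ, of_parts hx (.inr rfl) τ⟩

theorem or {P Q : IFm L [] V} (h : IsInst Φ (IFm.or P Q)) :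
    IsInst (IFm.next F Φ) P ∧ IsInst (IFm.next F Φ) Q := by
  obtain ⟨⟨U, A⟩, hx, τ, h⟩ := h
  cases A <;> cases h
  exact ⟨of_parts hx (.inl rfl) τ, of_parts hx (.inr rfl) τ⟩

theorem imp {P Q : IFm L [] V} (h : IsInst Φ (IFm.imp P Q)) :
    IsInst (IFm.next F Φ) P ∧ IsInst (IFm.next F Φ) Q := by
  obtain ⟨⟨U, A⟩, hx, τ, h⟩ := h
  cases A <;> cases h
  exact ⟨of_parts hx (.inl rfl) τ, of_parts hx (.inr rfl) τ⟩

theorem ex {a : Ty L.Base} {P : IFm L [] (a :: V)} (h : IsInst Φ (IFm.ex a P)) :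
    IsInst (IFm.next F Φ) P := by
  obtain ⟨⟨U, A⟩, hx, τ, h⟩ := h
  cases A <;> cases h
  exact of_parts hx rfl _

theorem all {a : Ty L.Base} {P : IFm L [] (a :: V)} (h : IsInst Φ (IFm.all a P)) :
    IsInst (IFm.next F Φ) P := by
  obtain ⟨⟨U, A⟩, hx, τ, h⟩ := h
  cases A <;> cases h
  exact of_parts hx rfl _

theorem mu {γ : Ctx L} {B : IFm L [γ] γ} {ts : Sub L γ V} (h : IsInst Φ (IFm.mu B ts)) :
    IsInst (IFm.next F Φ) (B.inst (IFm.mu B (Sub.id γ))) ∧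
      ∀ S, ⟨γ, S⟩ ∈ F → IsInst (IFm.next F Φ) (B.inst S) := by
  obtain ⟨⟨U, A⟩, hx, τ, h⟩ := h
  cases A <;> cases h
  exact ⟨of_mem (Or.inr (Set.mem_biUnion hx (.inl rfl))),
    fun S hS => of_mem (Or.inr (Set.mem_biUnion hx (.inr ⟨S, hS, rfl⟩)))⟩

theorem nu {γ : Ctx L} {B : IFm L [γ] γ} {ts : Sub L γ V} (h : IsInst Φ (IFm.nu B ts))
    (S : IFm L [] γ) (hS : ⟨γ, S⟩ ∈ F) : IsInst (IFm.next F Φ) (B.inst S) := by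
  obtain ⟨⟨U, A⟩, hx, τ, h⟩ := h
  cases A <;> cases h
  exact of_mem (Or.inr (Set.mem_biUnion hx ⟨S, hS, rfl⟩))

end IsInst

/-- `Φ` bounds the formula `A` of the fragment `H`. -/
abbrev IsHInst (Φ : Set (Pred L)) {V : Ctx L} (A : IFm L [] V) : Prop := A.IsH ∧ IsInst Φ A

theorem IsHInst.subst {Φ : Set (Pred L)} {V W : Ctx L} {A : IFm L [] V} (h : IsHInst Φ A)
    (σ : Sub L V W) : IsHInst Φ (A.subst σ) :=
  ⟨(IFm.isH_subst _ _).2 h.1, h.2.subst σ⟩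

theorem forall_mem_map_isHInst {Φ : Set (Pred L)} {V W : Ctx L} {Γ : Multiset (IFm L [] V)}
    (h : ∀ A ∈ Γ, IsHInst Φ A) (σ : Sub L V W) :
    ∀ A ∈ Γ.map (fun Q => Q.subst σ), IsHInst Φ A := by
  intro B hB
  obtain ⟨A, hA, rfl⟩ := Multiset.mem_map.1 hB
  exact (h A hA).subst σ

theorem IFm.Step.isHInst {F Φ : Set (Pred L)} {V W : Ctx L} {A : IFm L [] V} {ρ : Sub L V W}
    {Θ : Multiset (IFm L [] W)} (h : A.Step ρ Θ) (hA : IsHInst Φ A) :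
    ∀ B ∈ Θ, IsHInst (IFm.next F Φ) B := by
  obtain ⟨hH, hI⟩ := hA
  cases h with
  | and P Q =>
    intro B hB
    rw [Multiset.insert_eq_cons, Multiset.mem_cons, Multiset.mem_singleton] at hB
    rcases hB with rfl | rfl
    exacts [.subst ⟨hH.1, hI.and.1⟩ _, .subst ⟨hH.2, hI.and.2⟩ _]
  | orLeft P Q =>
    intro B hB
    rw [Multiset.mem_singleton.1 hB]
    exact .subst ⟨hH.1, hI.or.1⟩ _
  | orRight P Q =>
    intro B hB
    rw [Multiset.mem_singleton.1 hB]
    exact .subst ⟨hH.2, hI.or.2⟩ _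
  | ex a P _ t =>
    intro B hB
    rw [Multiset.mem_singleton.1 hB]
    exact IsHInst.subst (A := P) ⟨hH, hI.ex⟩ _
  | eq s t _ h => simp

theorem IFm.Step.card_le {V W : Ctx L} {A : IFm L [] V} {ρ : Sub L V W}
    {Θ : Multiset (IFm L [] W)} (h : A.Step ρ Θ) : Θ.card ≤ 2 := by
  cases h <;> simp

/-- Finitely many bounds by a finite set and a number have a common bound. -/
theorem exists_common_bound {α β : Type*} {Φ : Set α} (hΦ : Φ.Finite)
    {Q : α → Set β → ℕ → Prop}
    (mono : ∀ ⦃x K K' m m'⦄, Q x K m → K ⊆ K' → m ≤ m' → Q x K' m')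
    (h : ∀ x ∈ Φ, ∃ K : Set β, K.Finite ∧ ∃ m, Q x K m) :
    ∃ K : Set β, K.Finite ∧ ∃ m, ∀ x ∈ Φ, Q x K m := by
  induction Φ, hΦ using Set.Finite.induction_on with
  | empty => exact ⟨∅, Set.finite_empty, 0, by simp⟩
  | @insert a s _ _ ih =>
    obtain ⟨K, hK, m, hm⟩ := ih fun x hx => h x (Set.mem_insert_of_mem _ hx)
    obtain ⟨K', hK', m', hm'⟩ := h a (Set.mem_insert _ _)
    refine ⟨K ∪ K', hK.union hK', max m m', ?_⟩
    rintro x (rfl | hx)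
    · exact mono hm' Set.subset_union_right (le_max_right _ _)
    · exact mono (hm x hx) Set.subset_union_left (le_max_left _ _)

/-! ### From the intuitionistic calculus to the linear one -/

/-- The axioms of the intuitionistic calculus: the initial rule and reflexivity. -/
def intAx : Axioms L := fun V Γ R =>
  (∃ (γ : Ctx L) (B : IFm L [γ] γ) (ts : Sub L γ V), R = IFm.mu B ts ∧ R ∈ Γ) ∨
    ∃ (a : Ty L.Base) (t : Tm L V a), R = IFm.eq t t

/-- The intuitionistic calculus. -/
abbrev Int (F : Set (Pred L)) : ℕ → (V : Ctx L) → Multiset (IFm L [] V) → IFm L [] V → Prop :=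
  Calc True intAx F

namespace Lin

variable {F Φ : Set (Pred L)} {n : ℕ} {V : Ctx L} {Γ : Multiset (IFm L [] V)} {R : IFm L [] V}

/-- The cost for a formula in `H` is uniform over its instances, and `Φ` is finite; members of `Φ`
outside `H` have no relevant instance and contribute nothing. -/
theorem exists_weak_bound [Nonempty L.Base] (hΦ : Φ.Finite) :
    ∃ K : Set (Pred L), K.Finite ∧ ∃ m, ∀ ⦃F : Set (Pred L)⦄, K ⊆ F →
      ∀ ⦃V : Ctx L⦄ ⦃A : IFm L [] V⦄, IsHInst Φ A → ∀ ⦃n : ℕ⦄ ⦃Γ : Multiset (IFm L [] V)⦄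
        ⦃R : IFm L [] V⦄, Lin F n V Γ R → Lin F (n + m) V (A ::ₘ Γ) R := by
  obtain ⟨K, hK, m, h⟩ := exists_common_bound hΦ
    (Q := fun x K m => x.2.IsH → Weakens K m x.2)
    (fun x K K' m m' h hK hm hx F hF W σ n Γ R d =>
      (h hx (hK.trans hF) σ d).mono subset_rfl (Nat.add_le_add_left hm n))
    (fun x _ => by
      by_cases hx : x.2.IsH
      · obtain ⟨K, hK, m, h⟩ := exists_weakens x.2 hx
        exact ⟨K, hK, m, fun _ => h⟩
      · exact ⟨∅, Set.finite_empty, 0, fun h => (hx h).elim⟩)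
  refine ⟨K, hK, m, fun F hF V A ⟨hA, x, hx, σ, hσ⟩ n Γ R d => ?_⟩
  subst hσ
  exact h x hx ((IFm.isH_subst _ _).1 hA) hF σ d

theorem exists_contr_bound (hΦ : Φ.Finite) :
    ∃ K : Set (Pred L), K.Finite ∧ ∃ m, ∀ ⦃F : Set (Pred L)⦄, K ⊆ F →
      ∀ ⦃V : Ctx L⦄ ⦃A : IFm L [] V⦄, IsHInst Φ A → ∀ ⦃n : ℕ⦄ ⦃Γ : Multiset (IFm L [] V)⦄
        ⦃R : IFm L [] V⦄, Lin F n V (A ::ₘ A ::ₘ Γ) R → Lin F (n + m) V (A ::ₘ Γ) R := by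
  obtain ⟨K, hK, m, h⟩ := exists_common_bound hΦ
    (Q := fun x K m => x.2.IsH → Merges K m x.2 x.2 x.2)
    (fun x K K' m m' h hK hm hx F hF W σ n Γ R d =>
      (h hx (hK.trans hF) σ d).mono subset_rfl (Nat.add_le_add_left hm n))
    (fun x _ => by
      by_cases hx : x.2.IsH
      · obtain ⟨K, hK, m, h⟩ := exists_merges x.2 hx
        exact ⟨K, hK, m, fun _ => h⟩
      · exact ⟨∅, Set.finite_empty, 0, fun h => (hx h).elim⟩)
  refine ⟨K, hK, m, fun F hF V A ⟨hA, x, hx, σ, hσ⟩ n Γ R d => ?_⟩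
  subst hσ
  exact h x hx ((IFm.isH_subst _ _).1 hA) hF σ d

theorem weak_all {p : IFm L [] V → Prop} {m : ℕ}
    (h : ∀ ⦃A⦄, p A → ∀ ⦃n Γ R⦄, Lin F n V Γ R → Lin F (n + m) V (A ::ₘ Γ) R)
    (d : Lin F n V Γ R) (Δ : Multiset (IFm L [] V)) (hΔ : ∀ A ∈ Δ, p A) :
    Lin F (n + Δ.card * m) V (Δ + Γ) R := by
  induction Δ using Multiset.induction_on with
  | empty => simpa using d
  | cons A Δ ih =>
    rw [Multiset.forall_mem_cons] at hΔ
    rw [Multiset.card_cons, add_one_mul, ← add_assoc, Multiset.cons_add]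
    exact h hΔ.1 (ih hΔ.2)

theorem contr_all {p : IFm L [] V → Prop} {m : ℕ}
    (h : ∀ ⦃A⦄, p A → ∀ ⦃n Γ R⦄, Lin F n V (A ::ₘ A ::ₘ Γ) R → Lin F (n + m) V (A ::ₘ Γ) R)
    (Δ : Multiset (IFm L [] V)) (d : Lin F n V (Δ + Δ + Γ) R) (hΔ : ∀ A ∈ Δ, p A) :
    Lin F (n + Δ.card * m) V (Δ + Γ) R := by
  induction Δ using Multiset.induction_on generalizing n Γ with
  | empty => simpa using d
  | cons A Δ ih =>
    rw [Multiset.forall_mem_cons] at hΔ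
    rw [Multiset.card_cons, add_comm _ 1, one_add_mul, ← add_assoc, Multiset.cons_add,
      ← Multiset.add_cons]
    refine ih ?_ hΔ.2
    rw [Multiset.add_cons]
    refine h hΔ.1 (d.congr ?_)
    simp only [Multiset.cons_add, Multiset.add_cons]

end Lin

/-- Weakening and contraction are replaced by their linear simulations, by induction on the height.
The bounds depend on `n`, `k`, `F` and `Φ` alone and precede the quantification over sequents: a
rule may have infinitely many premises, and a bound chosen for each one could not be combined. -/
theorem Int.exists_lin [Nonempty L.Base] (n k : ℕ) {F Φ : Set (Pred L)} (hF : F.Finite)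
    (hΦ : Φ.Finite) : ∃ K : Set (Pred L), K.Finite ∧ ∃ m, ∀ (V : Ctx L)
      (Γ : Multiset (IFm L [] V)) (R : IFm L [] V), Int F n V Γ R → (∀ A ∈ Γ, IsHInst Φ A) →
        R.IsG → IsInst Φ R → Γ.card ≤ k → Lin K m V Γ R := by
  induction n generalizing k Φ with
  | zero =>
    refine ⟨∅, Set.finite_empty, 0, fun V Γ R d => ?_⟩
    cases d
  | succ n ih =>
    -- No inference replaces a hypothesis by more than two, and the premises about an invariant have
    -- a single hypothesis, so `k + 2` bounds all premises.
    obtain ⟨K₀, hK₀, m₀, h₀⟩ := ih (k + 2) (IFm.finite_next hF hΦ)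
    obtain ⟨Kw, hKw, mw, hw⟩ := Lin.exists_weak_bound hΦ
    obtain ⟨Kc, hKc, mc, hc⟩ := Lin.exists_contr_bound hΦ
    replace hw := hw (F := K₀ ∪ Kw ∪ Kc ∪ F) (by intro x; simp; tauto)
    replace hc := hc (F := K₀ ∪ Kw ∪ Kc ∪ F) (by intro x; simp; tauto)
    replace h₀ : ∀ {V : Ctx L} {Γ : Multiset (IFm L [] V)} {R : IFm L [] V}, Int F n V Γ R →
        (∀ A ∈ Γ, IsHInst (IFm.next F Φ) A) → R.IsG → IsInst (IFm.next F Φ) R →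
        Γ.card ≤ k + 2 → Lin (K₀ ∪ Kw ∪ Kc ∪ F) m₀ V Γ R := fun d h₁ h₂ h₃ h₄ =>
      (h₀ _ _ _ d h₁ h₂ h₃ h₄).mono (by intro x; simp; tauto) le_rfl
    have hFK : F ⊆ K₀ ∪ Kw ∪ Kc ∪ F := Set.subset_union_right
    -- An axiom may need up to `k` weakenings, a conjunction on the right up to `k` contractions,
    -- and an explicit structural rule one more of either kind.
    refine ⟨_, ((hK₀.union hKw).union hKc).union hF, m₀ + (k + 1) * mw + (k + 1) * mc + 2, ?_⟩
    generalize K₀ ∪ Kw ∪ Kc ∪ F = K at *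
    intro V Γ R d hΓ hR hRI hk
    have lift : ∀ {Γ : Multiset (IFm L [] V)}, (∀ A ∈ Γ, IsHInst Φ A) →
        ∀ A ∈ Γ, IsHInst (IFm.next F Φ) A := fun h A hA => ⟨(h A hA).1, (h A hA).2.next⟩
    have single : ∀ {γ : Ctx L} {S : IFm L [] γ}, S.IsH → IsInst (IFm.next F Φ) S →
        ∀ A ∈ ({S} : Multiset (IFm L [] γ)), IsHInst (IFm.next F Φ) A := by
      intro γ S hS hSI A hA
      rw [Multiset.mem_singleton.1 hA]
      exact ⟨hS, hSI⟩
    have hkw : k * mw ≤ (k + 1) * mw := Nat.mul_le_mul_right _ (Nat.le_succ k)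
    have hkc : k * mc ≤ (k + 1) * mc := Nat.mul_le_mul_right _ (Nat.le_succ k)
    have hw₁ : mw ≤ (k + 1) * mw := Nat.le_mul_of_pos_left _ (Nat.succ_pos k)
    have hc₁ : mc ≤ (k + 1) * mc := Nat.le_mul_of_pos_left _ (Nat.succ_pos k)
    cases d with
    | ax h =>
      rcases h with ⟨γ, B, ts, rfl, hmem⟩ | ⟨a, t, rfl⟩
      · obtain ⟨Δ, rfl⟩ := Multiset.exists_cons_of_mem hmem
        rw [Multiset.forall_mem_cons] at hΓ
        rw [Multiset.card_cons] at hk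
        have hkΔ : Δ.card * mw ≤ k * mw := Nat.mul_le_mul_right _ (by omega)
        refine ((Lin.weak_all (@hw V) (Lin.ident (n := 0) _) Δ hΓ.2).congr ?_).mono
          subset_rfl (by omega)
        rw [add_comm, Multiset.singleton_add]
      · have hkΔ : Γ.card * mw ≤ k * mw := Nat.mul_le_mul_right _ hk
        refine ((Lin.weak_all (@hw V) (Lin.eqR (n := 0) t) Γ hΓ).congr ?_).mono
          subset_rfl (by omega)
        rw [add_zero]
    | weak hs P d =>
      rw [Multiset.forall_mem_cons] at hΓ
      rw [Multiset.card_cons] at hk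
      exact (hw hΓ.1 (h₀ d (lift hΓ.2) hR hRI.next (by omega))).mono subset_rfl (by omega)
    | contr hs P d =>
      have hΓ' := Multiset.forall_mem_cons.1 hΓ
      rw [Multiset.card_cons] at hk
      refine (hc hΓ'.1 (h₀ d (lift ?_) hR hRI.next ?_)).mono subset_rfl (by omega)
      · exact Multiset.forall_mem_cons.2 ⟨hΓ'.1, hΓ⟩
      · simp only [Multiset.card_cons]; omega
    | left hA d =>
      rw [Multiset.forall_mem_cons] at hΓ
      rw [Multiset.card_cons] at hk
      refine Calc.mono (.left hA fun W ρ Θ hΘ => ?_) subset_rfl (show m₀ + 1 ≤ _ by omega)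
      refine h₀ (d W ρ Θ hΘ) ?_ ((IFm.isG_subst _ _).2 hR) (hRI.next.subst ρ) ?_
      · intro B hB
        rcases Multiset.mem_add.1 hB with hB | hB
        · exact hΘ.isHInst hΓ.1 B hB
        · exact forall_mem_map_isHInst (lift hΓ.2) ρ B hB
      · have := hΘ.card_le
        rw [Multiset.card_add, Multiset.card_map]
        omega
    | muL B ts S hS hSF d e =>
      rw [Multiset.forall_mem_cons] at hΓ
      rw [Multiset.card_cons] at hk
      refine Calc.mono (.muL B ts S hS (hFK hSF) (h₀ d ?_ hR hRI.next ?_) (h₀ e ?_ hS.isG ?_ ?_))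
        subset_rfl (show m₀ + 1 ≤ _ by omega)
      · rw [Multiset.forall_mem_cons]
        exact ⟨⟨(IFm.isH_subst _ _).2 hS, (IsInst.of_invariant hSF).subst ts⟩, lift hΓ.2⟩
      · rw [Multiset.card_cons]; omega
      · exact single (IFm.IsH.inst (B := B) hΓ.1.1 hS) (hΓ.1.2.mu.2 S hSF)
      · exact IsInst.of_invariant hSF
      · rw [Multiset.card_singleton]; omega
    | andR hs d e =>
      -- The multiplicative rule doubles the context, which is then contracted formula by formula.
      have h := Calc.tensorR not_false (h₀ d (lift hΓ) hR.1 hRI.and.1 (by omega))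
        (h₀ e (lift hΓ) hR.2 hRI.and.2 (by omega))
      have hkΓ : Γ.card * mc ≤ k * mc := Nat.mul_le_mul_right _ hk
      have := Lin.contr_all (@hc V) Γ (h.congr (add_zero _).symm) hΓ
      rw [add_zero] at this
      exact this.mono subset_rfl (by omega)
    | tensorR hs d e => exact (hs trivial).elim
    | orRLeft P Q d =>
      exact Calc.mono (.orRLeft _ _ (h₀ d (lift hΓ) hR.1 hRI.or.1 (by omega))) subset_rfl
        (show m₀ + 1 ≤ _ by omega)
    | orRRight P Q d =>
      exact Calc.mono (.orRRight _ _ (h₀ d (lift hΓ) hR.2 hRI.or.2 (by omega))) subset_rfl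
        (show m₀ + 1 ≤ _ by omega)
    | impR d =>
      refine Calc.mono (.impR (h₀ d ?_ hR.2 hRI.imp.2 ?_)) subset_rfl (show m₀ + 1 ≤ _ by omega)
      · exact Multiset.forall_mem_cons.2 ⟨⟨hR.1, hRI.imp.1⟩, lift hΓ⟩
      · rw [Multiset.card_cons]; omega
    | exR a P t d =>
      exact Calc.mono (.exR a P t (h₀ d (lift hΓ) ((IFm.isG_subst P _).2 hR) (hRI.ex.subst _)
        (by omega))) subset_rfl (show m₀ + 1 ≤ _ by omega)
    | allR a P d =>
      refine Calc.mono (.allR a P fun W ρ t => h₀ (d W ρ t) (forall_mem_map_isHInst (lift hΓ) ρ)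
        ((IFm.isG_subst P _).2 hR) (hRI.all.subst _) ?_) subset_rfl (show m₀ + 1 ≤ _ by omega)
      rw [Multiset.card_map]; omega
    | @muR _ _ γ _ B ts d =>
      exact Calc.mono (.muR B ts (h₀ d (lift hΓ) ((IFm.isG_subst _ _).2 (IFm.IsG.inst (B := B)
        (S := IFm.mu B (Sub.id γ)) hR hR)) (hRI.mu.1.subst _) (by omega))) subset_rfl
        (show m₀ + 1 ≤ _ by omega)
    | nuR B ts S hS hSF d e =>
      refine Calc.mono (.nuR B ts S hS (hFK hSF) (h₀ d (lift hΓ) ?_ ?_ (by omega))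
        (h₀ e (single hS (IsInst.of_invariant hSF)) ?_ (hRI.nu S hSF) ?_)) subset_rfl
        (show m₀ + 1 ≤ _ by omega)
      · exact (IFm.isG_subst _ _).2 hS.isG
      · exact (IsInst.of_invariant hSF).subst ts
      · exact IFm.IsG.inst (B := B) hR hS.isG
      · rw [Multiset.card_singleton]; omega

/-! ### Consistency of conversion, and a contradictory formula -/

/-- The set-theoretic interpretation of types, with two elements in each base type. -/
def Ty.Val {B : Type u} : Ty B → Type
  | base _ => Bool
  | arr a c => a.Val → c.Val

def Ty.Val.default {B : Type u} : (a : Ty B) → a.Val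
  | .base _ => false
  | .arr _ c => fun _ => Ty.Val.default c

/-- Values for the variables of a signature. -/
abbrev Env {B : Type u} (V : List (Ty B)) : Type u := ∀ ⦃a : Ty B⦄, Var V a → a.Val

def Env.snoc {B : Type u} {V : List (Ty B)} {b : Ty B} (e : Env V) (d : b.Val) : Env (b :: V)
  | _, .zero => d
  | _, .succ x => e x

namespace RawTm

def eval {V : Ctx L} {a : Ty L.Base} : RawTm L V a → Env V → a.Val
  | var x, e => e x
  | const _, _ => Ty.Val.default _
  | lam t, e => fun d => t.eval (e.snoc d)
  | app t s, e => t.eval e (s.eval e)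

theorem eval_rename {V W : Ctx L} {a : Ty L.Base} (t : RawTm L V a) (ρ : Ren V W) (e : Env W) :
    (t.rename ρ).eval e = t.eval (fun _ x => e (ρ x)) := by
  induction t generalizing W with
  | var x => rfl
  | const c => rfl
  | lam t ih =>
    simp only [rename, eval, ih]
    funext d
    congr 1
    funext b x
    cases x <;> rfl
  | app t s iht ihs => simp only [rename, eval, iht, ihs]

theorem eval_subst {V W : Ctx L} {a : Ty L.Base} (t : RawTm L V a) (σ : RSub L V W) (e : Env W) :
    (t.subst σ).eval e = t.eval (fun _ x => (σ x).eval e) := by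
  induction t generalizing W with
  | var x => rfl
  | const c => rfl
  | lam t ih =>
    simp only [subst, eval, ih]
    funext d
    congr 1
    funext b x
    cases x with
    | zero => rfl
    | succ x => exact eval_rename _ _ _
  | app t s iht ihs => simp only [subst, eval, iht, ihs]

/-- The full type structure over two elements is extensional, so it validates both beta and eta;
distinct values thus witness non-convertibility. -/
theorem Conv.eval_eq {V : Ctx L} {a : Ty L.Base} {t s : RawTm L V a} (h : Conv t s) (e : Env V) :
    t.eval e = s.eval e := by
  induction h with
  | refl t => rfl
  | symm _ ih => exact (ih e).symm
  | trans _ _ ih ih' => exact (ih e).trans (ih' e)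
  | lam _ ih => exact funext fun d => ih _
  | app _ _ ih ih' => simp only [RawTm.eval, ih, ih']
  | beta t s =>
    rw [eval_subst]
    simp only [RawTm.eval]
    congr 1
    funext b x
    cases x <;> rfl
  | eta t =>
    simp only [RawTm.eval, eval_rename]
    rfl

end RawTm

namespace IFm

/-- The equation between the two projections of a base type: a contradictory formula of the
fragment of hypotheses. -/
noncomputable def falsum [Nonempty L.Base] (Δ : PCtx L) (V : Ctx L) : IFm L Δ V :=
  let b : Ty L.Base := .base (Classical.arbitrary L.Base)
  let t : Tm L V (.arr b (.arr b b)) :=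
    Quotient.mk _ (RawTm.lam (RawTm.lam (RawTm.var (.succ .zero))))
  let s : Tm L V (.arr b (.arr b b)) := Quotient.mk _ (RawTm.lam (RawTm.lam (RawTm.var .zero)))
  eq t s

theorem isH_falsum [Nonempty L.Base] (Δ : PCtx L) (V : Ctx L) : (falsum Δ V).IsH := trivial

theorem not_step_falsum [Nonempty L.Base] {V W X : Ctx L} (σ : Sub L V W) (ρ : Sub L W X)
    (Θ : Multiset (IFm L [] X)) : ¬ ((falsum [] V).subst σ).Step ρ Θ := by
  intro h
  replace h := h.of_subst
  generalize σ.comp ρ = τ at h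
  cases h
  rename_i h
  -- A step would make the two projections convertible; their values at `true` and `false` differ.
  have h := (Quotient.exact h : RawTm.Conv _ _).eval_eq (fun a _ => Ty.Val.default a)
  exact Bool.noConfusion (congrFun (congrFun h true) false : true = false)

theorem falsum_psubst_snoc [Nonempty L.Base] {Δ : PCtx L} {V γ : Ctx L}
    (B : IFm L (γ :: Δ) V) :
    B.psubst (PSub.snoc (fun δ _ => falsum [] δ) (falsum [] γ)) =
      B.psubst (fun δ _ => falsum [] δ) := by
  congr 1
  funext δ p
  cases p <;> rfl

/-- Goals that are provable because, through implications, universal quantifiers and greatest fixed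
points, they end in a predicate variable. -/
def Vacuous {Δ : PCtx L} {V : Ctx L} : IFm L Δ V → Prop
  | all _ P => P.Vacuous
  | imp _ Q => Q.Vacuous
  | nu B _ => B.Vacuous
  | pvar _ _ => True
  | _ => False

/-- Hypotheses that are contradictory because, through conjunctions, existential quantifiers and
least fixed points, they end in a predicate variable. -/
def Absurd {Δ : PCtx L} {V : Ctx L} : IFm L Δ V → Prop
  | and _ Q => Q.Absurd
  | ex _ P => P.Absurd
  | mu B _ => B.Absurd
  | pvar _ _ => True
  | _ => False

theorem vacuous_subst {Δ : PCtx L} {V W : Ctx L} (P : IFm L Δ V) (σ : Sub L V W) :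
    (P.subst σ).Vacuous ↔ P.Vacuous := by
  induction P generalizing W <;> simp only [subst, Vacuous, *]

theorem absurd_subst {Δ : PCtx L} {V W : Ctx L} (P : IFm L Δ V) (σ : Sub L V W) :
    (P.subst σ).Absurd ↔ P.Absurd := by
  induction P generalizing W <;> simp only [subst, Absurd, *]

/-- If the encoding of a goal is also the negation of an encoded hypothesis, then the goal is
provable and the hypothesis is contradictory. -/
theorem IsH.vacuous_absurd {Δ : PCtx L} {V : Ctx L} {C D : IFm L Δ V} (hD : D.IsH)
    (h : C.enc = D.enc.dual) : C.Vacuous ∧ D.Absurd := by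
  induction D with
  | and P Q _ ih =>
    cases C <;> simp only [enc, Fm.dual, Fm.par.injEq, reduceCtorEq] at h
    have := ih hD.2 h.2
    exact this
  | or P Q => cases C <;> simp only [enc, Fm.dual, reduceCtorEq] at h
  | eq s t => cases C <;> simp only [enc, Fm.dual, reduceCtorEq] at h
  | ex a P ih =>
    cases C <;> simp only [enc, Fm.dual, Fm.all.injEq, reduceCtorEq] at h
    obtain ⟨rfl, h⟩ := h
    have := ih hD (eq_of_heq h)
    exact this
  | mu B ts ih =>
    cases C <;> simp only [enc, Fm.dual, Fm.nu.injEq, reduceCtorEq] at h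
    obtain ⟨rfl, h, -⟩ := h
    have := ih hD (eq_of_heq h)
    exact this
  | pvar p ts =>
    cases C <;> simp only [enc, Fm.dual, reduceCtorEq] at h
    exact ⟨trivial, trivial⟩
  | all a P => exact hD.elim
  | imp P Q => exact hD.elim
  | nu B ts => exact hD.elim

end IFm

namespace Int

variable {F : Set (Pred L)} {n m : ℕ} {V : Ctx L} {Γ : Multiset (IFm L [] V)} {R : IFm L [] V}

theorem verum [Nonempty L.Base] {γ : Ctx L} (σ : Sub L γ V) :
    Int F (n + 1) V Γ ((IFm.verum [] γ).subst σ) := .ax (.inr ⟨_, _, rfl⟩)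

theorem falsum [Nonempty L.Base] {γ : Ctx L} (σ : Sub L γ V) :
    Int F (n + 1) V ((IFm.falsum [] γ).subst σ ::ₘ Γ) R :=
  .left (.eq _ _) fun _ _ _ hΘ => (IFm.not_step_falsum _ _ _ hΘ).elim

theorem weak_all (d : Int F n V Γ R) (Δ : Multiset (IFm L [] V)) :
    Int F (n + Δ.card) V (Δ + Γ) R := by
  induction Δ using Multiset.induction_on with
  | empty => simpa using d
  | cons A Δ ih =>
    rw [Multiset.card_cons, Multiset.cons_add]
    exact .weak trivial A ih

/-- Identity is expanded down to least fixed points, where the initial rule applies. The induction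
never enters the body of a fixed point, so the absence of predicate variables is preserved; the
substitution `τ` serves only to land in formulas without predicate variables. -/
theorem exists_ident_psubst {Δ : PCtx L} (hΔ : ∀ γ, Var Δ γ → False) (A : IFm L Δ V)
    (hA : A.IsH) (τ : IFm.PSub L Δ []) : ∃ m, ∀ (F : Set (Pred L)) (W : Ctx L)
      (σ : Sub L V W), Int F m W {(A.psubst τ).subst σ} ((A.psubst τ).subst σ) := by
  induction A with
  | and P Q ihP ihQ =>
    obtain ⟨m, h⟩ := ihP hΔ hA.1 τ
    obtain ⟨m', h'⟩ := ihQ hΔ hA.2 τ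
    refine ⟨max m m' + 3, fun F W σ => .left (Γ := 0) (.and _ _) fun X ρ Θ hΘ => ?_⟩
    cases hΘ
    rw [Multiset.map_zero, add_zero, Multiset.insert_eq_cons]
    simp only [IFm.psubst, IFm.subst, IFm.subst_subst]
    refine .andR trivial (.congr (.weak trivial _ ((h F X _).mono subset_rfl (le_max_left _ _)))
      (Multiset.cons_swap _ _ 0)) (.weak trivial _ ((h' F X _).mono subset_rfl (le_max_right _ _)))
  | or P Q ihP ihQ =>
    obtain ⟨m, h⟩ := ihP hΔ hA.1 τ
    obtain ⟨m', h'⟩ := ihQ hΔ hA.2 τ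
    refine ⟨max m m' + 2, fun F W σ => .left (Γ := 0) (.or _ _) fun X ρ Θ hΘ => ?_⟩
    cases hΘ <;> simp only [Multiset.map_zero, add_zero, IFm.psubst, IFm.subst, IFm.subst_subst]
    · exact .orRLeft _ _ ((h F X _).mono subset_rfl (le_max_left _ _))
    · exact .orRRight _ _ ((h' F X _).mono subset_rfl (le_max_right _ _))
  | eq s t =>
    refine ⟨2, fun F W σ => .left (Γ := 0) (.eq _ _) fun X ρ Θ hΘ => ?_⟩
    cases hΘ with
    | eq _ _ _ h =>
      simp only [IFm.psubst, IFm.subst, h]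
      exact .ax (.inr ⟨_, _, rfl⟩)
  | ex a P ih =>
    obtain ⟨m, h⟩ := ih hΔ hA τ
    refine ⟨m + 2, fun F W σ => .left (Γ := 0) (.ex _ _) fun X ρ Θ hΘ => ?_⟩
    cases hΘ with
    | ex _ _ _ t =>
      rw [Multiset.map_zero, add_zero]
      refine Calc.exR_subst a _ ρ t ?_
      rw [IFm.subst_subst]
      exact h F X _
  | mu B ts ih =>
    exact ⟨1, fun F W σ => .ax (.inl ⟨_, _, _, rfl, Multiset.mem_singleton_self _⟩)⟩
  | pvar p ts => exact (hΔ _ p).elim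
  | all a P ih => exact hA.elim
  | imp P Q ihP ihQ => exact hA.elim
  | nu B ts ih => exact hA.elim

theorem exists_ident (A : IFm L [] V) (hA : A.IsH) : ∃ m, ∀ (F : Set (Pred L)) (W : Ctx L)
    (σ : Sub L V W), Int F m W {A.subst σ} (A.subst σ) := by
  have := exists_ident_psubst (fun _ p => p.nil_elim) A hA (fun _ p => p.nil_elim.elim)
  rwa [IFm.psubst_nil] at this

/-- The final predicate variable becomes a true equation, and the right rules for `∀`, `⊃` and `ν`
lead to it; each greatest fixed point on the way takes the same equation as coinvariant. -/
theorem exists_vacuous_psubst [Nonempty L.Base] {Δ : PCtx L} (C : IFm L Δ V) (hC : C.Vacuous) :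
    ∃ K : Set (Pred L), K.Finite ∧ ∃ m, ∀ F, K ⊆ F → ∀ (W : Ctx L) (σ : Sub L V W)
      (Γ : Multiset (IFm L [] W)),
        Int F m W Γ ((C.psubst (fun γ _ => IFm.verum [] γ)).subst σ) := by
  induction C with
  | and P Q => exact hC.elim
  | or P Q => exact hC.elim
  | eq s t => exact hC.elim
  | ex a P => exact hC.elim
  | mu B ts => exact hC.elim
  | pvar p ts => exact ⟨∅, Set.finite_empty, 1, fun F _ W σ Γ => verum (ts.comp σ)⟩
  | all a P ih =>
    obtain ⟨K, hK, m, hm⟩ := ih hC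
    refine ⟨K, hK, m + 1, fun F hF W σ Γ => .allR a _ fun X ρ t => ?_⟩
    rw [IFm.subst_subst]
    exact hm F hF _ _ _
  | imp P Q _ ih =>
    obtain ⟨K, hK, m, hm⟩ := ih hC
    exact ⟨K, hK, m + 1, fun F hF W σ Γ => .impR (hm F hF _ _ _)⟩
  | @nu Δ V γ B ts ih =>
    obtain ⟨K, hK, m, hm⟩ := ih hC
    refine ⟨insert ⟨γ, IFm.verum [] γ⟩ K, hK.insert _, m + 2, fun F hF W σ Γ => ?_⟩
    rw [Set.insert_subset_iff] at hF
    refine .nuR (n := m + 1) _ _ _ (IFm.isH_verum _ _) hF.1 (verum _) ?_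
    rw [IFm.psubst_lift_inst, IFm.verum_psubst_snoc]
    have := hm F hF.2 γ (Sub.id γ) {IFm.verum [] γ}
    rw [IFm.subst_id] at this
    exact this.mono subset_rfl (Nat.le_succ _)

/-- Dual to the vacuous case: the final predicate variable becomes a false equation, which has no
unifier and closes any sequent, and each least fixed point takes it as invariant. -/
theorem exists_absurd_psubst [Nonempty L.Base] {Δ : PCtx L} (D : IFm L Δ V) (hD : D.Absurd) :
    ∃ K : Set (Pred L), K.Finite ∧ ∃ m, ∀ F, K ⊆ F → ∀ (W : Ctx L) (σ : Sub L V W)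
      (Γ : Multiset (IFm L [] W)) (R : IFm L [] W),
        Int F m W ((D.psubst (fun γ _ => IFm.falsum [] γ)).subst σ ::ₘ Γ) R := by
  induction D with
  | and P Q _ ih =>
    obtain ⟨K, hK, m, hm⟩ := ih hD
    refine ⟨K, hK, m + 1, fun F hF W σ Γ R => .left (.and _ _) fun X ρ Θ hΘ => ?_⟩
    cases hΘ
    rw [Multiset.insert_eq_cons, Multiset.cons_add, Multiset.singleton_add, Multiset.cons_swap,
      IFm.subst_subst (Q.psubst _)]
    exact hm F hF _ _ _ _
  | or P Q => exact hD.elim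
  | eq s t => exact hD.elim
  | ex a P ih =>
    obtain ⟨K, hK, m, hm⟩ := ih hD
    refine ⟨K, hK, m + 1, fun F hF W σ Γ R => .left (.ex _ _) fun X ρ Θ hΘ => ?_⟩
    cases hΘ
    rw [Multiset.singleton_add, IFm.subst_subst]
    exact hm F hF _ _ _ _
  | @mu Δ V γ B ts ih =>
    obtain ⟨K, hK, m, hm⟩ := ih hD
    refine ⟨insert ⟨γ, IFm.falsum [] γ⟩ K, hK.insert _, m + 2, fun F hF W σ Γ R => ?_⟩
    rw [Set.insert_subset_iff] at hF
    refine .muL (n := m + 1) _ _ _ (IFm.isH_falsum _ _) hF.1 (falsum _) ?_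
    rw [IFm.psubst_lift_inst, IFm.falsum_psubst_snoc]
    have := hm F hF.2 _ (Sub.id _) 0 (IFm.falsum [] _)
    rw [IFm.subst_id] at this
    exact this.mono subset_rfl (Nat.le_succ _)
  | pvar p ts => exact ⟨∅, Set.finite_empty, 1, fun F _ W σ Γ R => falsum (ts.comp σ)⟩
  | all a P ih => exact hD.elim
  | imp P Q ihP ihQ => exact hD.elim
  | nu B ts ih => exact hD.elim

variable {Φ : Set (Pred L)}

theorem exists_ident_bound (hΦ : Φ.Finite) : ∃ m, ∀ ⦃F : Set (Pred L)⦄ ⦃V : Ctx L⦄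
    ⦃A : IFm L [] V⦄, IsHInst Φ A → Int F m V {A} A := by
  -- Identity needs no invariants, so the set component of the common bound is a dummy.
  obtain ⟨-, -, m, h⟩ := exists_common_bound (β := PUnit.{1}) hΦ
    (Q := fun x _ m => x.2.IsH → ∀ (F : Set (Pred L)) (W : Ctx L) (σ : Sub L x.1 W),
      Int F m W {x.2.subst σ} (x.2.subst σ))
    (fun x _ _ m m' h _ hm hx F W σ => (h hx F W σ).mono subset_rfl hm)
    (fun x _ => by
      by_cases hx : x.2.IsH
      · obtain ⟨m, h⟩ := exists_ident x.2 hx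
        exact ⟨∅, Set.finite_empty, m, fun _ => h⟩
      · exact ⟨∅, Set.finite_empty, 0, fun h => (hx h).elim⟩)
  refine ⟨m, fun F V A ⟨hA, x, hx, σ, hσ⟩ => ?_⟩
  subst hσ
  exact h x hx ((IFm.isH_subst _ _).1 hA) F _ σ

theorem exists_vacuous_bound [Nonempty L.Base] (hΦ : Φ.Finite) :
    ∃ K : Set (Pred L), K.Finite ∧ ∃ m, ∀ ⦃F : Set (Pred L)⦄, K ⊆ F → ∀ ⦃V : Ctx L⦄
      ⦃A : IFm L [] V⦄, IsInst Φ A → A.Vacuous → ∀ Γ, Int F m V Γ A := by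
  obtain ⟨K, hK, m, h⟩ := exists_common_bound hΦ
    (Q := fun x K m => x.2.Vacuous → ∀ (F : Set (Pred L)), K ⊆ F → ∀ (W : Ctx L)
      (σ : Sub L x.1 W) (Γ : Multiset (IFm L [] W)), Int F m W Γ (x.2.subst σ))
    (fun x K K' m m' h hK hm hx F hF W σ Γ =>
      (h hx F (hK.trans hF) W σ Γ).mono subset_rfl hm)
    (fun x _ => by
      by_cases hx : x.2.Vacuous
      · obtain ⟨K, hK, m, h⟩ := exists_vacuous_psubst x.2 hx
        rw [IFm.psubst_nil] at h
        exact ⟨K, hK, m, fun _ => h⟩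
      · exact ⟨∅, Set.finite_empty, 0, fun h => (hx h).elim⟩)
  refine ⟨K, hK, m, fun F hF V A ⟨x, hx, σ, hσ⟩ hA Γ => ?_⟩
  subst hσ
  exact h x hx ((IFm.vacuous_subst _ _).1 hA) F hF _ σ Γ

theorem exists_absurd_bound [Nonempty L.Base] (hΦ : Φ.Finite) :
    ∃ K : Set (Pred L), K.Finite ∧ ∃ m, ∀ ⦃F : Set (Pred L)⦄, K ⊆ F → ∀ ⦃V : Ctx L⦄
      ⦃A : IFm L [] V⦄, IsInst Φ A → A.Absurd → ∀ Γ R, Int F m V (A ::ₘ Γ) R := by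
  obtain ⟨K, hK, m, h⟩ := exists_common_bound hΦ
    (Q := fun x K m => x.2.Absurd → ∀ (F : Set (Pred L)), K ⊆ F → ∀ (W : Ctx L)
      (σ : Sub L x.1 W) (Γ : Multiset (IFm L [] W)) (R : IFm L [] W),
        Int F m W (x.2.subst σ ::ₘ Γ) R)
    (fun x K K' m m' h hK hm hx F hF W σ Γ R =>
      (h hx F (hK.trans hF) W σ Γ R).mono subset_rfl hm)
    (fun x _ => by
      by_cases hx : x.2.Absurd
      · obtain ⟨K, hK, m, h⟩ := exists_absurd_psubst x.2 hx
        rw [IFm.psubst_nil] at h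
        exact ⟨K, hK, m, fun _ => h⟩
      · exact ⟨∅, Set.finite_empty, 0, fun h => (hx h).elim⟩)
  refine ⟨K, hK, m, fun F hF V A ⟨x, hx, σ, hσ⟩ hA Γ R => ?_⟩
  subst hσ
  exact h x hx ((IFm.absurd_subst _ _).1 hA) F hF _ σ Γ R

end Int

/-! ### From the linear calculus to the intuitionistic one -/

/-- The axioms of the linear calculus, and sequents that are provable because a formula is vacuous
or absurd. -/
def ambAx : Axioms L := fun V Γ R =>
  R.IsH ∧ Γ = {R} ∨ (∃ (a : Ty L.Base) (t : Tm L V a), R = IFm.eq t t) ∨ R.Vacuous ∨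
    ∃ A ∈ Γ, A.Absurd

/-- The uniform bookkeeping is that of `Int.exists_lin`; here the axioms of `ambAx` are replaced by
derivations, and the contexts of a multiplicative conjunction are made equal by weakening. -/
theorem Calc.exists_int [Nonempty L.Base] (n k : ℕ) {F Φ : Set (Pred L)} (hF : F.Finite)
    (hΦ : Φ.Finite) : ∃ K : Set (Pred L), K.Finite ∧ ∃ m, ∀ (V : Ctx L)
      (Γ : Multiset (IFm L [] V)) (R : IFm L [] V), Calc False ambAx F n V Γ R →
        (∀ A ∈ Γ, IsHInst Φ A) → R.IsG → IsInst Φ R → Γ.card ≤ k → Int K m V Γ R := by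
  induction n generalizing k Φ with
  | zero =>
    refine ⟨∅, Set.finite_empty, 0, fun V Γ R d => ?_⟩
    cases d
  | succ n ih =>
    obtain ⟨K₀, hK₀, m₀, h₀⟩ := ih (k + 2) (IFm.finite_next hF hΦ)
    obtain ⟨mi, hi⟩ := Int.exists_ident_bound hΦ
    obtain ⟨Kv, hKv, mv, hv⟩ := Int.exists_vacuous_bound hΦ
    obtain ⟨Ka, hKa, ma, ha⟩ := Int.exists_absurd_bound hΦ
    replace hv := hv (F := K₀ ∪ Kv ∪ Ka ∪ F) (by intro x; simp; tauto)
    replace ha := ha (F := K₀ ∪ Kv ∪ Ka ∪ F) (by intro x; simp; tauto)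
    replace hi := hi (F := K₀ ∪ Kv ∪ Ka ∪ F)
    replace h₀ : ∀ {V : Ctx L} {Γ : Multiset (IFm L [] V)} {R : IFm L [] V},
        Calc False ambAx F n V Γ R →
        (∀ A ∈ Γ, IsHInst (IFm.next F Φ) A) → R.IsG → IsInst (IFm.next F Φ) R →
        Γ.card ≤ k + 2 → Int (K₀ ∪ Kv ∪ Ka ∪ F) m₀ V Γ R := fun d h₁ h₂ h₃ h₄ =>
      (h₀ _ _ _ d h₁ h₂ h₃ h₄).mono (by intro x; simp; tauto) le_rfl
    have hFK : F ⊆ K₀ ∪ Kv ∪ Ka ∪ F := Set.subset_union_right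
    refine ⟨_, ((hK₀.union hKv).union hKa).union hF, m₀ + mi + mv + ma + k + 1, ?_⟩
    generalize K₀ ∪ Kv ∪ Ka ∪ F = K at *
    intro V Γ R d hΓ hR hRI hk
    have lift : ∀ {Γ : Multiset (IFm L [] V)}, (∀ A ∈ Γ, IsHInst Φ A) →
        ∀ A ∈ Γ, IsHInst (IFm.next F Φ) A := fun h A hA => ⟨(h A hA).1, (h A hA).2.next⟩
    have single : ∀ {γ : Ctx L} {S : IFm L [] γ}, S.IsH → IsInst (IFm.next F Φ) S →
        ∀ A ∈ ({S} : Multiset (IFm L [] γ)), IsHInst (IFm.next F Φ) A := by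
      intro γ S hS hSI A hA
      rw [Multiset.mem_singleton.1 hA]
      exact ⟨hS, hSI⟩
    cases d with
    | ax h =>
      rcases h with ⟨hRH, rfl⟩ | ⟨a, t, rfl⟩ | h | ⟨A, hA, h⟩
      · exact (hi ⟨hRH, hRI⟩).mono subset_rfl (by omega)
      · exact .ax (.inr ⟨a, t, rfl⟩)
      · exact (hv hRI h Γ).mono subset_rfl (by omega)
      · obtain ⟨Δ, rfl⟩ := Multiset.exists_cons_of_mem hA
        exact (ha (hΓ A hA).2 h Δ R).mono subset_rfl (by omega)
    | weak hs P d => exact hs.elim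
    | contr hs P d => exact hs.elim
    | left hA d =>
      rw [Multiset.forall_mem_cons] at hΓ
      rw [Multiset.card_cons] at hk
      refine Calc.mono (.left hA fun W ρ Θ hΘ => ?_) subset_rfl (show m₀ + 1 ≤ _ by omega)
      refine h₀ (d W ρ Θ hΘ) ?_ ((IFm.isG_subst _ _).2 hR) (hRI.next.subst ρ) ?_
      · intro B hB
        rcases Multiset.mem_add.1 hB with hB | hB
        · exact hΘ.isHInst hΓ.1 B hB
        · exact forall_mem_map_isHInst (lift hΓ.2) ρ B hB
      · have := hΘ.card_le
        rw [Multiset.card_add, Multiset.card_map]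
        omega
    | muL B ts S hS hSF d e =>
      rw [Multiset.forall_mem_cons] at hΓ
      rw [Multiset.card_cons] at hk
      refine Calc.mono (.muL B ts S hS (hFK hSF) (h₀ d ?_ hR hRI.next ?_) (h₀ e ?_ hS.isG ?_ ?_))
        subset_rfl (show m₀ + 1 ≤ _ by omega)
      · rw [Multiset.forall_mem_cons]
        exact ⟨⟨(IFm.isH_subst _ _).2 hS, (IsInst.of_invariant hSF).subst ts⟩, lift hΓ.2⟩
      · rw [Multiset.card_cons]; omega
      · exact single (IFm.IsH.inst (B := B) hΓ.1.1 hS) (hΓ.1.2.mu.2 S hSF)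
      · exact IsInst.of_invariant hSF
      · rw [Multiset.card_singleton]; omega
    | andR hs d e => exact hs.elim
    | @tensorR _ _ Γ₁ Γ₂ _ _ hs d e =>
      rw [Multiset.card_add] at hk
      have hΓ₁ : ∀ A ∈ Γ₁, IsHInst Φ A := fun A hA => hΓ A (Multiset.mem_add.2 (.inl hA))
      have hΓ₂ : ∀ A ∈ Γ₂, IsHInst Φ A := fun A hA => hΓ A (Multiset.mem_add.2 (.inr hA))
      -- Each premise receives the context of the other, at most `k` further hypotheses.
      have h₁ := Int.weak_all (h₀ d (lift hΓ₁) hR.1 hRI.and.1 (by omega)) Γ₂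
      have h₂ := Int.weak_all (h₀ e (lift hΓ₂) hR.2 hRI.and.2 (by omega)) Γ₁
      exact Calc.mono (.andR (n := m₀ + k) trivial
        ((h₁.congr (add_comm _ _)).mono subset_rfl (by omega))
        (h₂.mono subset_rfl (by omega))) subset_rfl (by omega)
    | orRLeft P Q d =>
      exact Calc.mono (.orRLeft _ _ (h₀ d (lift hΓ) hR.1 hRI.or.1 (by omega))) subset_rfl
        (show m₀ + 1 ≤ _ by omega)
    | orRRight P Q d =>
      exact Calc.mono (.orRRight _ _ (h₀ d (lift hΓ) hR.2 hRI.or.2 (by omega))) subset_rfl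
        (show m₀ + 1 ≤ _ by omega)
    | impR d =>
      refine Calc.mono (.impR (h₀ d ?_ hR.2 hRI.imp.2 ?_)) subset_rfl (show m₀ + 1 ≤ _ by omega)
      · exact Multiset.forall_mem_cons.2 ⟨⟨hR.1, hRI.imp.1⟩, lift hΓ⟩
      · rw [Multiset.card_cons]; omega
    | exR a P t d =>
      exact Calc.mono (.exR a P t (h₀ d (lift hΓ) ((IFm.isG_subst P _).2 hR) (hRI.ex.subst _)
        (by omega))) subset_rfl (show m₀ + 1 ≤ _ by omega)
    | allR a P d =>
      refine Calc.mono (.allR a P fun W ρ t => h₀ (d W ρ t) (forall_mem_map_isHInst (lift hΓ) ρ)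
        ((IFm.isG_subst P _).2 hR) (hRI.all.subst _) ?_) subset_rfl (show m₀ + 1 ≤ _ by omega)
      rw [Multiset.card_map]; omega
    | @muR _ _ γ _ B ts d =>
      exact Calc.mono (.muR B ts (h₀ d (lift hΓ) ((IFm.isG_subst _ _).2 (IFm.IsG.inst (B := B)
        (S := IFm.mu B (Sub.id γ)) hR hR)) (hRI.mu.1.subst _) (by omega))) subset_rfl
        (show m₀ + 1 ≤ _ by omega)
    | nuR B ts S hS hSF d e =>
      refine Calc.mono (.nuR B ts S hS (hFK hSF) (h₀ d (lift hΓ) ?_ ?_ (by omega))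
        (h₀ e (single hS (IsInst.of_invariant hSF)) ?_ (hRI.nu S hSF) ?_)) subset_rfl
        (show m₀ + 1 ≤ _ by omega)
      · exact (IFm.isG_subst _ _).2 hS.isG
      · exact (IsInst.of_invariant hSF).subst ts
      · exact IFm.IsG.inst (B := B) hR hS.isG
      · rw [Multiset.card_singleton]; omega

/-! ### Derivations of muLJL and the intuitionistic calculus -/

theorem exists_succ_of_add_one_le {h : ℕ∞} {n : ℕ} (H : h + 1 ≤ n) :
    ∃ m : ℕ, n = m + 1 ∧ h ≤ m := by
  cases n with
  | zero => simp at H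
  | succ n =>
    refine ⟨n, rfl, ?_⟩
    rw [Nat.cast_add, Nat.cast_one] at H
    exact (ENat.add_le_add_iff_right ENat.one_ne_top).1 H

theorem exists_succ_of_one_le {n : ℕ} (H : (1 : ℕ∞) ≤ n) : ∃ m : ℕ, n = m + 1 := by
  obtain ⟨m, h, -⟩ := exists_succ_of_add_one_le (h := 0) (by simpa using H)
  exact ⟨m, h⟩

/-- The statement carries an arbitrary substitution `ρ` so that one premise with an eigenvariable,
or one for each unifier, supplies the premises for all substitutions. -/
theorem LJL.int {c : CSU L} {F : Set (Pred L)} {V : Ctx L} {Γ : Multiset (IFm L [] V)}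
    {R : IFm L [] V} (d : LJL c V Γ R) (n : ℕ) (hc : d.CutFree) (hn : d.height ≤ n)
    (hF : d.coinvariants ⊆ F) {W : Ctx L} (ρ : Sub L V W) :
    Int F n W (Γ.map (fun Q => Q.subst ρ)) (R.subst ρ) := by
  induction d generalizing n W <;>
    simp only [CutFree, height, coinvariants, Set.union_subset_iff, Set.insert_subset_iff,
      Set.iUnion_subset_iff] at hc hn hF
  case init Γ B ts =>
    obtain ⟨n, rfl⟩ := exists_succ_of_one_le hn
    exact .ax (.inl ⟨_, B, _, rfl, Multiset.mem_map_of_mem _ (Multiset.mem_cons_self _ _)⟩)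
  case eqR Γ a t =>
    obtain ⟨n, rfl⟩ := exists_succ_of_one_le hn
    exact .ax (.inr ⟨_, _, rfl⟩)
  all_goals
    obtain ⟨n, rfl, hm⟩ := exists_succ_of_add_one_le hn
    clear hn
    rename' hm => hn
    try simp only [max_le_iff, iSup_le_iff] at hn
    try rw [Multiset.map_cons]
  case weak P d ih => exact .weak trivial _ (ih n hc hn hF ρ)
  case contr P d ih =>
    refine .contr trivial _ ?_
    simpa only [Multiset.map_cons] using ih n hc hn hF ρ
  case andL P Q d ih =>
    refine .left (.and _ _) fun X σ Θ hΘ => ?_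
    cases hΘ
    have := ih n hc hn hF (ρ.comp σ)
    simpa only [Multiset.map_cons, Multiset.insert_eq_cons, Multiset.cons_add,
      Multiset.singleton_add, IFm.subst_subst, IFm.map_subst_subst] using this
  case orL P Q d e ihd ihe =>
    refine .left (.or _ _) fun X σ Θ hΘ => ?_
    cases hΘ
    · have := ihd n hc.1 hn.1 hF.1 (ρ.comp σ)
      simpa only [Multiset.map_cons, Multiset.singleton_add, IFm.subst_subst,
        IFm.map_subst_subst] using this
    · have := ihe n hc.2 hn.2 hF.2 (ρ.comp σ)
      simpa only [Multiset.map_cons, Multiset.singleton_add, IFm.subst_subst,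
        IFm.map_subst_subst] using this
  case exL a P d ih =>
    refine .left (.ex _ _) fun X σ Θ hΘ => ?_
    cases hΘ with
    | ex _ _ _ t =>
      have := ih n hc hn hF ((ρ.comp σ).snoc t)
      simpa only [Multiset.map_cons, Multiset.singleton_add, IFm.subst_subst,
        IFm.map_subst_subst, Sub.weaken_comp_snoc, Sub.lift_comp_snoc] using this
  case eqL a s t d ih =>
    refine .left (.eq _ _) fun X σ Θ hΘ => ?_
    cases hΘ with
    | eq _ _ _ h =>
      rw [Tm.subst_subst, Tm.subst_subst] at h
      -- Any solution of the instantiated equation factors through some `θ` in the complete set; the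
      -- premise for `θ`, instantiated by `σ'`, is the one required.
      obtain ⟨θ, hθ, σ', hσ'⟩ := c.complete s t (ρ.comp σ) h
      have := ih ⟨θ, hθ⟩ n (hc _) (hn _) (hF _) σ'
      rw [IFm.map_subst_subst, IFm.subst_subst, ← hσ'] at this
      rwa [IFm.map_subst_subst, IFm.subst_subst, zero_add]
  case muL B ts S hS d e ihd ihe =>
    refine .muL B _ S hS hF.1 ?_ ?_
    · have := ihd n hc.1 hn.1 hF.2.1 ρ
      simpa only [Multiset.map_cons, IFm.subst_subst] using this
    · have := ihe n hc.2 hn.2 hF.2.2 (Sub.id _)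
      rwa [IFm.map_subst_id, IFm.subst_id] at this
  case andR d e ihd ihe =>
    exact .andR trivial (ihd n hc.1 hn.1 hF.1 ρ) (ihe n hc.2 hn.2 hF.2 ρ)
  case orRLeft P Q d ih => exact .orRLeft _ _ (ih n hc hn hF ρ)
  case orRRight P Q d ih => exact .orRRight _ _ (ih n hc hn hF ρ)
  case impR d ih =>
    refine .impR ?_
    simpa only [Multiset.map_cons] using ih n hc hn hF ρ
  case exR a P t d ih =>
    refine Calc.exR_subst a P ρ (t.subst ρ) ?_
    have := ih n hc hn hF ρ
    rwa [IFm.subst_subst, Sub.single_comp] at this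
  case allR a P d ih =>
    refine .allR a _ fun X σ t => ?_
    have := ih n hc hn hF ((ρ.comp σ).snoc t)
    rwa [IFm.map_subst_subst, Sub.weaken_comp_snoc, ← IFm.map_subst_subst,
      ← Sub.lift_comp_snoc, ← IFm.subst_subst] at this
  case muR B ts d ih =>
    refine .muR B _ ?_
    simpa only [IFm.subst_subst] using ih n hc hn hF ρ
  case nuR B ts S hS d e ihd ihe =>
    refine .nuR B _ S hS hF.1 ?_ ?_
    · simpa only [IFm.subst_subst] using ihd n hc.1 hn.1 hF.2.1 ρ
    · have := ihe n hc.2 hn.2 hF.2.2 (Sub.id _)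
      rwa [IFm.map_subst_id, IFm.subst_id] at this

/-- Cut-free derivability in muLJL with height at most `n` and (co)invariants in `F`. -/
def LJL.Bounded (c : CSU L) (F : Set (Pred L)) (n : ℕ) (V : Ctx L) (Γ : Multiset (IFm L [] V))
    (R : IFm L [] V) : Prop :=
  ∃ d : LJL c V Γ R, d.CutFree ∧ d.height ≤ n ∧ d.coinvariants ⊆ F

theorem cast_succ_le {h : ℕ∞} {n : ℕ} (H : h ≤ n) : h + 1 ≤ ((n + 1 : ℕ) : ℕ∞) := by
  rw [Nat.cast_add, Nat.cast_one]
  gcongr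

theorem one_le_cast_succ (n : ℕ) : (1 : ℕ∞) ≤ ((n + 1 : ℕ) : ℕ∞) := by
  simp

/-- Only some premises are kept: those at the identity, at a fresh variable, and at the members of
the chosen set of unifiers. -/
theorem Int.bounded {c : CSU L} {F : Set (Pred L)} {n : ℕ} {V : Ctx L}
    {Γ : Multiset (IFm L [] V)} {R : IFm L [] V} (d : Int F n V Γ R) :
    LJL.Bounded c F n V Γ R := by
  induction d with
  | ax h =>
    rcases h with ⟨γ, B, ts, rfl, h⟩ | ⟨a, t, rfl⟩
    · obtain ⟨Δ, rfl⟩ := Multiset.exists_cons_of_mem h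
      exact ⟨.init Δ B ts, trivial, one_le_cast_succ _, Set.empty_subset _⟩
    · exact ⟨.eqR _ t, trivial, one_le_cast_succ _, Set.empty_subset _⟩
  | weak _ P _ ih =>
    obtain ⟨d, hc, hn, hF⟩ := ih
    exact ⟨.weak P d, hc, cast_succ_le hn, hF⟩
  | contr _ P _ ih =>
    obtain ⟨d, hc, hn, hF⟩ := ih
    exact ⟨.contr P d, hc, cast_succ_le hn, hF⟩
  | @left n V Γ A R hA _ ih =>
    cases hA with
    | and P Q =>
      have h := ih V (Sub.id V) _ (.and P Q _)
      rw [IFm.map_subst_id, IFm.subst_id, IFm.subst_id, IFm.subst_id, Multiset.insert_eq_cons,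
        Multiset.cons_add, Multiset.singleton_add] at h
      obtain ⟨d, hc, hn, hF⟩ := h
      exact ⟨.andL P Q d, hc, cast_succ_le hn, hF⟩
    | or P Q =>
      have h := ih V (Sub.id V) _ (.orLeft P Q _)
      have h' := ih V (Sub.id V) _ (.orRight P Q _)
      rw [IFm.map_subst_id, IFm.subst_id, IFm.subst_id, Multiset.singleton_add] at h h'
      obtain ⟨d, hc, hn, hF⟩ := h
      obtain ⟨e, hc', hn', hF'⟩ := h'
      exact ⟨.orL P Q d e, ⟨hc, hc'⟩, cast_succ_le (max_le hn hn'), Set.union_subset hF hF'⟩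
    | ex a P =>
      have h := ih _ (Sub.weaken V a) _ (.ex a P _ (Tm.var .zero))
      rw [Sub.snoc_weaken_var, IFm.subst_id, Multiset.singleton_add] at h
      obtain ⟨d, hc, hn, hF⟩ := h
      exact ⟨.exL a P d, hc, cast_succ_le hn, hF⟩
    | eq s t =>
      have h : ∀ θ : c.csu s t, LJL.Bounded c F n θ.1.1 (Γ.map (fun Q => Q.subst θ.1.2))
          (R.subst θ.1.2) := fun θ => by
        have := ih θ.1.1 θ.1.2 0 (.eq s t _ (c.unifies s t _ θ.2))
        rwa [zero_add] at this
      choose d hc hn hF using h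
      exact ⟨.eqL s t d, hc, cast_succ_le (iSup_le hn), Set.iUnion_subset hF⟩
  | muL B ts S hS hSF _ _ ihd ihe =>
    obtain ⟨d, hc, hn, hF⟩ := ihd
    obtain ⟨e, hc', hn', hF'⟩ := ihe
    exact ⟨.muL B ts S hS d e, ⟨hc, hc'⟩, cast_succ_le (max_le hn hn'),
      Set.insert_subset hSF (Set.union_subset hF hF')⟩
  | andR _ _ _ ihd ihe =>
    obtain ⟨d, hc, hn, hF⟩ := ihd
    obtain ⟨e, hc', hn', hF'⟩ := ihe
    exact ⟨.andR d e, ⟨hc, hc'⟩, cast_succ_le (max_le hn hn'), Set.union_subset hF hF'⟩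
  | tensorR hs => exact (hs trivial).elim
  | orRLeft P Q _ ih =>
    obtain ⟨d, hc, hn, hF⟩ := ih
    exact ⟨.orRLeft P Q d, hc, cast_succ_le hn, hF⟩
  | orRRight P Q _ ih =>
    obtain ⟨d, hc, hn, hF⟩ := ih
    exact ⟨.orRRight P Q d, hc, cast_succ_le hn, hF⟩
  | impR _ ih =>
    obtain ⟨d, hc, hn, hF⟩ := ih
    exact ⟨.impR d, hc, cast_succ_le hn, hF⟩
  | exR a P t _ ih =>
    obtain ⟨d, hc, hn, hF⟩ := ih
    exact ⟨.exR a P t d, hc, cast_succ_le hn, hF⟩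
  | @allR n V Γ a P _ ih =>
    have h := ih _ (Sub.weaken V a) (Tm.var .zero)
    rw [Sub.snoc_weaken_var, IFm.subst_id] at h
    obtain ⟨d, hc, hn, hF⟩ := h
    exact ⟨.allR a P d, hc, cast_succ_le hn, hF⟩
  | muR B ts _ ih =>
    obtain ⟨d, hc, hn, hF⟩ := ih
    exact ⟨.muR B ts d, hc, cast_succ_le hn, hF⟩
  | nuR B ts S hS hSF _ _ ihd ihe =>
    obtain ⟨d, hc, hn, hF⟩ := ihd
    obtain ⟨e, hc', hn', hF'⟩ := ihe
    exact ⟨.nuR B ts S hS d e, ⟨hc, hc'⟩, cast_succ_le (max_le hn hn'),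
      Set.insert_subset hSF (Set.union_subset hF hF')⟩

theorem LJL.exists_quasiFinite_iff {c : CSU L} {V : Ctx L} {Γ : Multiset (IFm L [] V)}
    {R : IFm L [] V} : (∃ d : LJL c V Γ R, d.QuasiFinite) ↔
      ∃ F : Set (Pred L), F.Finite ∧ ∃ n, Int F n V Γ R := by
  constructor
  · rintro ⟨d, hc, hn, hF⟩
    obtain ⟨n, h⟩ := ENat.ne_top_iff_exists.1 hn.ne
    have := d.int n hc h.ge subset_rfl (Sub.id V)
    rw [IFm.map_subst_id, IFm.subst_id] at this
    exact ⟨_, hF, n, this⟩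
  · rintro ⟨F, hF, n, h⟩
    obtain ⟨d, hc, hn, hdF⟩ := h.bounded (c := c)
    exact ⟨d, hc, hn.trans_lt (ENat.natCast_lt_top n), hF.subset hdF⟩

/-! ### Encoded sequents -/

/-- The encoding of a hypothesis: the negation of its encoding. -/
abbrev IFm.neg {V : Ctx L} (A : IFm L [] V) : Fm L [] V := A.enc.dual

/-- The encoding of a sequent. -/
abbrev encSeq {V : Ctx L} (Γ : Multiset (IFm L [] V)) (R : IFm L [] V) : Multiset (Fm L [] V) :=
  R.enc ::ₘ Γ.map IFm.neg

theorem IFm.neg_subst {V W : Ctx L} (A : IFm L [] V) (σ : Sub L V W) :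
    (A.subst σ).neg = A.neg.subst σ := by
  rw [IFm.neg, IFm.enc_subst, Fm.dual_subst]

theorem IFm.neg_inst {γ : Ctx L} (B : IFm L [γ] γ) (S : IFm L [] γ) :
    (B.inst S).neg = B.enc.dual.inst S.neg := by
  rw [IFm.neg, IFm.enc_inst, Fm.dual_inst]

theorem encSeq_subst {V W : Ctx L} (Γ : Multiset (IFm L [] V)) (R : IFm L [] V) (σ : Sub L V W) :
    encSeq (Γ.map (fun Q => Q.subst σ)) (R.subst σ) = (encSeq Γ R).map (fun Q => Q.subst σ) := by
  simp only [encSeq, Multiset.map_cons, Multiset.map_map, Function.comp_def, IFm.neg_subst,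
    IFm.enc_subst]

theorem encSeq_cons {V : Ctx L} (A : IFm L [] V) (Γ : Multiset (IFm L [] V)) (R : IFm L [] V) :
    encSeq (A ::ₘ Γ) R = A.neg ::ₘ encSeq Γ R := by
  rw [encSeq, Multiset.map_cons, Multiset.cons_swap]

theorem encSeq_singleton {V : Ctx L} (A : IFm L [] V) (R : IFm L [] V) :
    encSeq {A} R = {R.enc, A.neg} := rfl

/-- The (co)invariant of a use of the rule for greatest fixed points is encoded by a predicate
in `F`. -/
def EncodesIn (F : Set (Pred L)) (i : Σ γ : Ctx L, Fm L [γ] γ × Fm L [] γ) : Prop :=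
  ∃ S : IFm L [] i.1, S.IsH ∧ ⟨i.1, S⟩ ∈ F ∧
    ((∃ B : IFm L [i.1] i.1, B.IsH ∧ i.2.1 = B.enc.dual ∧ i.2.2 = S.enc.dual) ∨
     (∃ B : IFm L [i.1] i.1, B.IsG ∧ i.2.1 = B.enc ∧ i.2.2 = S.enc))

/-- Cut-free derivability in muMALL with height at most `n` and (co)invariants encoded by
predicates in `F`. -/
def MALL.Bounded (c : CSU L) (F : Set (Pred L)) (n : ℕ) (V : Ctx L) (Γ : Multiset (Fm L [] V)) :
    Prop :=
  ∃ d : MALL c V Γ, d.CutFree ∧ d.height ≤ n ∧ ∀ i ∈ d.nuUses, EncodesIn F i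

theorem MALL.Bounded.congr {c : CSU L} {F : Set (Pred L)} {n : ℕ} {V : Ctx L}
    {Γ Γ' : Multiset (Fm L [] V)} (h : MALL.Bounded c F n V Γ) (e : Γ = Γ') :
    MALL.Bounded c F n V Γ' := e ▸ h

theorem forall_mem_step {V W : Ctx L} {A : IFm L [] V} {Γ : Multiset (IFm L [] V)}
    {ρ : Sub L V W} {Θ : Multiset (IFm L [] W)} (h : A.Step ρ Θ) (hΓ : ∀ B ∈ A ::ₘ Γ, B.IsH) :
    ∀ B ∈ Θ + Γ.map (fun Q => Q.subst ρ), B.IsH := by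
  have hA := hΓ A (Multiset.mem_cons_self _ _)
  intro B hB
  rcases Multiset.mem_add.1 hB with hB | hB
  · cases h <;> simp only [Multiset.insert_eq_cons, Multiset.mem_cons, Multiset.mem_singleton,
      Multiset.notMem_zero] at hB
    · rcases hB with rfl | rfl
      exacts [(IFm.isH_subst _ _).2 hA.1, (IFm.isH_subst _ _).2 hA.2]
    · exact hB ▸ (IFm.isH_subst _ _).2 hA.1
    · exact hB ▸ (IFm.isH_subst _ _).2 hA.2
    · rename_i P _ _
      exact hB ▸ (IFm.isH_subst P _).2 hA
  · obtain ⟨C, hC, rfl⟩ := Multiset.mem_map.1 hB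
    exact (IFm.isH_subst _ _).2 (hΓ C (Multiset.mem_cons_of_mem hC))

theorem forall_mem_map_isH {V W : Ctx L} {Γ : Multiset (IFm L [] V)}
    (h : ∀ A ∈ Γ, A.IsH) (σ : Sub L V W) :
    ∀ A ∈ Γ.map (fun Q => Q.subst σ), A.IsH := by
  intro B hB
  obtain ⟨A, hA, rfl⟩ := Multiset.mem_map.1 hB
  exact (IFm.isH_subst _ _).2 (h A hA)

/-! ### From the linear calculus to muMALL -/

/-- The linear calculus is muMALL on encoded sequents: a left rule for a hypothesis is the rule for
the dual connective, and the premises for all substitutions are again cut down to those that muMALL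
asks for. -/
theorem Lin.mallBounded {c : CSU L} {F : Set (Pred L)} {n : ℕ} {V : Ctx L}
    {Γ : Multiset (IFm L [] V)} {R : IFm L [] V} (d : Lin F n V Γ R) (hΓ : ∀ A ∈ Γ, A.IsH)
    (hR : R.IsG) : MALL.Bounded c F n V (encSeq Γ R) := by
  induction d with
  | ax h =>
    rcases h with rfl | ⟨rfl, a, t, rfl⟩
    · exact ⟨MALL.init (c := c) (IFm.enc _), trivial, one_le_cast_succ _, fun i hi => hi.elim⟩
    · exact ⟨.eq t, trivial, one_le_cast_succ _, fun i hi => hi.elim⟩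
  | weak hs => exact hs.elim
  | contr hs => exact hs.elim
  | @left n V Γ A R hA _ ih =>
    have ih : ∀ {W : Ctx L} {ρ : Sub L V W} {Θ : Multiset (IFm L [] W)}, A.Step ρ Θ →
        MALL.Bounded c F n W (encSeq (Θ + Γ.map (fun Q => Q.subst ρ)) (R.subst ρ)) :=
      fun hΘ => ih _ _ _ hΘ (forall_mem_step hΘ hΓ) ((IFm.isG_subst _ _).2 hR)
    rw [encSeq_cons]
    cases hA with
    | and P Q =>
      have h := ih (.and P Q (Sub.id V))
      rw [IFm.map_subst_id, IFm.subst_id, IFm.subst_id, IFm.subst_id, Multiset.insert_eq_cons,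
        Multiset.cons_add, Multiset.singleton_add, encSeq_cons, encSeq_cons] at h
      obtain ⟨d, hc, hn, hF⟩ := h
      exact ⟨.par _ _ d, hc, cast_succ_le hn, hF⟩
    | or P Q =>
      have h := ih (.orLeft P Q (Sub.id V))
      have h' := ih (.orRight P Q (Sub.id V))
      rw [IFm.map_subst_id, IFm.subst_id, IFm.subst_id, Multiset.singleton_add,
        encSeq_cons] at h h'
      obtain ⟨d, hc, hn, hF⟩ := h
      obtain ⟨e, hc', hn', hF'⟩ := h'
      exact ⟨.amp _ _ d e, ⟨hc, hc'⟩, cast_succ_le (max_le hn hn'),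
        fun i hi => hi.elim (hF i) (hF' i)⟩
    | ex a P =>
      have h := ih (.ex a P (Sub.weaken V a) (Tm.var .zero))
      rw [Sub.snoc_weaken_var, IFm.subst_id, Multiset.singleton_add, encSeq_cons,
        encSeq_subst] at h
      obtain ⟨d, hc, hn, hF⟩ := h
      exact ⟨.all a _ d, hc, cast_succ_le hn, hF⟩
    | eq s t =>
      have h : ∀ θ : c.csu s t, MALL.Bounded c F n θ.1.1
          ((encSeq Γ R).map (fun Q => Q.subst θ.1.2)) := fun θ => by
        have := ih (.eq s t θ.1.2 (c.unifies s t _ θ.2))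
        rwa [zero_add, encSeq_subst] at this
      choose d hc hn hF using h
      refine ⟨.neq s t d, hc, cast_succ_le (iSup_le hn), fun i hi => ?_⟩
      obtain ⟨θ, hθ⟩ := Set.mem_iUnion.1 hi
      exact hF θ i hθ
  | @muL n V γ Γ R B ts S hS hSF _ _ ihd ihe =>
    rw [Multiset.forall_mem_cons] at hΓ
    rw [encSeq_cons]
    have h := ihd (Multiset.forall_mem_cons.2 ⟨(IFm.isH_subst _ _).2 hS, hΓ.2⟩) hR
    have h' := ihe (fun A hA => by
      rw [Multiset.mem_singleton.1 hA]
      exact IFm.IsH.inst (B := B) hΓ.1 hS) hS.isG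
    rw [encSeq_cons, IFm.neg_subst] at h
    replace h' := h'.congr (show _ = {B.enc.dual.inst S.neg, S.neg.dual} by
      rw [encSeq_singleton, IFm.neg_inst, Fm.dual_dual, Multiset.pair_comm])
    obtain ⟨d, hc, hn, hF⟩ := h
    obtain ⟨e, hc', hn', hF'⟩ := h'
    refine ⟨.nu B.enc.dual ts S.neg d e, ⟨hc, hc'⟩, cast_succ_le (max_le hn hn'), ?_⟩
    rintro i (rfl | hi | hi)
    exacts [⟨S, hS, hSF, .inl ⟨B, hΓ.1, rfl, rfl⟩⟩, hF i hi, hF' i hi]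
  | andR hs => exact hs.elim
  | @tensorR n V Γ Γ' P Q hs _ _ ihd ihe =>
    obtain ⟨d, hc, hn, hF⟩ := ihd (fun A hA => hΓ A (Multiset.mem_add.2 (.inl hA))) hR.1
    obtain ⟨e, hc', hn', hF'⟩ := ihe (fun A hA => hΓ A (Multiset.mem_add.2 (.inr hA))) hR.2
    rw [encSeq, Multiset.map_add]
    exact ⟨.tensor P.enc Q.enc d e, ⟨hc, hc'⟩, cast_succ_le (max_le hn hn'),
        fun i hi => hi.elim (hF i) (hF' i)⟩
  | orRLeft P Q _ ih =>
    obtain ⟨d, hc, hn, hF⟩ := ih hΓ hR.1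
    exact ⟨.plusLeft _ _ d, hc, cast_succ_le hn, hF⟩
  | orRRight P Q _ ih =>
    obtain ⟨d, hc, hn, hF⟩ := ih hΓ hR.2
    exact ⟨.plusRight _ _ d, hc, cast_succ_le hn, hF⟩
  | @impR n V Γ P Q _ ih =>
    have h := ih (Multiset.forall_mem_cons.2 ⟨hR.1, hΓ⟩) hR.2
    rw [encSeq_cons] at h
    obtain ⟨d, hc, hn, hF⟩ := h
    rw [encSeq, IFm.enc, Fm.prename_nil]
    exact ⟨.par _ _ d, hc, cast_succ_le hn, hF⟩
  | exR a P t _ ih =>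
    have h := ih hΓ ((IFm.isG_subst P _).2 hR)
    rw [encSeq, IFm.enc_subst] at h
    obtain ⟨d, hc, hn, hF⟩ := h
    exact ⟨.ex a _ t d, hc, cast_succ_le hn, hF⟩
  | @allR n V Γ a P _ ih =>
    have h := ih _ (Sub.weaken V a) (Tm.var .zero) (forall_mem_map_isH hΓ _)
      ((IFm.isG_subst P _).2 hR)
    rw [Sub.snoc_weaken_var, IFm.subst_id, encSeq, Multiset.map_map] at h
    replace h := h.congr (Γ' := P.enc ::ₘ (Γ.map IFm.neg).map (fun Q => Q.subst (Sub.weaken V a)))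
      (by simp only [Multiset.map_map, Function.comp_def, IFm.neg_subst])
    obtain ⟨d, hc, hn, hF⟩ := h
    exact ⟨.all a _ d, hc, cast_succ_le hn, hF⟩
  | @muR n V γ Γ B ts _ ih =>
    have h := ih hΓ ((IFm.isG_subst _ _).2 (IFm.IsG.inst (B := B)
        (S := IFm.mu B (Sub.id γ)) hR hR))
    rw [encSeq, IFm.enc_subst, IFm.enc_inst] at h
    obtain ⟨d, hc, hn, hF⟩ := h
    exact ⟨.mu B.enc ts d, hc, cast_succ_le hn, hF⟩
  | @nuR n V γ Γ B ts S hS hSF _ _ ihd ihe =>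
    have h := ihd hΓ ((IFm.isG_subst _ _).2 hS.isG)
    have h' := ihe (fun A hA => by rwa [Multiset.mem_singleton.1 hA])
      (IFm.IsG.inst (B := B) hR hS.isG)
    rw [encSeq, IFm.enc_subst] at h
    rw [encSeq_singleton, IFm.enc_inst] at h'
    obtain ⟨d, hc, hn, hF⟩ := h
    obtain ⟨e, hc', hn', hF'⟩ := h'
    refine ⟨.nu B.enc ts S.enc d e, ⟨hc, hc'⟩, cast_succ_le (max_le hn hn'), ?_⟩
    rintro i (rfl | hi | hi)
    exacts [⟨S, hS, hSF, .inr ⟨B, hR, rfl, rfl⟩⟩, hF i hi, hF' i hi]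

/-! ### From muMALL to the linear calculus -/

/-- It decides on which side of the turnstile the principal formula is read. When both readings are
possible either may be chosen, since the context is read accordingly. -/
theorem cons_eq_encSeq {V : Ctx L} {A : Fm L [] V} {Δ : Multiset (Fm L [] V)}
    {Γ : Multiset (IFm L [] V)} {R : IFm L [] V} (h : A ::ₘ Δ = encSeq Γ R) :
    (A = R.enc ∧ Δ = Γ.map IFm.neg) ∨
      ∃ B Γ', Γ = B ::ₘ Γ' ∧ A = B.neg ∧ Δ = encSeq Γ' R := by
  rcases Multiset.cons_eq_cons.1 h with h | ⟨-, cs, hΔ, h'⟩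
  · exact .inl h
  · have hA : A ∈ Γ.map IFm.neg := h' ▸ Multiset.mem_cons_self _ _
    obtain ⟨B, hB, rfl⟩ := Multiset.mem_map.1 hA
    obtain ⟨Γ', rfl⟩ := Multiset.exists_cons_of_mem hB
    rw [Multiset.map_cons, Multiset.cons_inj_right] at h'
    exact .inr ⟨B, Γ', rfl, rfl, by rw [hΔ, ← h']⟩

theorem exists_of_map_eq_add {α β : Type*} {f : α → β} {s : Multiset α} {t t' : Multiset β}
    (h : t + t' = s.map f) : ∃ r r', s = r + r' ∧ t = r.map f ∧ t' = r'.map f := by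
  induction t using Multiset.induction_on generalizing s with
  | empty => exact ⟨0, s, by simp, rfl, by simpa using h⟩
  | cons b t ih =>
    rw [Multiset.cons_add] at h
    have hb : b ∈ s.map f := h ▸ Multiset.mem_cons_self _ _
    obtain ⟨a, ha, rfl⟩ := Multiset.mem_map.1 hb
    obtain ⟨s, rfl⟩ := Multiset.exists_cons_of_mem ha
    rw [Multiset.map_cons, Multiset.cons_inj_right] at h
    obtain ⟨r, r', rfl, rfl, rfl⟩ := ih h
    exact ⟨a ::ₘ r, r', by simp, by simp, rfl⟩

/-- Once the side of the principal formula is fixed, its head connective determines the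
intuitionistic rule; units never occur in an encoding. Only the rule for `ν` carries further data,
its coinvariant, whose form may contradict the chosen side. -/
theorem MALL.calc {c : CSU L} {F : Set (Pred L)} {V : Ctx L} {Δ : Multiset (Fm L [] V)}
    (d : MALL c V Δ) (n : ℕ) (hc : d.CutFree) (hn : d.height ≤ n)
    (hF : ∀ i ∈ d.nuUses, EncodesIn F i) {Γ : Multiset (IFm L [] V)} {R : IFm L [] V}
    (hΔ : Δ = encSeq Γ R) (hΓ : ∀ A ∈ Γ, A.IsH) (hR : R.IsG) {W : Ctx L} (ρ : Sub L V W) :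
    Calc False ambAx F n W (Γ.map (fun Q => Q.subst ρ)) (R.subst ρ) := by
  induction d generalizing n W <;>
    simp only [CutFree, height, nuUses, Set.mem_union, Set.mem_insert_iff,
      Set.mem_iUnion] at hc hn hF
  case init P =>
    obtain ⟨n, rfl⟩ := exists_succ_of_one_le hn
    -- The goal and the negation of the single hypothesis are `P` and its dual in some order, so
    -- goal and hypothesis have the same encoding; as the hypothesis is in `H`, they are equal.
    have key : R.IsH ∧ Γ = {R} := by
      rcases cons_eq_encSeq hΔ with ⟨rfl, h⟩ | ⟨B, Γ', rfl, rfl, h⟩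
      · obtain ⟨A, rfl, hA⟩ := Multiset.map_eq_singleton.1 h.symm
        have hAH := hΓ A (Multiset.mem_singleton_self A)
        obtain rfl := hAH.enc_injective (Fm.dual_injective hA)
        exact ⟨hAH, rfl⟩
      · obtain ⟨h₁, h₂⟩ := (Multiset.singleton_eq_cons_iff _).1 h
        obtain rfl := Multiset.map_eq_zero.1 h₂
        have hBH := hΓ B (Multiset.mem_cons_self _ _)
        obtain rfl := hBH.enc_injective ((Fm.dual_dual _).symm.trans h₁)
        exact ⟨hBH, rfl⟩
    obtain ⟨hRH, rfl⟩ := key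
    exact .ax (.inl ⟨(IFm.isH_subst _ _).2 hRH, Multiset.map_singleton _ _⟩)
  case eq a t =>
    obtain ⟨n, rfl⟩ := exists_succ_of_one_le hn
    rcases cons_eq_encSeq hΔ with ⟨h, h'⟩ | ⟨B, Γ', rfl, h, -⟩
    · cases R <;> simp only [IFm.enc, reduceCtorEq, Fm.eq.injEq] at h
      obtain ⟨rfl, h₁, h₂⟩ := h
      obtain rfl := (eq_of_heq h₁).symm.trans (eq_of_heq h₂)
      exact .ax (.inr (.inl ⟨_, _, rfl⟩))
    · have hB := hΓ B (Multiset.mem_cons_self _ _)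
      cases B <;> first | exact hB.elim | simp only [IFm.neg, IFm.enc, Fm.dual, reduceCtorEq] at h
  case one =>
    rcases cons_eq_encSeq hΔ with ⟨h, -⟩ | ⟨B, Γ', rfl, h, -⟩
    · cases R <;> simp only [IFm.enc, reduceCtorEq] at h
    · have hB := hΓ B (Multiset.mem_cons_self _ _)
      cases B <;> first | exact hB.elim | simp only [IFm.neg, IFm.enc, Fm.dual, reduceCtorEq] at h
  case top =>
    rcases cons_eq_encSeq hΔ with ⟨h, -⟩ | ⟨B, Γ', rfl, h, -⟩
    · cases R <;> simp only [IFm.enc, reduceCtorEq] at h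
    · have hB := hΓ B (Multiset.mem_cons_self _ _)
      cases B <;> first | exact hB.elim | simp only [IFm.neg, IFm.enc, Fm.dual, reduceCtorEq] at h
  all_goals
    obtain ⟨n, rfl, hm⟩ := exists_succ_of_add_one_le hn
    clear hn
    rename' hm => hn
    try simp only [max_le_iff, iSup_le_iff] at hn
  case bot d ih =>
    rcases cons_eq_encSeq hΔ with ⟨h, rfl⟩ | ⟨B, Γ', rfl, h, rfl⟩
    · cases R <;> simp only [IFm.enc, reduceCtorEq] at h
    · have hB := hΓ B (Multiset.mem_cons_self _ _)
      cases B <;> first | exact hB.elim | simp only [IFm.neg, IFm.enc, Fm.dual, reduceCtorEq] at h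
  case par P Q d ih =>
    rcases cons_eq_encSeq hΔ with ⟨h, rfl⟩ | ⟨B, Γ', rfl, h, rfl⟩
    · cases R <;> simp only [IFm.enc, reduceCtorEq, Fm.par.injEq] at h
      obtain ⟨rfl, rfl⟩ := h
      refine .impR ?_
      rw [← Multiset.map_cons (fun Q => IFm.subst Q ρ)]
      refine ih n hc hn hF ?_ (Multiset.forall_mem_cons.2 ⟨hR.1, hΓ⟩) hR.2 ρ
      rw [encSeq_cons, Fm.prename_nil]
    · have hB := hΓ B (Multiset.mem_cons_self _ _)
      rw [Multiset.forall_mem_cons] at hΓ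
      rw [Multiset.map_cons]
      cases B <;> first
        | exact hB.elim
        | simp only [IFm.neg, IFm.enc, Fm.dual, reduceCtorEq, Fm.par.injEq] at h
      obtain ⟨rfl, rfl⟩ := h
      refine .left (.and _ _) fun X σ Θ hΘ => ?_
      cases hΘ
      have := ih n hc hn hF (by rw [← encSeq_cons, ← encSeq_cons]) (Multiset.forall_mem_cons.2
        ⟨hB.1, Multiset.forall_mem_cons.2 ⟨hB.2, hΓ.2⟩⟩) hR (ρ.comp σ)
      simpa only [Multiset.map_cons, Multiset.insert_eq_cons, Multiset.cons_add,
        Multiset.singleton_add, IFm.subst_subst, IFm.map_subst_subst] using this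
  case tensor P Q d e ihd ihe =>
    rcases cons_eq_encSeq hΔ with ⟨h, h'⟩ | ⟨B, Γ', rfl, h, -⟩
    · cases R <;> simp only [IFm.enc, reduceCtorEq, Fm.tensor.injEq] at h
      obtain ⟨rfl, rfl⟩ := h
      obtain ⟨Γ₁, Γ₂, rfl, rfl, rfl⟩ := exists_of_map_eq_add h'
      rw [Multiset.map_add]
      exact .tensorR not_false
        (ihd n hc.1 hn.1 (fun i hi => hF i (.inl hi)) rfl
          (fun A hA => hΓ A (Multiset.mem_add.2 (.inl hA))) hR.1 ρ)
        (ihe n hc.2 hn.2 (fun i hi => hF i (.inr hi)) rfl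
          (fun A hA => hΓ A (Multiset.mem_add.2 (.inr hA))) hR.2 ρ)
    · have hB := hΓ B (Multiset.mem_cons_self _ _)
      cases B <;> first | exact hB.elim | simp only [IFm.neg, IFm.enc, Fm.dual, reduceCtorEq] at h
  case amp P Q d e ihd ihe =>
    rcases cons_eq_encSeq hΔ with ⟨h, rfl⟩ | ⟨B, Γ', rfl, h, rfl⟩
    · cases R <;> simp only [IFm.enc, reduceCtorEq] at h
    · have hB := hΓ B (Multiset.mem_cons_self _ _)
      rw [Multiset.forall_mem_cons] at hΓ
      rw [Multiset.map_cons]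
      cases B <;> first
        | exact hB.elim
        | simp only [IFm.neg, IFm.enc, Fm.dual, reduceCtorEq, Fm.amp.injEq] at h
      obtain ⟨rfl, rfl⟩ := h
      refine .left (.or _ _) fun X σ Θ hΘ => ?_
      have h₁ := ihd n hc.1 hn.1 (fun i hi => hF i (.inl hi)) (by rw [← encSeq_cons])
        (Multiset.forall_mem_cons.2 ⟨hB.1, hΓ.2⟩) hR (ρ.comp σ)
      have h₂ := ihe n hc.2 hn.2 (fun i hi => hF i (.inr hi)) (by rw [← encSeq_cons])
        (Multiset.forall_mem_cons.2 ⟨hB.2, hΓ.2⟩) hR (ρ.comp σ)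
      cases hΘ
      · simpa only [Multiset.map_cons, Multiset.singleton_add, IFm.subst_subst,
          IFm.map_subst_subst] using h₁
      · simpa only [Multiset.map_cons, Multiset.singleton_add, IFm.subst_subst,
          IFm.map_subst_subst] using h₂
  case plusLeft P Q d ih =>
    rcases cons_eq_encSeq hΔ with ⟨h, rfl⟩ | ⟨B, Γ', rfl, h, rfl⟩
    · cases R <;> simp only [IFm.enc, reduceCtorEq, Fm.plus.injEq] at h
      obtain ⟨rfl, rfl⟩ := h
      exact .orRLeft _ _ (ih n hc hn hF rfl hΓ hR.1 ρ)
    · have hB := hΓ B (Multiset.mem_cons_self _ _)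
      cases B <;> first | exact hB.elim | simp only [IFm.neg, IFm.enc, Fm.dual, reduceCtorEq] at h
  case plusRight P Q d ih =>
    rcases cons_eq_encSeq hΔ with ⟨h, rfl⟩ | ⟨B, Γ', rfl, h, rfl⟩
    · cases R <;> simp only [IFm.enc, reduceCtorEq, Fm.plus.injEq] at h
      obtain ⟨rfl, rfl⟩ := h
      exact .orRRight _ _ (ih n hc hn hF rfl hΓ hR.2 ρ)
    · have hB := hΓ B (Multiset.mem_cons_self _ _)
      cases B <;> first | exact hB.elim | simp only [IFm.neg, IFm.enc, Fm.dual, reduceCtorEq] at h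
  case all a P d ih =>
    rcases cons_eq_encSeq hΔ with ⟨h, rfl⟩ | ⟨B, Γ', rfl, h, rfl⟩
    · cases R <;> simp only [IFm.enc, reduceCtorEq, Fm.all.injEq] at h
      rename_i P'
      obtain ⟨rfl, h⟩ := h
      obtain rfl := eq_of_heq h
      refine .allR a _ fun X σ t => ?_
      have := ih n hc hn hF (Γ := Γ.map (fun Q => Q.subst (Sub.weaken _ a))) (R := P')
        (by simp only [encSeq, Multiset.map_map, Function.comp_def, IFm.neg_subst])
        (forall_mem_map_isH hΓ _) hR ((ρ.comp σ).snoc t)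
      rwa [IFm.map_subst_subst, Sub.weaken_comp_snoc, ← IFm.map_subst_subst,
        ← Sub.lift_comp_snoc, ← IFm.subst_subst] at this
    · have hB := hΓ B (Multiset.mem_cons_self _ _)
      rw [Multiset.forall_mem_cons] at hΓ
      rw [Multiset.map_cons]
      cases B <;> first
        | exact hB.elim
        | simp only [IFm.neg, IFm.enc, Fm.dual, reduceCtorEq, Fm.all.injEq] at h
      rename_i P'
      obtain ⟨rfl, h⟩ := h
      obtain rfl := eq_of_heq h
      refine .left (.ex _ _) fun X σ Θ hΘ => ?_
      cases hΘ with
      | ex _ _ _ t =>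
        have := ih n hc hn hF (Γ := P' ::ₘ Γ'.map (fun Q => Q.subst (Sub.weaken _ a)))
          (R := R.subst (Sub.weaken _ a)) (by rw [encSeq_cons, encSeq_subst])
          (Multiset.forall_mem_cons.2 ⟨hB, forall_mem_map_isH hΓ.2 _⟩)
          ((IFm.isG_subst _ _).2 hR) ((ρ.comp σ).snoc t)
        simpa only [Multiset.map_cons, Multiset.singleton_add, IFm.subst_subst,
          IFm.map_subst_subst, Sub.weaken_comp_snoc, Sub.lift_comp_snoc] using this
  case ex a P t d ih =>
    rcases cons_eq_encSeq hΔ with ⟨h, rfl⟩ | ⟨B, Γ', rfl, h, rfl⟩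
    · cases R <;> simp only [IFm.enc, reduceCtorEq, Fm.ex.injEq] at h
      rename_i P'
      obtain ⟨rfl, h⟩ := h
      obtain rfl := eq_of_heq h
      refine Calc.exR_subst a P' ρ (t.subst ρ) ?_
      have := ih n hc hn hF (Γ := Γ) (R := P'.subst (Sub.single t))
        (by rw [encSeq, IFm.enc_subst]) hΓ ((IFm.isG_subst P' _).2 hR) ρ
      rwa [IFm.subst_subst, Sub.single_comp] at this
    · have hB := hΓ B (Multiset.mem_cons_self _ _)
      cases B <;> first | exact hB.elim | simp only [IFm.neg, IFm.enc, Fm.dual, reduceCtorEq] at h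
  case neq a s t d ih =>
    rcases cons_eq_encSeq hΔ with ⟨h, rfl⟩ | ⟨B, Γ', rfl, h, rfl⟩
    · cases R <;> simp only [IFm.enc, reduceCtorEq] at h
    · have hB := hΓ B (Multiset.mem_cons_self _ _)
      rw [Multiset.forall_mem_cons] at hΓ
      rw [Multiset.map_cons]
      cases B <;> first
        | exact hB.elim
        | simp only [IFm.neg, IFm.enc, Fm.dual, reduceCtorEq, Fm.neq.injEq] at h
      obtain ⟨rfl, h₁, h₂⟩ := h
      obtain rfl := eq_of_heq h₁
      obtain rfl := eq_of_heq h₂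
      refine .left (.eq _ _) fun X σ Θ hΘ => ?_
      cases hΘ with
      | eq _ _ _ h =>
        rw [Tm.subst_subst, Tm.subst_subst] at h
        obtain ⟨θ, hθ, σ', hσ'⟩ := c.complete s t (ρ.comp σ) h
        have := ih ⟨θ, hθ⟩ n (hc _) (hn _) (fun i hi => hF i ⟨_, hi⟩)
          (encSeq_subst Γ' R θ.2).symm (forall_mem_map_isH hΓ.2 _)
          ((IFm.isG_subst _ _).2 hR) σ'
        rw [IFm.map_subst_subst, IFm.subst_subst, ← hσ'] at this
        rwa [IFm.map_subst_subst, IFm.subst_subst, zero_add]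
  case mu γ B₀ ts d ih =>
    rcases cons_eq_encSeq hΔ with ⟨h, rfl⟩ | ⟨B, Γ', rfl, h, rfl⟩
    · cases R <;> simp only [IFm.enc, reduceCtorEq, Fm.mu.injEq] at h
      rename_i B _
      obtain ⟨rfl, h, h'⟩ := h
      obtain rfl := eq_of_heq h
      obtain rfl := eq_of_heq h'
      refine .muR B _ ?_
      have := ih n hc hn hF (Γ := Γ) (R := (B.inst (IFm.mu B (Sub.id _))).subst ts)
        (by rw [encSeq, IFm.enc_subst, IFm.enc_inst]; rfl) hΓ
        ((IFm.isG_subst _ _).2 (IFm.IsG.inst (B := B) (S := IFm.mu B (Sub.id _)) hR hR)) ρ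
      rwa [IFm.subst_subst] at this
    · have hB := hΓ B (Multiset.mem_cons_self _ _)
      cases B <;> first | exact hB.elim | simp only [IFm.neg, IFm.enc, Fm.dual, reduceCtorEq] at h
  case nu γ B₀ ts S₀ d e ihd ihe =>
    obtain ⟨S, hS, hSF, hi⟩ := hF _ (.inl rfl)
    simp only at S hS hSF hi
    rcases cons_eq_encSeq hΔ with ⟨h, rfl⟩ | ⟨B, Γ', rfl, h, rfl⟩
    · cases R <;> simp only [IFm.enc, reduceCtorEq, Fm.nu.injEq] at h
      rename_i B _
      obtain ⟨rfl, h, h'⟩ := h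
      obtain rfl := eq_of_heq h
      obtain rfl := eq_of_heq h'
      -- A coinvariant meant for an induction does not fit a goal, but then the operator is both an
      -- encoding and a dual of one in `H`: the goal is vacuous and the premises are dropped.
      rcases hi with ⟨B', hB', h, -⟩ | ⟨B', -, -, rfl⟩
      · exact .ax (.inr (.inr (.inl (IFm.IsH.vacuous_absurd hB' h).1)))
      · refine .nuR B _ S hS hSF ?_ ?_
        · have := ihd n hc.1 hn.1 (fun i hi => hF i (.inr (.inl hi))) (Γ := Γ)
            (R := S.subst ts) (by rw [encSeq, IFm.enc_subst]) hΓ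
            ((IFm.isG_subst _ _).2 hS.isG) ρ
          rwa [IFm.subst_subst] at this
        · have := ihe n hc.2 hn.2 (fun i hi => hF i (.inr (.inr hi))) (Γ := {S})
            (R := B.inst S) (by rw [encSeq_singleton, IFm.enc_inst])
            (fun A hA => by rwa [Multiset.mem_singleton.1 hA])
            (IFm.IsG.inst (B := B) hR hS.isG) (Sub.id _)
          rwa [IFm.map_subst_id, IFm.subst_id] at this
    · have hB := hΓ B (Multiset.mem_cons_self _ _)
      rw [Multiset.forall_mem_cons] at hΓ
      rw [Multiset.map_cons]
      cases B <;> first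
        | exact hB.elim
        | simp only [IFm.neg, IFm.enc, Fm.dual, reduceCtorEq, Fm.nu.injEq] at h
      rename_i B _
      obtain ⟨rfl, h, h'⟩ := h
      obtain rfl := eq_of_heq h
      obtain rfl := eq_of_heq h'
      -- Conversely, a coinvariant meant for a coinduction on a hypothesis makes that hypothesis
      -- absurd.
      rcases hi with ⟨B', -, -, rfl⟩ | ⟨B', -, h, -⟩
      · refine .muL B _ S hS hSF ?_ ?_
        · have := ihd n hc.1 hn.1 (fun i hi => hF i (.inr (.inl hi))) (Γ := S.subst ts ::ₘ Γ')
            (R := R) (by rw [encSeq_cons, IFm.neg_subst])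
            (Multiset.forall_mem_cons.2 ⟨(IFm.isH_subst _ _).2 hS, hΓ.2⟩) hR ρ
          rwa [Multiset.map_cons, IFm.subst_subst] at this
        · have := ihe n hc.2 hn.2 (fun i hi => hF i (.inr (.inr hi))) (Γ := {B.inst S})
            (R := S) (by rw [encSeq_singleton, IFm.neg_inst, Fm.dual_dual, Multiset.pair_comm])
            (fun A hA => by
              rw [Multiset.mem_singleton.1 hA]
              exact IFm.IsH.inst (B := B) hB hS)
            hS.isG (Sub.id _)
          rwa [IFm.map_subst_id, IFm.subst_id] at this
      · exact .ax (.inr (.inr (.inr ⟨_, Multiset.mem_cons_self _ _,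
          (IFm.IsH.vacuous_absurd (D := B) hB h.symm).2⟩)))

/-! ### Quasi-finite muMALL derivations and explicit bounds -/

theorem MALL.exists_bounded {c : CSU L} {V : Ctx L} {Δ : Multiset (Fm L [] V)}
    (d : MALL c V Δ) (hd : d.QuasiFinite) (hi : ∀ i ∈ d.nuUses, EncodesH i) :
    ∃ F : Set (Pred L), F.Finite ∧ ∃ n : ℕ, MALL.Bounded c F n V Δ := by
  obtain ⟨hc, hn, hF⟩ := hd
  obtain ⟨n, h⟩ := ENat.ne_top_iff_exists.1 hn.ne
  let f : Pred L → Σ γ : Ctx L, Fm L [] γ := fun x => ⟨x.1, x.2.enc⟩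
  let g : Pred L → Σ γ : Ctx L, Fm L [] γ := fun x => ⟨x.1, x.2.enc.dual⟩
  -- The finitely many coinvariants are muMALL formulas; injectivity of the encoding and of its dual
  -- on `H` makes the set of predicates that encode to them finite.
  have hf : Set.InjOn f {x | x.2.IsH} := by
    rintro ⟨γ, S⟩ hS ⟨γ', S'⟩ - h
    obtain ⟨rfl, h⟩ := Sigma.mk.inj_iff.1 h
    exact congrArg _ (IFm.IsH.enc_injective hS (eq_of_heq h))
  have hg : Set.InjOn g {x | x.2.IsH} := by
    rintro ⟨γ, S⟩ hS ⟨γ', S'⟩ - h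
    obtain ⟨rfl, h⟩ := Sigma.mk.inj_iff.1 h
    exact congrArg _ (IFm.IsH.enc_injective hS (Fm.dual_injective (eq_of_heq h)))
  refine ⟨{x | x.2.IsH} ∩ f ⁻¹' d.coinvariants ∪ {x | x.2.IsH} ∩ g ⁻¹' d.coinvariants,
    .union ?_ ?_, n, d, hc, h.ge, fun i hid => ?_⟩
  · exact Set.Finite.of_finite_image (f := f) (hF.subset (by rintro _ ⟨x, hx, rfl⟩; exact hx.2))
      (hf.mono Set.inter_subset_left)
  · exact Set.Finite.of_finite_image (f := g) (hF.subset (by rintro _ ⟨x, hx, rfl⟩; exact hx.2))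
      (hg.mono Set.inter_subset_left)
  · obtain ⟨S, hS, h⟩ := hi i hid
    refine ⟨S, hS, ?_, h⟩
    have hmem : (⟨i.1, i.2.2⟩ : Σ γ : Ctx L, Fm L [] γ) ∈ d.coinvariants := ⟨i, hid, rfl⟩
    rcases h with ⟨B, -, -, h⟩ | ⟨B, -, -, h⟩
    · rw [h] at hmem
      exact .inr ⟨hS, hmem⟩
    · rw [h] at hmem
      exact .inl ⟨hS, hmem⟩

theorem MALL.Bounded.exists_quasiFinite {c : CSU L} {F : Set (Pred L)} (hF : F.Finite) {n : ℕ}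
    {V : Ctx L} {Δ : Multiset (Fm L [] V)} (h : MALL.Bounded c F n V Δ) :
    ∃ d : MALL c V Δ, d.QuasiFinite ∧ ∀ i ∈ d.nuUses, EncodesH i := by
  obtain ⟨d, hc, hn, hi⟩ := h
  refine ⟨d, ⟨hc, hn.trans_lt (ENat.natCast_lt_top n), ?_⟩, fun i hid => ?_⟩
  · refine Set.Finite.subset ((hF.image fun x => (⟨x.1, x.2.enc⟩ : Σ γ : Ctx L, Fm L [] γ)).union
      (hF.image fun x => ⟨x.1, x.2.enc.dual⟩)) ?_
    rintro _ ⟨i, hid, rfl⟩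
    obtain ⟨S, -, hSF, h⟩ := hi i hid
    rcases h with ⟨B, -, -, h⟩ | ⟨B, -, -, h⟩
    · exact .inr ⟨_, hSF, congrArg (Sigma.mk i.1) h.symm⟩
    · exact .inl ⟨_, hSF, congrArg (Sigma.mk i.1) h.symm⟩
  · obtain ⟨S, hS, -, h⟩ := hi i hid
    exact ⟨S, hS, h⟩

end MuMALL

/-! ### The equivalence -/

theorem mainTheorem5 {L : MuMALL.Vocabulary} [Nonempty L.Base] (c : MuMALL.CSU L)
    (V : MuMALL.Ctx L) (Γ : Multiset (MuMALL.IFm L [] V)) (P : MuMALL.IFm L [] V)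
    (hΓ : ∀ A ∈ Γ, A.IsH) (hP : P.IsG) :
    (∃ d : MuMALL.LJL c V Γ P, d.QuasiFinite) ↔
      (∃ d : MuMALL.MALL c V (P.enc ::ₘ Γ.map (fun A => A.enc.dual)),
        d.QuasiFinite ∧ ∀ i ∈ d.nuUses, MuMALL.EncodesH i) := by
  open MuMALL in
  -- The uniform bounds start from the formulas of the end sequent.
  let Φ : Set (Pred L) := insert ⟨V, P⟩ {x | ∃ A ∈ Γ, x = ⟨V, A⟩}
  have hΦ : Φ.Finite := by
    refine Set.Finite.insert _ (Set.Finite.subset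
      ((Multiset.finite_toSet Γ).image (Sigma.mk V)) ?_)
    rintro _ ⟨A, hA, rfl⟩
    exact ⟨A, hA, rfl⟩
  have hPΦ : IsInst Φ P := .of_mem (.inl rfl)
  have hΓΦ : ∀ A ∈ Γ, IsHInst Φ A := fun A hA => ⟨hΓ A hA, .of_mem (.inr ⟨A, hA, rfl⟩)⟩
  rw [LJL.exists_quasiFinite_iff]
  constructor
  · rintro ⟨F, hF, n, d⟩
    obtain ⟨K, hK, m, h⟩ := Int.exists_lin n Γ.card hF hΦ
    exact ((h V Γ P d hΓΦ hP hPΦ le_rfl).mallBounded (c := c) hΓ hP).exists_quasiFinite hK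
  · rintro ⟨d, hd, hi⟩
    obtain ⟨F, hF, n, d, hc, hn, hi⟩ := d.exists_bounded hd hi
    have d := d.calc n hc hn hi rfl hΓ hP (Sub.id V)
    rw [IFm.map_subst_id, IFm.subst_id] at d
    obtain ⟨K, hK, m, h⟩ := Calc.exists_int n Γ.card hF hΦ
    exact ⟨K, hK, m, h V Γ P d hΓΦ hP hPΦ le_rfl⟩
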